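/- Let $\Omega\subset\mathbb R^2$ be a bounded domain whose boundary is a finite disjoint union of simple closed polygons with sides $\Gamma_i$, with $\Omega$ on one side only of $\partial\Omega$, and let $n$ be the outward unit normal. Let $\mathcal T_h$ be a conforming triangulation of $\overline\Omega$ with $h_K=\operatorname{diam}K$, $h=\max_K h_K$, $\rho_K$ the radius of the largest ball inscribed in $K$, such that $h_K/\rho_K\le c_\rho$ and $h\le c_q h_K$ for all $K\in\mathcal T_h$. Assume that every $\Gamma_i$ contains at least five element edges and that some triangle either has an edge on $\partial\Omega$ with opposite vertex not on $\partial\Omega$, or has two edges on $\partial\Omega$ (the latter assumption always holds if $\Omega$ is simply connected). For $k\ge1$ let $V_h^k$ be the space of continuous functions on $\overline\Omega$ that are polynomials of degree at most $k$ on each $K\in\mathcal T_h$. Let $\varepsilon>0$, let $\beta\in[W^{1,\infty}(\Omega)]^2$ satisfy $-\tfrac12\nabla\cdot\beta\ge0$ a.e. in $\Omega$ (the case $\sigma=0$ of $\sigma-\frac12\nabla\cdot\beta\ge 0$), let $\partial\Omega^-=\{x\in\partial\Omega:\beta\cdot n<0\}$, and define \[ a_h(u,v)=(\nabla u,\nabla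 v)_\Omega-\langle\nabla u\cdot n,v\rangle_{\partial\Omega}+\langle u,\nabla v\cdot n\rangle_{\partial\Omega}, \] \[ A_h(u,v)=(\beta\cdot\nabla u,v)_\Omega-\langle\beta\cdot n\,u,v\rangle_{\partial\Omega^-}+\varepsilon\,a_h(u,v), \] \[ \|v\|_{1,h}^2=\|\nabla v\|_{L^2(\Omega)}^2+\sum_{K}h_K^{-1}\|v\|_{L^2(\partial\Omega\cap\partial K)}^2,\qquad \|v\|_{1,h,\beta}^2=\varepsilon\|v\|_{1,h}^2+\tfrac12\big\||\beta\cdot n|^{1/2}v\big\|_{L^2(\partial\Omega)}^2 . \] Then there is a constant $c_s>0$, depending only on $\Omega$, $k$, $c_\rho$ and $c_q$ (in particular not on $h$, $\mathcal T_h$, $\varepsilon$ or $\beta$), such that, whenever the local Péclet number satisfies $Pe=|\beta(x)|h/\varepsilon<1$ for all $x\in\Omega$, for all $v_h\in V_h^k$ \[ c_s\|v_h\|_{1,h,\beta}\le\sup_{0\ne w_h\in V_h^k}\frac{A_h(v_h,w_h)}{\|w_h\|_{1,h,\beta}} . \] -/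

import Mathlib

open MeasureTheory

noncomputable section

/-- The Euclidean plane. -/
abbrev Plane : Type := EuclideanSpace ℝ (Fin 2)

/-! ### Polygonal domains -/

/-- `Ω` is a bounded domain whose boundary is a finite disjoint union of simple closed polygons.
The corners are `p i`, the sides are `Γ i = [p i, p (next i)]`, and each cycle of the permutation
`next` is one closed polygon. The condition `interior (closure Ω) = Ω` says that `Ω` lies on one
side only of its boundary (no slits). -/
structure IsPolygonalDomain (Ω : Set Plane) {m : ℕ} (p : Fin m → Plane)
    (next : Equiv.Perm (Fin m)) : Prop where
  isOpen : IsOpen Ω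
  isBounded : Bornology.IsBounded Ω
  isConnected : IsConnected Ω
  regular : interior (closure Ω) = Ω
  corner_injective : Function.Injective p
  next_ne : ∀ i, next i ≠ i
  sides_meet : ∀ i j, i ≠ j →
    segment ℝ (p i) (p (next i)) ∩ segment ℝ (p j) (p (next j)) ⊆
      ({p i, p (next i)} ∩ {p j, p (next j)} : Set Plane)
  frontier_eq : frontier Ω = ⋃ i, segment ℝ (p i) (p (next i))

/-! ### Integrals and normals on straight edges -/

/-- The integral of `f` over the segment `[a, b]` with respect to arc length. -/
def edgeIntegral (a b : Plane) (f : Plane → ℝ) : ℝ :=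
  dist a b * ∫ t in (0 : ℝ)..1, f (AffineMap.lineMap a b t)

/-- The altitude vector of the triangle `a b c`, from the line `a b` to the vertex `c`. -/
def altitudeVec (a b c : Plane) : Plane :=
  (c - a) - (inner ℝ (b - a) (c - a) / ‖b - a‖ ^ 2) • (b - a)

/-- The unit normal of the edge `[a, b]` of the triangle `a b c` that points out of the triangle. -/
def outwardNormal (a b c : Plane) : Plane :=
  -(‖altitudeVec a b c‖⁻¹ • altitudeVec a b c)

/-! ### Velocity fields of class `W^{1,∞}` -/

/-- `g` is the weak partial derivative of `f` in the `j`-th coordinate direction on `Ω`. -/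
def HasWeakPartial (Ω : Set Plane) (j : Fin 2) (f g : Plane → ℝ) : Prop :=
  ∀ φ : Plane → ℝ, ContDiff ℝ ((⊤ : ℕ∞) : WithTop ℕ∞) φ → HasCompactSupport φ → tsupport φ ⊆ Ω →
    ∫ x in Ω, f x * fderiv ℝ φ x (EuclideanSpace.single j 1) = -∫ x in Ω, g x * φ x

/-- `β ∈ [W^{1,∞}(Ω)]²`, given by its representative that is continuous up to the boundary, and
`σ - (1/2) ∇ · β ≥ 0` almost everywhere in `Ω`. -/
structure IsAdmissibleVelocity (Ω : Set Plane) (σ : ℝ) (β : Plane → Plane) : Prop where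
  continuousOn : ContinuousOn β (closure Ω)
  memLp : ∀ i, MemLp (fun x => β x i) ⊤ (volume.restrict Ω)
  weakGradient : ∃ D : Fin 2 → Fin 2 → Plane → ℝ,
    (∀ i j, MemLp (D i j) ⊤ (volume.restrict Ω) ∧ HasWeakPartial Ω j (fun x => β x i) (D i j)) ∧
    ∀ᵐ x ∂(volume.restrict Ω), 0 ≤ σ - 1 / 2 * (D 0 0 x + D 1 1 x)

/-! ### Triangulations -/

/-- A conforming triangulation fitted to `Ω`: finitely many distinct nondegenerate closed triangles
that cover the closure of `Ω`; two of them meet in the convex hull of their common vertices, that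
is, in nothing, a common vertex or a common edge. -/
structure Triangulation (Ω : Set Plane) where
  numCells : ℕ
  vert : Fin numCells → Fin 3 → Plane
  indep : ∀ K, AffineIndependent ℝ (vert K)
  distinct : ∀ K L, K ≠ L → Set.range (vert K) ≠ Set.range (vert L)
  conforming : ∀ K L, convexHull ℝ (Set.range (vert K)) ∩ convexHull ℝ (Set.range (vert L)) ⊆
    convexHull ℝ (Set.range (vert K) ∩ Set.range (vert L))
  covers : ⋃ K, convexHull ℝ (Set.range (vert K)) = closure Ω

namespace Triangulation

variable {Ω : Set Plane} (T : Triangulation Ω)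

/-- The closed triangle with index `K`. -/
def cell (K : Fin T.numCells) : Set Plane := convexHull ℝ (Set.range (T.vert K))

/-- The diameter `h_K`. -/
def hK (K : Fin T.numCells) : ℝ := Metric.diam (T.cell K)

/-- The radius `ρ_K` of the largest ball inscribed in the triangle. -/
def rhoK (K : Fin T.numCells) : ℝ :=
  sSup {r : ℝ | ∃ c : Plane, Metric.closedBall c r ⊆ T.cell K}

/-- The mesh parameter `h`, the largest diameter of a triangle. -/
def h : ℝ := ⨆ K, T.hK K

/-- Shape regularity with constant `cρ`. -/
def ShapeRegular (cρ : ℝ) : Prop := ∀ K, T.hK K / T.rhoK K ≤ cρ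

/-- Quasi-uniformity with constant `cq`. -/
def QuasiUniform (cq : ℝ) : Prop := ∀ K, T.h ≤ cq * T.hK K

/-- An element face is a pair `F = (K, j)`: the edge of the triangle `K` opposite to its `j`-th
vertex. These are the two end points of the face. -/
def faceA (F : Fin T.numCells × Fin 3) : Plane := T.vert F.1 (F.2 + 1)

def faceB (F : Fin T.numCells × Fin 3) : Plane := T.vert F.1 (F.2 + 2)

/-- The vertex of the triangle opposite to the face. -/
def apex (F : Fin T.numCells × Fin 3) : Plane := T.vert F.1 F.2

/-- The face as a closed segment. -/
def face (F : Fin T.numCells × Fin 3) : Set Plane := segment ℝ (T.faceA F) (T.faceB F)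

/-- The outward unit normal on a face. -/
def normal (F : Fin T.numCells × Fin 3) : Plane :=
  outwardNormal (T.faceA F) (T.faceB F) (T.apex F)

open Classical in
/-- The element faces that are contained in a given set. -/
def facesIn (S : Set Plane) : Finset (Fin T.numCells × Fin 3) :=
  Finset.univ.filter fun F => T.face F ⊆ S

/-- The element faces on the boundary of `Ω`; they make up `∂Ω`. -/
def boundaryFaces : Finset (Fin T.numCells × Fin 3) := T.facesIn (frontier Ω)

/-- Some triangle has an edge on `∂Ω` with its opposite vertex off `∂Ω`, or has two edges on `∂Ω`.
(For a simply connected `Ω` this always holds.) -/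
def ResolvesBoundary : Prop :=
  (∃ F ∈ T.boundaryFaces, T.apex F ∉ frontier Ω) ∨
    ∃ F ∈ T.boundaryFaces, ∃ G ∈ T.boundaryFaces, F.1 = G.1 ∧ F ≠ G

/-! ### The finite element space -/

/-- The space `V_h^k` of continuous functions on the closure of `Ω` that are polynomials of degree
at most `k` on every triangle. (Values outside the closure of `Ω` play no role.) -/
def feSpace (k : ℕ) : Set (Plane → ℝ) :=
  {v | ContinuousOn v (closure Ω) ∧
    ∀ K, ∃ q : MvPolynomial (Fin 2) ℝ, q.totalDegree ≤ k ∧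
      ∀ x ∈ T.cell K, v x = MvPolynomial.eval (fun i => x i) q}

/-- The gradient of the restriction of `v` to the triangle `K`, up to the boundary of `K`. -/
def cellGrad (v : Plane → ℝ) (K : Fin T.numCells) (x : Plane) : Plane :=
  gradientWithin v (T.cell K) x

/-- The integral over `Ω` of a function that is given triangle by triangle. -/
def domainIntegral (f : Fin T.numCells → Plane → ℝ) : ℝ := ∑ K, ∫ x in T.cell K, f K x

/-- The integral over `∂Ω` of a function that is given face by face. -/
def boundaryIntegral (f : Fin T.numCells × Fin 3 → Plane → ℝ) : ℝ :=
  ∑ F ∈ T.boundaryFaces, edgeIntegral (T.faceA F) (T.faceB F) (f F)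

/-! ### Bilinear forms and norms -/

/-- The penalty-free non-symmetric Nitsche form of the Laplacian,
`a_h(u, v) = (∇u, ∇v)_Ω - ⟨∇u · n, v⟩_∂Ω + ⟨u, ∇v · n⟩_∂Ω`. -/
def nitscheForm (u v : Plane → ℝ) : ℝ :=
  T.domainIntegral (fun K x => inner ℝ (T.cellGrad u K x) (T.cellGrad v K x))
    - T.boundaryIntegral (fun F x => inner ℝ (T.cellGrad u F.1 x) (T.normal F) * v x)
    + T.boundaryIntegral (fun F x => u x * inner ℝ (T.cellGrad v F.1 x) (T.normal F))

/-- The convection-diffusion-reaction form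
`A_h(u, v) = (σ u + β · ∇u, v)_Ω - ⟨β · n u, v⟩_∂Ω⁻ + ε a_h(u, v)`, where `∂Ω⁻` is the part of the
boundary with `β · n < 0`. -/
def convDiffForm (σ ε : ℝ) (β : Plane → Plane) (u v : Plane → ℝ) : ℝ :=
  T.domainIntegral (fun K x => (σ * u x + inner ℝ (β x) (T.cellGrad u K x)) * v x)
    - T.boundaryIntegral (fun F =>
        {x | inner ℝ (β x) (T.normal F) < 0}.indicator
          fun x => inner ℝ (β x) (T.normal F) * u x * v x)
    + ε * T.nitscheForm u v

/-- `‖v‖²_{1,h} = ‖∇v‖² + ∑_K h_K⁻¹ ‖v‖²_{∂Ω ∩ ∂K}`. -/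
def normSqOneH (v : Plane → ℝ) : ℝ :=
  T.domainIntegral (fun K x => ‖T.cellGrad v K x‖ ^ 2)
    + T.boundaryIntegral (fun F x => (T.hK F.1)⁻¹ * v x ^ 2)

/-- `‖v‖_{1,h,β}`, with `‖v‖²_{1,h,β} = ε ‖v‖²_{1,h} + (1/2) ‖ |β · n|^{1/2} v ‖²_∂Ω`. -/
def normBeta (ε : ℝ) (β : Plane → Plane) (v : Plane → ℝ) : ℝ :=
  Real.sqrt (ε * T.normSqOneH v
    + 1 / 2 * T.boundaryIntegral (fun F x => |inner ℝ (β x) (T.normal F)| * v x ^ 2))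

end Triangulation

end

open MeasureTheory

noncomputable section

/-! ### Vectors in the plane -/

/-! Taking the test function equal to `v` already controls half of the theorem. The two boundary
terms of the Nitsche form cancel, and for `∇ · β ≤ 0` integration by parts gives `A_h(v, v) ≥ ε
‖∇v‖² + (1/2) ‖|β · n|^{1/2} v‖²` (`convDiffForm_self_ge`). What is missing is the trace term `∑
h_K⁻¹ ‖v‖²` on the boundary, since there is no penalty. It is recovered from the term `ε ⟨v, ∇w ·
n⟩` by adding to `v` a small multiple `α w` of a suitable piecewise linear function `w`.

Let `G` be a finite set of nodes, and let `w` take the value `s v(z)` at `z ∈ G`, with a sign `s`,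
and zero at all other nodes. `GoodNodes` asks two things of `G`. First, with `v` replaced by its
nodal values, `⟨v, ∇w · n⟩` is at least `(1/M) ∑_{z ∈ G} v(z)²`. Second, every boundary face is
joined to `G` by a connected set of diameter comparable to `h`. On a mesh that is fine compared with
the sides, `G` consists of the vertices off the boundary that are opposite to boundary faces: the
hat function of such a vertex decreases to zero towards the face, so `s = -1` gives a positive flux
(`flux_innerApexes`). On a coarse mesh `h` is comparable to the diameter of `Ω`, so one such vertex
is enough, or else the vertex between two boundary faces of one triangle, with `s = 1`
(`exists_goodNodes_of_corner`). `exists_goodNodes` combines these cases with a connection radius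
that depends only on `Ω`.

The errors are measured by the oscillation of `v` on the triangles, which the inverse estimate
bounds by the local energy (`exists_inverse_estimate`, `abs_sub_le_of_cellGrad_le`). In particular
the trace term is bounded by the values at `G` plus the energy (`GoodNodes.traceNormSq_le`): along a
connected set, `v` varies by at most the sum of the oscillations on the boundedly many triangles
met. The Péclet condition gives `|β| ≤ ε / h`, so the convective terms have the scaling of the
diffusive ones and constants are independent of `ε` and `β`. The inflow cross term is split by
Young's inequality; its part in `v` is exactly the boundary term of the diagonal, and its part in
`w` is of order `α²`. For small `α` the form at `v + α w` therefore dominates `ε` times energy plus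
nodal values, and hence both squared norms (`exists_test_function`).

The integration by parts needs care because `β` is only continuous with bounded weak derivatives. On
each triangle the weak derivative is tested with a nonnegative function times a smooth cut-off; the
gradient of the cut-off concentrates on the faces and yields the boundary integrals in the limit
(`sum_edgeIntegral_le_integral_cell`). Contributions of interior faces cancel between neighbours,
after pairing these faces from the conformity of the mesh (`sum_faces_eq_sum_boundaryFaces`). -/

lemma plane_inner (x y : Plane) : inner ℝ x y = x 0 * y 0 + x 1 * y 1 := by
  simp [PiLp.inner_apply, Fin.sum_univ_two, mul_comm]

lemma plane_norm_sq (x : Plane) : ‖x‖ ^ 2 = x 0 ^ 2 + x 1 ^ 2 := by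
  rw [← real_inner_self_eq_norm_sq, plane_inner]; ring

lemma plane_ext {x y : Plane} (h0 : x 0 = y 0) (h1 : x 1 = y 1) : x = y := by
  ext i; fin_cases i <;> assumption

/-- Two vectors orthogonal to the same nonzero vector of the plane are parallel. -/
lemma exists_smul_of_inner_eq_zero {u g g' : Plane} (hu : u ≠ 0) (hg : g ≠ 0)
    (h : inner ℝ g u = 0) (h' : inner ℝ g' u = 0) : ∃ μ : ℝ, g' = μ • g := by
  have hg2 : 0 < ‖g‖ ^ 2 := by positivity
  have hu2 : 0 < ‖u‖ ^ 2 := by positivity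
  rw [plane_norm_sq] at hg2 hu2
  rw [plane_inner] at h h'
  have hc : g' 0 * g 1 - g' 1 * g 0 = 0 := by
    have h1 : (g' 0 * g 1 - g' 1 * g 0) * (u 0 ^ 2 + u 1 ^ 2) = 0 := by
      linear_combination (g 1 * u 0 - g 0 * u 1) * h' + (g' 0 * u 1 - g' 1 * u 0) * h
    exact (mul_eq_zero.1 h1).resolve_right hu2.ne'
  refine ⟨(g' 0 * g 0 + g' 1 * g 1) / (g 0 ^ 2 + g 1 ^ 2), plane_ext ?_ ?_⟩
  · simp only [PiLp.smul_apply, smul_eq_mul]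
    field_simp
    linear_combination g 1 * hc
  · simp only [PiLp.smul_apply, smul_eq_mul]
    field_simp
    linear_combination -g 0 * hc

namespace Triangulation

variable {Ω : Set Plane} (T : Triangulation Ω)

/-! ### Barycentric coordinates -/

/-- The vertices of a triangle as an affine basis of the plane. -/
def basis (K : Fin T.numCells) : AffineBasis (Fin 3) ℝ Plane where
  toFun := T.vert K
  ind' := T.indep K
  tot' := by
    rw [(T.indep K).affineSpan_eq_top_iff_card_eq_finrank_add_one]
    simp

/-- The barycentric coordinates of a triangle. -/
def lam (K : Fin T.numCells) (j : Fin 3) : Plane →ᵃ[ℝ] ℝ := (T.basis K).coord j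

/-- The gradients of the barycentric coordinates. -/
def glam (K : Fin T.numCells) (j : Fin 3) : Plane :=
  (InnerProductSpace.toDual ℝ Plane).symm (LinearMap.toContinuousLinearMap (T.lam K j).linear)

lemma lam_vert (K : Fin T.numCells) (i j : Fin 3) :
    T.lam K i (T.vert K j) = if i = j then 1 else 0 :=
  (T.basis K).coord_apply i j

lemma sum_lam (K : Fin T.numCells) (x : Plane) : ∑ j, T.lam K j x = 1 :=
  (T.basis K).sum_coord_apply_eq_one x

lemma sum_lam_smul_vert (K : Fin T.numCells) (x : Plane) :
    ∑ j, T.lam K j x • T.vert K j = x :=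
  (T.basis K).linear_combination_coord_eq_self x

lemma mem_cell {K : Fin T.numCells} {x : Plane} : x ∈ T.cell K ↔ ∀ j, 0 ≤ T.lam K j x := by
  have := (T.basis K).convexHull_eq_nonneg_coord
  exact Set.ext_iff.1 this x

lemma mem_interior_cell {K : Fin T.numCells} {x : Plane} :
    x ∈ interior (T.cell K) ↔ ∀ j, 0 < T.lam K j x := by
  have := (T.basis K).interior_convexHull
  exact Set.ext_iff.1 this x

lemma inner_glam (K : Fin T.numCells) (j : Fin 3) (y : Plane) :
    inner ℝ (T.glam K j) y = (T.lam K j).linear y := by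
  simp [glam]

lemma lam_sub (K : Fin T.numCells) (j : Fin 3) (x y : Plane) :
    T.lam K j x - T.lam K j y = inner ℝ (T.glam K j) (x - y) := by
  rw [inner_glam]
  exact ((T.lam K j).linearMap_vsub x y).symm

lemma continuous_lam (K : Fin T.numCells) (j : Fin 3) : Continuous (T.lam K j) :=
  (T.lam K j).continuous_of_finiteDimensional

lemma lam_le_one {K : Fin T.numCells} {x : Plane} (hx : x ∈ T.cell K) (j : Fin 3) :
    T.lam K j x ≤ 1 := by
  rw [← T.sum_lam K x]
  exact Finset.single_le_sum (f := fun j => T.lam K j x)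
    (fun i _ => T.mem_cell.1 hx i) (Finset.mem_univ j)

lemma sum_glam (K : Fin T.numCells) : ∑ j, T.glam K j = 0 := by
  refine ext_inner_right ℝ fun y => ?_
  rw [sum_inner, inner_zero_left]
  have h1 := T.sum_lam K y
  have h2 := T.sum_lam K 0
  have : ∀ j, inner ℝ (T.glam K j) y = T.lam K j y - T.lam K j 0 := fun j => by
    rw [lam_sub, sub_zero]
  simp only [this, Finset.sum_sub_distrib, h1, h2, sub_self]

lemma vert_mem_cell (K : Fin T.numCells) (j : Fin 3) : T.vert K j ∈ T.cell K :=
  subset_convexHull ℝ _ ⟨j, rfl⟩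

lemma vert_injective (K : Fin T.numCells) : Function.Injective (T.vert K) := (T.indep K).injective

lemma convex_cell (K : Fin T.numCells) : Convex ℝ (T.cell K) := convex_convexHull ℝ _

lemma isCompact_cell (K : Fin T.numCells) : IsCompact (T.cell K) :=
  (Set.finite_range (T.vert K)).isCompact_convexHull (𝕜 := ℝ)

lemma isClosed_cell (K : Fin T.numCells) : IsClosed (T.cell K) := (T.isCompact_cell K).isClosed

lemma cell_subset_closure (K : Fin T.numCells) : T.cell K ⊆ closure Ω := by
  rw [← T.covers]; exact Set.subset_iUnion (fun K => convexHull ℝ (Set.range (T.vert K))) K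

lemma exists_mem_cell {x : Plane} (hx : x ∈ closure Ω) : ∃ K, x ∈ T.cell K := by
  rw [← T.covers] at hx; exact Set.mem_iUnion.1 hx

lemma interior_cell_nonempty (K : Fin T.numCells) : (interior (T.cell K)).Nonempty := by
  exact ⟨_, (T.basis K).centroid_mem_interior_convexHull⟩

/-! ### Faces -/

section faces

variable (F : Fin T.numCells × Fin 3)

lemma faceA_mem_cell : T.faceA F ∈ T.cell F.1 := T.vert_mem_cell _ _

lemma faceB_mem_cell : T.faceB F ∈ T.cell F.1 := T.vert_mem_cell _ _

lemma apex_mem_cell : T.apex F ∈ T.cell F.1 := T.vert_mem_cell _ _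

lemma lam_faceA : T.lam F.1 F.2 (T.faceA F) = 0 := by
  rw [faceA, lam_vert, if_neg]; generalize F.2 = j; fin_cases j <;> decide

lemma lam_faceB : T.lam F.1 F.2 (T.faceB F) = 0 := by
  rw [faceB, lam_vert, if_neg]; generalize F.2 = j; fin_cases j <;> decide

lemma lam_apex : T.lam F.1 F.2 (T.apex F) = 1 := by
  rw [apex, lam_vert, if_pos rfl]

lemma sum_fin_three_shift {M : Type*} [AddCommMonoid M] (f : Fin 3 → M) (j : Fin 3) :
    ∑ i, f i = f j + f (j + 1) + f (j + 2) := by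
  fin_cases j
  · exact Fin.sum_univ_three f
  · simp only [Fin.sum_univ_three]
    change f 0 + f 1 + f 2 = f 1 + f 2 + f 0
    abel
  · simp only [Fin.sum_univ_three]
    change f 0 + f 1 + f 2 = f 2 + f 0 + f 1
    abel

lemma face_subset_cell : T.face F ⊆ T.cell F.1 :=
  (T.convex_cell F.1).segment_subset (T.faceA_mem_cell F) (T.faceB_mem_cell F)

lemma mem_face {F} {x : Plane} : x ∈ T.face F ↔ x ∈ T.cell F.1 ∧ T.lam F.1 F.2 x = 0 := by
  constructor
  · intro hx
    refine ⟨T.face_subset_cell F hx, ?_⟩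
    obtain ⟨a, b, -, -, hab, rfl⟩ := hx
    have := Convex.combo_affine_apply (f := T.lam F.1 F.2) (x := T.faceA F) (y := T.faceB F) hab
    rw [this, lam_faceA, lam_faceB]; simp
  · rintro ⟨hx, h0⟩
    have hs := T.sum_lam F.1 x
    have hv := T.sum_lam_smul_vert F.1 x
    rw [sum_fin_three_shift _ F.2, h0] at hs hv
    refine ⟨T.lam F.1 (F.2 + 1) x, T.lam F.1 (F.2 + 2) x, T.mem_cell.1 hx _, T.mem_cell.1 hx _,
      by linarith, ?_⟩
    rw [zero_smul, zero_add] at hv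
    exact hv

lemma faceA_ne_faceB : T.faceA F ≠ T.faceB F := by
  intro h
  have := T.vert_injective F.1 h
  revert this
  generalize F.2 = j
  fin_cases j <;> decide

lemma glam_inner_face : inner ℝ (T.glam F.1 F.2) (T.faceB F - T.faceA F) = 0 := by
  rw [← lam_sub, lam_faceA, lam_faceB, sub_zero]

lemma glam_inner_apex : inner ℝ (T.glam F.1 F.2) (T.apex F - T.faceA F) = 1 := by
  rw [← lam_sub, lam_faceA, lam_apex, sub_zero]

lemma glam_ne_zero (K : Fin T.numCells) (j : Fin 3) : T.glam K j ≠ 0 := by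
  intro h
  have := T.glam_inner_apex (K, j)
  simp [h] at this

/-- Both vectors are orthogonal to the face, hence parallel. Pairing with the gradient, which gives
`1` on the altitude, fixes the factor. -/
lemma altitudeVec_eq : altitudeVec (T.faceA F) (T.faceB F) (T.apex F)
    = (‖T.glam F.1 F.2‖ ^ 2)⁻¹ • T.glam F.1 F.2 := by
  set g := T.glam F.1 F.2 with hg
  have hgn : g ≠ 0 := T.glam_ne_zero _ _
  have hu : T.faceB F - T.faceA F ≠ 0 := sub_ne_zero.2 (T.faceA_ne_faceB F).symm
  have h1 := T.glam_inner_face F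
  have h2 := T.glam_inner_apex F
  rw [← hg] at h1 h2
  have h3 : inner ℝ (altitudeVec (T.faceA F) (T.faceB F) (T.apex F)) (T.faceB F - T.faceA F)
      = 0 := by
    have : ‖T.faceB F - T.faceA F‖ ≠ 0 := norm_ne_zero_iff.2 hu
    rw [altitudeVec, inner_sub_left, inner_smul_left, real_inner_self_eq_norm_sq,
      real_inner_comm]
    simp only [conj_trivial]
    field_simp
    simp
  obtain ⟨μ, hμ⟩ := exists_smul_of_inner_eq_zero hu hgn h1 h3
  have h4 : inner ℝ g (altitudeVec (T.faceA F) (T.faceB F) (T.apex F)) = 1 := by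
    rw [altitudeVec, inner_sub_right, inner_smul_right, h1, h2]; simp
  rw [hμ, inner_smul_right, real_inner_self_eq_norm_sq] at h4
  rw [hμ, eq_inv_of_mul_eq_one_left h4]

/-- The outward normal is opposite to the gradient of the barycentric coordinate of the apex. -/
lemma normal_eq : T.normal F = -(‖T.glam F.1 F.2‖⁻¹ • T.glam F.1 F.2) := by
  have hg : ‖T.glam F.1 F.2‖ ≠ 0 := norm_ne_zero_iff.2 (T.glam_ne_zero _ _)
  rw [normal, outwardNormal, altitudeVec_eq, norm_smul, smul_smul]
  congr 2
  rw [norm_inv, norm_pow, norm_norm]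
  field_simp

lemma norm_normal : ‖T.normal F‖ = 1 := by
  have hg : ‖T.glam F.1 F.2‖ ≠ 0 := norm_ne_zero_iff.2 (T.glam_ne_zero _ _)
  rw [normal_eq, norm_neg, norm_smul, norm_inv, norm_norm, inv_mul_cancel₀ hg]

/-- Twice the area of a triangle. -/
def dArea (K : Fin T.numCells) : ℝ :=
  |(T.vert K 1 - T.vert K 0) 0 * (T.vert K 2 - T.vert K 0) 1
    - (T.vert K 1 - T.vert K 0) 1 * (T.vert K 2 - T.vert K 0) 0|

lemma dArea_eq : T.dArea F.1 =
    |(T.faceB F - T.faceA F) 0 * (T.apex F - T.faceA F) 1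
    - (T.faceB F - T.faceA F) 1 * (T.apex F - T.faceA F) 0| := by
  obtain ⟨K, j⟩ := F
  simp only [dArea, faceA, faceB, apex]
  congr 1
  fin_cases j
  · change _ = (T.vert K 2 - T.vert K 1) 0 * (T.vert K 0 - T.vert K 1) 1
      - (T.vert K 2 - T.vert K 1) 1 * (T.vert K 0 - T.vert K 1) 0
    simp only [PiLp.sub_apply]; ring
  · change _ = (T.vert K 0 - T.vert K 2) 0 * (T.vert K 1 - T.vert K 2) 1
      - (T.vert K 0 - T.vert K 2) 1 * (T.vert K 1 - T.vert K 2) 0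
    simp only [PiLp.sub_apply]; ring
  · change _ = (T.vert K 1 - T.vert K 0) 0 * (T.vert K 2 - T.vert K 0) 1
      - (T.vert K 1 - T.vert K 0) 1 * (T.vert K 2 - T.vert K 0) 0
    simp only [PiLp.sub_apply]

/-- The height over the face is `1 / ‖∇λ‖`, and twice the area is base times height. In coordinates,
the determinant times the gradient is the edge vector turned by a right angle. -/
lemma dist_face : dist (T.faceA F) (T.faceB F) = T.dArea F.1 * ‖T.glam F.1 F.2‖ := by
  rw [dist_comm, dist_eq_norm, ← abs_of_nonneg (norm_nonneg (T.glam F.1 F.2)), dArea_eq, ← abs_mul,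
    ← abs_of_nonneg (norm_nonneg (_ - _)), ← sq_eq_sq_iff_abs_eq_abs, mul_pow, plane_norm_sq,
    plane_norm_sq]
  have h1 := T.glam_inner_face F
  have h2 := T.glam_inner_apex F
  rw [plane_inner] at h1 h2
  generalize T.faceB F - T.faceA F = u at *
  generalize T.apex F - T.faceA F = w at *
  generalize T.glam F.1 F.2 = g at *
  have e0 : (u 0 * w 1 - u 1 * w 0) * g 1 = u 0 := by
    linear_combination u 0 * h2 - w 0 * h1
  have e1 : (u 0 * w 1 - u 1 * w 0) * g 0 = -u 1 := by
    linear_combination -u 1 * h2 + w 1 * h1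
  linear_combination -(u 0 + (u 0 * w 1 - u 1 * w 0) * g 1) * e0
    - ((u 0 * w 1 - u 1 * w 0) * g 0 - u 1) * e1

lemma dist_face_pos : 0 < dist (T.faceA F) (T.faceB F) := dist_pos.2 (T.faceA_ne_faceB F)

/-- The normal scaled by the length of the face. -/
lemma dist_smul_normal : dist (T.faceA F) (T.faceB F) • T.normal F
    = -(T.dArea F.1 • T.glam F.1 F.2) := by
  have hg : ‖T.glam F.1 F.2‖ ≠ 0 := norm_ne_zero_iff.2 (T.glam_ne_zero _ _)
  rw [normal_eq, dist_face, smul_neg, smul_smul, mul_assoc, mul_inv_cancel₀ hg, mul_one]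

lemma dArea_pos (K : Fin T.numCells) : 0 < T.dArea K := by
  have h1 := T.dist_face_pos (K, 0)
  rw [dist_face] at h1
  exact pos_of_mul_pos_left h1 (norm_nonneg _)

end faces

/-! ### Neighbouring triangles -/

/-- By conformity `x` lies in the hull of the common vertices. If vertex `j` is not common, the
coordinate `λ_j` vanishes on this hull. -/
lemma vert_mem_range_of_lam_ne_zero {K L : Fin T.numCells} {x : Plane} (hK : x ∈ T.cell K)
    (hL : x ∈ T.cell L) {j : Fin 3} (hj : T.lam K j x ≠ 0) : T.vert K j ∈ Set.range (T.vert L) := by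
  by_contra hn
  apply hj
  have hx := T.conforming K L ⟨hK, hL⟩
  have hc : Convex ℝ {y | T.lam K j y = 0} :=
    (convex_singleton (0 : ℝ)).affine_preimage (T.lam K j)
  refine convexHull_min ?_ hc hx
  rintro _ ⟨⟨i, rfl⟩, hi⟩
  rw [Set.mem_ofPred_eq, lam_vert, if_neg]
  rintro rfl
  exact hn hi

/-- At an interior point of `K` no coordinate vanishes, so all three vertices of `K` are vertices of
`L`, and distinct triangles have distinct vertex sets. -/
lemma eq_of_mem_interior_cell {K L : Fin T.numCells} {x : Plane} (hK : x ∈ interior (T.cell K))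
    (hL : x ∈ T.cell L) : K = L := by
  by_contra hne
  refine T.distinct K L hne ?_
  have h : ∀ j, ∃ i, T.vert L i = T.vert K j := fun j =>
    T.vert_mem_range_of_lam_ne_zero (interior_subset hK) hL (T.mem_interior_cell.1 hK j).ne'
  choose f hf using h
  have hinj : Function.Injective f := fun a b hab => T.vert_injective K (by rw [← hf, ← hf, hab])
  have hsurj := Finite.surjective_of_injective hinj
  have : T.vert K = T.vert L ∘ f := funext fun j => (hf j).symm
  rw [this, hsurj.range_comp]

/-- Two faces of different triangles are partners if they have the same end points. -/
def Partner (F G : Fin T.numCells × Fin 3) : Prop :=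
  F.1 ≠ G.1 ∧ ({T.faceA F, T.faceB F} : Set Plane) = {T.faceA G, T.faceB G}

lemma Partner.symm {F G : Fin T.numCells × Fin 3} (h : T.Partner F G) : T.Partner G F :=
  ⟨h.1.symm, h.2.symm⟩

lemma partner_ends {F G : Fin T.numCells × Fin 3} (h : T.Partner F G) :
    (T.faceA F = T.faceA G ∧ T.faceB F = T.faceB G) ∨
      (T.faceA F = T.faceB G ∧ T.faceB F = T.faceA G) :=
  Set.pair_eq_pair_iff.1 h.2

lemma mem_openFace {F : Fin T.numCells × Fin 3} {x : Plane} :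
    x ∈ openSegment ℝ (T.faceA F) (T.faceB F) ↔
      T.lam F.1 F.2 x = 0 ∧ ∀ i, i ≠ F.2 → 0 < T.lam F.1 i x := by
  constructor
  · rintro ⟨a, b, ha, hb, hab, rfl⟩
    have h := fun i => Convex.combo_affine_apply (f := T.lam F.1 i) (x := T.faceA F)
      (y := T.faceB F) hab
    refine ⟨?_, fun i hi => ?_⟩
    · rw [h, lam_faceA, lam_faceB]; simp
    · rw [h, faceA, faceB, lam_vert, lam_vert]
      have : i = F.2 + 1 ∧ i ≠ F.2 + 2 ∨ i = F.2 + 2 ∧ i ≠ F.2 + 1 := by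
        revert hi; generalize F.2 = j; revert i j; decide
      rcases this with ⟨h1, h2⟩ | ⟨h1, h2⟩
      · rw [if_pos h1, if_neg h2]; simpa using ha
      · rw [if_pos h1, if_neg h2]; simpa using hb
  · rintro ⟨h0, h1⟩
    have hs := T.sum_lam F.1 x
    have hv := T.sum_lam_smul_vert F.1 x
    rw [sum_fin_three_shift _ F.2, h0] at hs hv
    rw [zero_smul, zero_add] at hv
    have e1 : F.2 + 1 ≠ F.2 := by generalize F.2 = j; revert j; decide
    have e2 : F.2 + 2 ≠ F.2 := by generalize F.2 = j; revert j; decide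
    exact ⟨T.lam F.1 (F.2 + 1) x, T.lam F.1 (F.2 + 2) x, h1 _ e1, h1 _ e2, by linarith, hv⟩

lemma partner_openFace {F G : Fin T.numCells × Fin 3} (h : T.Partner F G) :
    openSegment ℝ (T.faceA F) (T.faceB F) = openSegment ℝ (T.faceA G) (T.faceB G) := by
  rcases T.partner_ends h with ⟨h1, h2⟩ | ⟨h1, h2⟩
  · rw [h1, h2]
  · rw [h1, h2, openSegment_symm]

lemma midpoint_mem_openFace (F : Fin T.numCells × Fin 3) :
    midpoint ℝ (T.faceA F) (T.faceB F) ∈ openSegment ℝ (T.faceA F) (T.faceB F) :=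
  midpoint_mem_openSegment _ _

/-- Near an inner point of a face, the triangle is the half plane where the barycentric coordinate
of the apex is nonnegative. -/
lemma eventually_lam_pos {F : Fin T.numCells × Fin 3} {x : Plane}
    (hx : x ∈ openSegment ℝ (T.faceA F) (T.faceB F)) :
    ∀ᶠ y in nhds x, ∀ i, i ≠ F.2 → 0 < T.lam F.1 i y := by
  rw [Filter.eventually_all]
  intro i
  by_cases hi : i = F.2
  · exact Filter.Eventually.of_forall fun y h => absurd hi h
  · filter_upwards [(T.continuous_lam F.1 i).continuousAt.eventually
      (lt_mem_nhds ((T.mem_openFace.1 hx).2 i hi))] with y hy _ using hy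

/-- The coordinates of the two apexes vanish on the same line, hence are proportional. With a
positive factor both triangles would lie on the same side of the face, and a point slightly off its
midpoint would be interior to both. -/
lemma partner_glam {F G : Fin T.numCells × Fin 3} (h : T.Partner F G) :
    ∃ μ < (0 : ℝ), T.glam G.1 G.2 = μ • T.glam F.1 F.2 ∧
      ∀ x, T.lam G.1 G.2 x = μ * T.lam F.1 F.2 x := by
  have hu : T.faceB F - T.faceA F ≠ 0 := sub_ne_zero.2 (T.faceA_ne_faceB F).symm
  have hG : inner ℝ (T.glam G.1 G.2) (T.faceB F - T.faceA F) = 0 := by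
    rcases T.partner_ends h with ⟨h1, h2⟩ | ⟨h1, h2⟩
    · rw [h1, h2, glam_inner_face]
    · rw [h1, h2, ← neg_sub, inner_neg_right, glam_inner_face, neg_zero]
  obtain ⟨μ, hμ⟩ := exists_smul_of_inner_eq_zero hu (T.glam_ne_zero _ _) (T.glam_inner_face F) hG
  have hA : T.lam G.1 G.2 (T.faceA F) = 0 := by
    rcases T.partner_ends h with ⟨h1, h2⟩ | ⟨h1, h2⟩
    · rw [h1, lam_faceA]
    · rw [h1, lam_faceB]
  have hlam : ∀ x, T.lam G.1 G.2 x = μ * T.lam F.1 F.2 x := fun x => by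
    have h1 := T.lam_sub G.1 G.2 x (T.faceA F)
    have h2 := T.lam_sub F.1 F.2 x (T.faceA F)
    rw [hA, hμ, inner_smul_left, sub_zero] at h1
    rw [lam_faceA, sub_zero] at h2
    rw [h1, h2]; simp
  refine ⟨μ, ?_, hμ, hlam⟩
  by_contra hneg
  have hμ0 : μ ≠ 0 := by
    rintro rfl
    exact T.glam_ne_zero G.1 G.2 (by rw [hμ, zero_smul])
  have hμpos : 0 < μ := lt_of_le_of_ne (not_lt.1 hneg) hμ0.symm
  have hxF := T.midpoint_mem_openFace F
  have hxG := hxF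
  rw [T.partner_openFace h] at hxG
  set x := midpoint ℝ (T.faceA F) (T.faceB F)
  have hev := (T.eventually_lam_pos hxF).and (T.eventually_lam_pos hxG)
  have hcont : Filter.Tendsto (fun t : ℝ => x + t • T.glam F.1 F.2) (nhdsWithin 0 (Set.Ioi 0))
      (nhds x) := by
    have : Continuous fun t : ℝ => x + t • T.glam F.1 F.2 := by fun_prop
    simpa using (this.tendsto 0).mono_left nhdsWithin_le_nhds
  obtain ⟨t, ⟨h1, h2⟩, ht⟩ := ((hcont.eventually hev).and self_mem_nhdsWithin).exists
  have hF : 0 < T.lam F.1 F.2 (x + t • T.glam F.1 F.2) := by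
    have h3 := T.lam_sub F.1 F.2 (x + t • T.glam F.1 F.2) x
    rw [(T.mem_openFace.1 hxF).1, sub_zero, add_sub_cancel_left, inner_smul_right,
      real_inner_self_eq_norm_sq] at h3
    rw [h3]
    have := norm_pos_iff.2 (T.glam_ne_zero F.1 F.2)
    have ht' : 0 < t := ht
    positivity
  have hG' : 0 < T.lam G.1 G.2 (x + t • T.glam F.1 F.2) := by
    rw [hlam]; positivity
  refine h.1 (T.eq_of_mem_interior_cell (x := x + t • T.glam F.1 F.2)
    (T.mem_interior_cell.2 fun i => ?_)
    (interior_subset (T.mem_interior_cell.2 fun i => ?_)))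
  · by_cases hi : i = F.2
    · rw [hi]; exact hF
    · exact h1 i hi
  · by_cases hi : i = G.2
    · rw [hi]; exact hG'
    · exact h2 i hi

lemma partner_normal {F G : Fin T.numCells × Fin 3} (h : T.Partner F G) :
    T.normal G = -T.normal F := by
  obtain ⟨μ, hμ, hg, -⟩ := T.partner_glam h
  have hgn : ‖T.glam F.1 F.2‖ ≠ 0 := norm_ne_zero_iff.2 (T.glam_ne_zero _ _)
  rw [normal_eq, normal_eq, hg, norm_smul, smul_smul, Real.norm_of_nonpos hμ.le, neg_neg]
  rw [← neg_smul]
  congr 1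
  field_simp [hμ.ne]

/-- Three different triangles on one face would be pairwise on opposite sides of it. The product of
two of the negative factors would have to equal the third. -/
lemma partner_unique {F G G' : Fin T.numCells × Fin 3} (h : T.Partner F G) (h' : T.Partner F G') :
    G = G' := by
  have hends := h.2.symm.trans h'.2
  by_cases hc : G.1 = G'.1
  · refine Prod.ext hc ?_
    by_contra hne
    -- Two faces of the same triangle differ: the vertex opposite to the second one is an end point
    -- of the first.
    have hmem : T.vert G.1 G'.2 ∈ ({T.faceA G, T.faceB G} : Set Plane) := by
      have : G'.2 = G.2 + 1 ∨ G'.2 = G.2 + 2 := by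
        revert hne; generalize G.2 = i; generalize G'.2 = j; revert i j; decide
      rcases this with h1 | h1
      · left; rw [h1]; rfl
      · right; rw [h1]; rfl
    rw [hends, hc] at hmem
    have key : ∀ j : Fin 3, j ≠ j + 1 ∧ j ≠ j + 2 := by decide
    rcases hmem with h1 | h1
    · exact (key _).1 (T.vert_injective _ h1)
    · exact (key _).2 (T.vert_injective _ h1)
  · exfalso
    obtain ⟨μ, hμ, -, h1⟩ := T.partner_glam h
    obtain ⟨μ', hμ', -, h2⟩ := T.partner_glam h'
    obtain ⟨ν, hν, -, h3⟩ := T.partner_glam (F := G) (G := G') ⟨hc, hends⟩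
    have h4 := h3 (T.apex F)
    rw [h1, h2, lam_apex] at h4
    nlinarith [mul_pos_of_neg_of_neg hν hμ]

/-- Close to an inner point of the face, each of the two triangles fills the half plane on its side.
-/
lemma partner_mem_nhds {F G : Fin T.numCells × Fin 3} (h : T.Partner F G) {x : Plane}
    (hx : x ∈ openSegment ℝ (T.faceA F) (T.faceB F)) :
    x ∈ interior (closure Ω) := by
  rw [mem_interior_iff_mem_nhds]
  have hxG := hx
  rw [T.partner_openFace h] at hxG
  obtain ⟨μ, hμ, -, hlam⟩ := T.partner_glam h
  filter_upwards [T.eventually_lam_pos hx, T.eventually_lam_pos hxG] with y h1 h2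
  rcases le_total 0 (T.lam F.1 F.2 y) with h0 | h0
  · refine T.cell_subset_closure F.1 (T.mem_cell.2 fun i => ?_)
    by_cases hi : i = F.2
    · rwa [hi]
    · exact (h1 i hi).le
  · refine T.cell_subset_closure G.1 (T.mem_cell.2 fun i => ?_)
    by_cases hi : i = G.2
    · rw [hi, hlam]; exact mul_nonneg_of_nonpos_of_nonpos hμ.le h0
    · exact (h2 i hi).le

/-- A small step out of the triangle across the face stays in the open set `Ω` and so lands in a
triangle. Being one of finitely many closed sets, this triangle also contains `x` if the step is
short; by conformity it then has both end points of the face as vertices. -/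
lemma exists_partner_of_mem (hΩ : IsOpen Ω) {F : Fin T.numCells × Fin 3} {x : Plane}
    (hx : x ∈ openSegment ℝ (T.faceA F) (T.faceB F)) (hxΩ : x ∈ Ω) : ∃ G, T.Partner F G := by
  have hU : ∀ᶠ y in nhds x, y ∈ Ω ∧ ∀ L, x ∉ T.cell L → y ∉ T.cell L := by
    refine Filter.Eventually.and (hΩ.mem_nhds hxΩ) ?_
    rw [Filter.eventually_all]
    intro L
    by_cases hL : x ∈ T.cell L
    · exact Filter.Eventually.of_forall fun y h => absurd hL h
    · filter_upwards [(T.isClosed_cell L).isOpen_compl.mem_nhds hL] with y hy _ using hy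
  have hcont : Filter.Tendsto (fun t : ℝ => x - t • T.glam F.1 F.2) (nhdsWithin 0 (Set.Ioi 0))
      (nhds x) := by
    have : Continuous fun t : ℝ => x - t • T.glam F.1 F.2 := by fun_prop
    simpa using (this.tendsto 0).mono_left nhdsWithin_le_nhds
  obtain ⟨t, ⟨h1, h2⟩, ht⟩ := ((hcont.eventually hU).and self_mem_nhdsWithin).exists
  obtain ⟨L, hL⟩ := T.exists_mem_cell (subset_closure h1)
  have hxL : x ∈ T.cell L := by
    by_contra hn
    exact h2 L hn hL
  have hxF := T.mem_openFace.1 hx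
  have hlt : T.lam F.1 F.2 (x - t • T.glam F.1 F.2) < 0 := by
    have h3 := T.lam_sub F.1 F.2 (x - t • T.glam F.1 F.2) x
    rw [hxF.1, sub_zero, sub_sub_cancel_left, inner_neg_right, inner_smul_right,
      real_inner_self_eq_norm_sq] at h3
    rw [h3]
    have := norm_pos_iff.2 (T.glam_ne_zero F.1 F.2)
    have ht' : 0 < t := ht
    rw [neg_lt_zero]
    positivity
  have hne : F.1 ≠ L := by
    rintro rfl
    exact absurd (T.mem_cell.1 hL F.2) (not_le.2 hlt)
  have hxK : x ∈ T.cell F.1 := T.mem_cell.2 fun i => by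
    by_cases hi : i = F.2
    · rw [hi, hxF.1]
    · exact (hxF.2 i hi).le
  have e1 : F.2 + 1 ≠ F.2 := by generalize F.2 = j; revert j; decide
  have e2 : F.2 + 2 ≠ F.2 := by generalize F.2 = j; revert j; decide
  obtain ⟨a, ha⟩ := T.vert_mem_range_of_lam_ne_zero hxK hxL (hxF.2 _ e1).ne'
  obtain ⟨b, hb⟩ := T.vert_mem_range_of_lam_ne_zero hxK hxL (hxF.2 _ e2).ne'
  have hab : a ≠ b := by
    rintro rfl
    exact T.faceA_ne_faceB F (ha.symm.trans hb)
  have : ∃ c : Fin 3, (a = c + 1 ∧ b = c + 2) ∨ (b = c + 1 ∧ a = c + 2) := by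
    revert a b hab; intro a _ b _ hab
    clear * - hab
    revert a b; decide
  obtain ⟨c, hc⟩ := this
  refine ⟨(L, c), hne, ?_⟩
  have hA : T.faceA F = T.vert L a := ha.symm
  have hB : T.faceB F = T.vert L b := hb.symm
  rw [hA, hB, faceA, faceB]
  rcases hc with ⟨rfl, rfl⟩ | ⟨rfl, rfl⟩
  · rfl
  · exact Set.pair_comm _ _

lemma mem_boundaryFaces {F : Fin T.numCells × Fin 3} :
    F ∈ T.boundaryFaces ↔ T.face F ⊆ frontier Ω := by
  simp [boundaryFaces, facesIn]

lemma not_partner_of_mem_boundaryFaces (hΩ : IsOpen Ω) (hreg : interior (closure Ω) = Ω)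
    {F : Fin T.numCells × Fin 3} (hF : F ∈ T.boundaryFaces)
    (G : Fin T.numCells × Fin 3) : ¬ T.Partner F G := by
  intro h
  have h1 := T.partner_mem_nhds h (T.midpoint_mem_openFace F)
  rw [hreg] at h1
  have h2 := T.mem_boundaryFaces.1 hF (openSegment_subset_segment ℝ _ _ (T.midpoint_mem_openFace F))
  rw [hΩ.frontier_eq] at h2
  exact h2.2 h1

lemma exists_partner (hΩ : IsOpen Ω) {F : Fin T.numCells × Fin 3} (hF : F ∉ T.boundaryFaces) :
    ∃ G, T.Partner F G := by
  rw [mem_boundaryFaces, Set.not_subset] at hF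
  obtain ⟨x, hx, hxf⟩ := hF
  have hxΩ : x ∈ Ω := by
    by_contra hn
    exact hxf (by rw [hΩ.frontier_eq]
                  exact ⟨T.cell_subset_closure _ (T.face_subset_cell F hx), hn⟩)
  have hcl : x ∈ closure (openSegment ℝ (T.faceA F) (T.faceB F)) := by
    rwa [closure_openSegment]
  obtain ⟨y, hyΩ, hy⟩ := mem_closure_iff.1 hcl Ω hΩ hxΩ
  exact T.exists_partner_of_mem hΩ hy hyΩ

/-- A boundary point that is not a vertex is an inner point of a boundary face. -/
lemma exists_boundaryFace (hΩ : IsOpen Ω) (hreg : interior (closure Ω) = Ω) {x : Plane} (hx : x ∈ frontier Ω) (hv : ∀ K j, x ≠ T.vert K j) :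
    ∃ F ∈ T.boundaryFaces, x ∈ openSegment ℝ (T.faceA F) (T.faceB F) := by
  have hx' := hx
  rw [hΩ.frontier_eq] at hx'
  obtain ⟨K, hK⟩ := T.exists_mem_cell hx'.1
  have h0 : ∃ j, T.lam K j x = 0 := by
    by_contra! hne
    have : x ∈ interior (T.cell K) := T.mem_interior_cell.2 fun j =>
      lt_of_le_of_ne (T.mem_cell.1 hK j) (hne j).symm
    have := interior_mono (T.cell_subset_closure K) this
    rw [hreg] at this
    exact hx'.2 this
  obtain ⟨j, hj⟩ := h0
  have hpos : ∀ i, i ≠ j → 0 < T.lam K i x := by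
    intro i hij
    refine lt_of_le_of_ne (T.mem_cell.1 hK i) fun h => ?_
    have : ∃ l, ∀ i', i' = j ∨ i' = i ∨ i' = l := by
      clear * - hij; revert i j; decide
    obtain ⟨l, hl⟩ := this
    have hz : ∀ i', i' ≠ l → T.lam K i' x = 0 := by
      intro i' hi'
      rcases hl i' with rfl | rfl | rfl
      · exact hj
      · exact h.symm
      · exact absurd rfl hi'
    have hs := T.sum_lam K x
    have hsv := T.sum_lam_smul_vert K x
    rw [Finset.sum_eq_single l (fun i' _ hi' => hz i' hi') (by simp)] at hs
    rw [Finset.sum_eq_single l (fun i' _ hi' => by rw [hz i' hi', zero_smul]) (by simp), hs,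
      one_smul] at hsv
    exact hv K l hsv.symm
  have hxo : x ∈ openSegment ℝ (T.faceA (K, j)) (T.faceB (K, j)) := T.mem_openFace.2 ⟨hj, hpos⟩
  refine ⟨(K, j), ?_, hxo⟩
  by_contra hF
  obtain ⟨G, hG⟩ := T.exists_partner hΩ hF
  have := T.partner_mem_nhds hG hxo
  rw [hreg] at this
  exact hx'.2 this

/-- A quantity that is odd under the passage to the neighbouring triangle sums up to its boundary
part. -/
lemma sum_faces_eq_sum_boundaryFaces (hΩ : IsOpen Ω) (hreg : interior (closure Ω) = Ω)
    (e : Fin T.numCells × Fin 3 → ℝ)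
    (he : ∀ F G, T.Partner F G → e G = -e F) :
    ∑ F, e F = ∑ F ∈ T.boundaryFaces, e F := by
  classical
  rw [← Finset.sum_add_sum_compl T.boundaryFaces e, add_eq_left]
  have hex : ∀ F ∈ (T.boundaryFaces)ᶜ, ∃ G, T.Partner F G := fun F hF =>
    T.exists_partner hΩ (Finset.mem_compl.1 hF)
  choose! g hg using hex
  -- Passing to the partner is an involution without fixed points on the interior faces, and the two
  -- terms of each pair cancel.
  refine Finset.sum_involution (fun F _ => g F) ?_ ?_ ?_ ?_
  · intro F hF
    rw [he F _ (hg F hF), add_neg_cancel]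
  · intro F hF _ h
    exact (hg F hF).1 (by rw [h])
  · intro F hF
    rw [Finset.mem_compl]
    intro hb
    exact T.not_partner_of_mem_boundaryFaces hΩ hreg hb F (hg F hF).symm
  · intro F hF
    have hm : g F ∈ (T.boundaryFaces)ᶜ := by
      rw [Finset.mem_compl]
      intro hb
      exact T.not_partner_of_mem_boundaryFaces hΩ hreg hb F (hg F hF).symm
    exact T.partner_unique (hg _ hm) (hg F hF).symm

end Triangulation

/-! ### Affine coordinates in plane integrals -/

lemma integral_plane_eq_integral_prod (f : Plane → ℝ) (a u w : Plane)
    (hdet : u 0 * w 1 - u 1 * w 0 ≠ 0) :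
    ∫ x, f x = |u 0 * w 1 - u 1 * w 0| * ∫ p : ℝ × ℝ, f (a + p.1 • u + p.2 • w) := by
  set Mx : Matrix (Fin 2) (Fin 2) ℝ := !![u 0, w 0; u 1, w 1] with hMx
  have hM : Mx.det = u 0 * w 1 - u 1 * w 0 := by
    rw [hMx, Matrix.det_fin_two_of]; ring
  have hd : Mx.det ≠ 0 := by rwa [hM]
  have hmap := Real.map_matrix_volume_pi_eq_smul_volume_pi hd
  have hemb : MeasurableEmbedding (Matrix.toLin' Mx) := by
    have hinj : Function.Injective (Matrix.toLin' Mx) := by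
      have := Matrix.mulVec_injective_iff_isUnit.2 ((Matrix.isUnit_iff_isUnit_det _).2
        (isUnit_iff_ne_zero.2 hd))
      exact this
    exact ((Matrix.toLin' Mx).continuous_of_finiteDimensional).measurableEmbedding hinj
  have h1 : ∫ x, f x = ∫ x, f (a + x) := (integral_add_left_eq_self f a).symm
  have h2 : ∫ x, f (a + x) = ∫ y : Fin 2 → ℝ, f (a + WithLp.toLp 2 y) :=
    ((PiLp.volume_preserving_toLp (Fin 2)).integral_comp
      (MeasurableEquiv.toLp 2 (Fin 2 → ℝ)).measurableEmbedding (fun x => f (a + x))).symm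
  have h3 : ∫ y : Fin 2 → ℝ, f (a + WithLp.toLp 2 (Matrix.toLin' Mx y))
      = |Mx.det⁻¹| * ∫ y : Fin 2 → ℝ, f (a + WithLp.toLp 2 y) := by
    rw [← hemb.integral_map (fun y => f (a + WithLp.toLp 2 y)), hmap, integral_smul_measure,
      ENNReal.toReal_ofReal (abs_nonneg _), smul_eq_mul]
  have h4 : ∫ y : Fin 2 → ℝ, f (a + WithLp.toLp 2 (Matrix.toLin' Mx y))
      = ∫ p : ℝ × ℝ, f (a + p.1 • u + p.2 • w) := by
    rw [← (volume_preserving_finTwoArrow ℝ).integral_comp']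
    refine integral_congr_ae (Filter.Eventually.of_forall fun y => ?_)
    simp only [MeasurableEquiv.finTwoArrow_apply]
    congr 1
    rw [add_assoc]
    congr 1
    apply plane_ext
    · simp [hMx, Matrix.mulVec, dotProduct, Fin.sum_univ_two]; ring
    · simp [hMx, Matrix.mulVec, dotProduct, Fin.sum_univ_two]; ring
  rw [h1, h2, ← h4, h3, ← hM, abs_inv, ← mul_assoc, mul_inv_cancel₀ (abs_ne_zero.2 hd), one_mul]

/-! ### A smooth step -/

/-- A smooth function with value `0` on `(-∞, 1]` and value `1` on `[2, ∞)`. -/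
def smoothStep (t : ℝ) : ℝ := Real.smoothTransition (t - 1)

lemma smoothStep_contDiff : ContDiff ℝ ((⊤ : ℕ∞) : WithTop ℕ∞) smoothStep :=
  Real.smoothTransition.contDiff.comp (contDiff_id.sub contDiff_const)

lemma smoothStep_eq_zero {t : ℝ} (ht : t ≤ 1) : smoothStep t = 0 :=
  Real.smoothTransition.zero_of_nonpos (by linarith)

lemma smoothStep_eq_one {t : ℝ} (ht : 2 ≤ t) : smoothStep t = 1 :=
  Real.smoothTransition.one_of_one_le (by linarith)

lemma smoothStep_nonneg (t : ℝ) : 0 ≤ smoothStep t := Real.smoothTransition.nonneg _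

lemma smoothStep_le_one (t : ℝ) : smoothStep t ≤ 1 := Real.smoothTransition.le_one _

lemma smoothStep_hasDerivAt (t : ℝ) : HasDerivAt smoothStep (deriv smoothStep t) t :=
  ((smoothStep_contDiff.differentiable (by simp)) t).hasDerivAt

lemma continuous_deriv_smoothStep : Continuous (deriv smoothStep) :=
  smoothStep_contDiff.continuous_deriv (by simp)

lemma deriv_smoothStep_eq_zero {t : ℝ} (ht : t ∉ Set.Icc (1 : ℝ) 2) : deriv smoothStep t = 0 := by
  rcases lt_or_ge t 1 with h | h
  · have : smoothStep =ᶠ[nhds t] fun _ => 0 := by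
      filter_upwards [gt_mem_nhds h] with s hs using smoothStep_eq_zero hs.le
    rw [this.deriv_eq]; simp
  · have h2 : 2 < t := by
      by_contra hn
      exact ht ⟨h, not_lt.1 hn⟩
    have : smoothStep =ᶠ[nhds t] fun _ => 1 := by
      filter_upwards [lt_mem_nhds h2] with s hs using smoothStep_eq_one hs.le
    rw [this.deriv_eq]; simp

lemma exists_bound_deriv_smoothStep : ∃ C, 0 ≤ C ∧ ∀ t, |deriv smoothStep t| ≤ C := by
  obtain ⟨C, hC⟩ := (isCompact_Icc (a := (1 : ℝ)) (b := 2)).exists_bound_of_continuousOn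
    continuous_deriv_smoothStep.continuousOn
  refine ⟨max C 0, le_max_right _ _, fun t => ?_⟩
  by_cases ht : t ∈ Set.Icc (1 : ℝ) 2
  · exact (hC t ht).trans (le_max_left _ _)
  · rw [deriv_smoothStep_eq_zero ht, abs_zero]; exact le_max_right _ _

lemma integral_deriv_smoothStep : ∫ t, deriv smoothStep t = 1 := by
  have h1 : ∫ t in (1 : ℝ)..2, deriv smoothStep t = smoothStep 2 - smoothStep 1 :=
    intervalIntegral.integral_deriv_eq_sub
      (fun t _ => (smoothStep_hasDerivAt t).differentiableAt)
      (continuous_deriv_smoothStep.intervalIntegrable _ _)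
  rw [smoothStep_eq_one le_rfl, smoothStep_eq_zero le_rfl, sub_zero] at h1
  rw [← h1, intervalIntegral.integral_of_le (by norm_num), ← integral_Icc_eq_integral_Ioc,
    setIntegral_eq_integral_of_forall_compl_eq_zero]
  exact fun t ht => deriv_smoothStep_eq_zero ht

/-- Pointwise limit of the cut-offs: if `f δ` stays away from zero, then `f δ / δ` eventually
exceeds `2`. -/
lemma eventually_smoothStep_div {f : ℝ → ℝ} {c : ℝ} (hc : 0 < c)
    (hf : Filter.Tendsto f (nhdsWithin 0 (Set.Ioi 0)) (nhds c)) :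
    ∀ᶠ δ in nhdsWithin (0 : ℝ) (Set.Ioi 0), smoothStep (f δ / δ) = 1 := by
  have h1 : ∀ᶠ δ in nhdsWithin (0 : ℝ) (Set.Ioi 0), c / 2 < f δ :=
    hf.eventually (lt_mem_nhds (by linarith))
  have h2 : ∀ᶠ δ in nhdsWithin (0 : ℝ) (Set.Ioi 0), δ < c / 4 :=
    (gt_mem_nhds (by positivity)).filter_mono nhdsWithin_le_nhds
  filter_upwards [h1, h2, self_mem_nhdsWithin] with δ h1 h2 h3
  have h3' : 0 < δ := h3
  apply smoothStep_eq_one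
  rw [le_div_iff₀ h3']
  linarith

/-! ### Nonnegative test functions -/

lemma plane_eq_sum_single (y : Plane) :
    y = y 0 • EuclideanSpace.single (0 : Fin 2) (1 : ℝ)
      + y 1 • EuclideanSpace.single (1 : Fin 2) (1 : ℝ) := by
  apply plane_ext <;> simp

/-- The integral equals `-∫ (∇ · β) φ`, and `σ = 0` makes `-∇ · β` nonnegative. This is the only
form in which the weak derivatives of `β` enter. -/
lemma IsAdmissibleVelocity.integral_nonneg {Ω : Set Plane} {β : Plane → Plane}
    (hβ : IsAdmissibleVelocity Ω 0 β) {φ : Plane → ℝ}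
    (hφ : ContDiff ℝ ((⊤ : ℕ∞) : WithTop ℕ∞) φ) (hc : HasCompactSupport φ)
    (hs : tsupport φ ⊆ Ω) (h0 : ∀ x, 0 ≤ φ x) :
    0 ≤ ∫ x in Ω, fderiv ℝ φ x (β x) := by
  obtain ⟨D, hD, hdiv⟩ := hβ.weakGradient
  have hφi : Integrable φ (volume.restrict Ω) :=
    (hφ.continuous.integrable_of_hasCompactSupport hc).restrict
  have hdi : ∀ e : Plane, Integrable (fun x => fderiv ℝ φ x e) (volume.restrict Ω) := fun e =>
    (((hφ.continuous_fderiv (by simp)).clm_apply continuous_const).integrable_of_hasCompactSupport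
      (hc.fderiv_apply (𝕜 := ℝ) e)).restrict
  have hβi : ∀ i, Integrable (fun x => β x i * fderiv ℝ φ x (EuclideanSpace.single i 1))
      (volume.restrict Ω) := fun i => (hdi _).mul_of_top_right (hβ.memLp i)
  have hDi : ∀ i, Integrable (fun x => D i i x * φ x) (volume.restrict Ω) := fun i =>
    hφi.mul_of_top_right (hD i i).1
  have hexp : ∀ x, fderiv ℝ φ x (β x) =
      β x 0 * fderiv ℝ φ x (EuclideanSpace.single 0 1)
        + β x 1 * fderiv ℝ φ x (EuclideanSpace.single 1 1) := fun x => by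
    conv_lhs => rw [plane_eq_sum_single (β x)]
    simp
  simp only [hexp]
  rw [integral_add (hβi 0) (hβi 1), (hD 0 0).2 φ hφ hc hs, (hD 1 1).2 φ hφ hc hs, ← neg_add,
    ← integral_add (hDi 0) (hDi 1), ← integral_neg]
  refine integral_nonneg_of_ae ?_
  filter_upwards [hdiv] with x hx
  have := mul_nonneg (show 0 ≤ -(D 0 0 x + D 1 1 x) by linarith) (h0 x)
  simp only [Pi.zero_apply]
  linarith

/-! ### The weak divergence theorem on a triangle. -/

namespace Triangulation

variable {Ω : Set Plane} (T : Triangulation Ω)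

/-- The derivative of a smooth cut-off near a face concentrates on that face. -/
lemma tendsto_integral_cutoff (F : Fin T.numCells × Fin 3) {f : Plane → ℝ} (hf : Continuous f) :
    Filter.Tendsto (fun δ : ℝ => ∫ x, f x * (deriv smoothStep (T.lam F.1 F.2 x / δ) / δ *
        (smoothStep (T.lam F.1 (F.2 + 1) x / δ) * smoothStep (T.lam F.1 (F.2 + 2) x / δ))))
      (nhdsWithin 0 (Set.Ioi 0))
      (nhds (T.dArea F.1 * ∫ t in (0 : ℝ)..1, f (AffineMap.lineMap (T.faceA F) (T.faceB F) t))) := by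
  obtain ⟨C₁, hC₁0, hC₁⟩ := exists_bound_deriv_smoothStep
  obtain ⟨C₂, hC₂⟩ := (T.isCompact_cell F.1).exists_bound_of_continuousOn hf.continuousOn
  set A := T.faceA F with hA
  set u := T.faceB F - T.faceA F with hu
  set w := T.apex F - T.faceA F with hw
  have hdA := T.dArea_eq F
  have hdpos := T.dArea_pos F.1
  rw [← hu, ← hw] at hdA
  have hlamA : ∀ i, T.lam F.1 i A = if i = F.2 + 1 then 1 else 0 := fun i => by
    rw [hA, faceA, lam_vert]
  have hlamu : ∀ i, inner ℝ (T.glam F.1 i) u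
      = (if i = F.2 + 2 then 1 else 0) - if i = F.2 + 1 then 1 else 0 := fun i => by
    rw [hu, ← lam_sub, faceA, faceB, lam_vert, lam_vert]
  have hlamw : ∀ i, inner ℝ (T.glam F.1 i) w
      = (if i = F.2 then 1 else 0) - if i = F.2 + 1 then 1 else 0 := fun i => by
    rw [hw, ← lam_sub, faceA, apex, lam_vert, lam_vert]
  have hlam : ∀ i s t, T.lam F.1 i (A + s • u + t • w) = T.lam F.1 i A
      + s * inner ℝ (T.glam F.1 i) u + t * inner ℝ (T.glam F.1 i) w := fun i s t => by
    have := T.lam_sub F.1 i (A + s • u + t • w) A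
    rw [add_assoc, add_sub_cancel_left, inner_add_right, inner_smul_right, inner_smul_right] at this
    rw [add_assoc]
    linarith
  have key : ∀ j : Fin 3, j ≠ j + 1 ∧ j ≠ j + 2 ∧ j + 1 ≠ j ∧ j + 1 ≠ j + 2 ∧ j + 2 ≠ j ∧
      j + 2 ≠ j + 1 := by decide
  obtain ⟨k1, k2, k3, k4, k5, k6⟩ := key F.2
  have l0 : ∀ s t, T.lam F.1 F.2 (A + s • u + t • w) = t := fun s t => by
    rw [hlam, hlamA, hlamu, hlamw]; simp [k1, k2]
  have l1 : ∀ s t, T.lam F.1 (F.2 + 1) (A + s • u + t • w) = 1 - s - t := fun s t => by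
    rw [hlam, hlamA, hlamu, hlamw]; simp [k3, k4]; ring
  have l2 : ∀ s t, T.lam F.1 (F.2 + 2) (A + s • u + t • w) = s := fun s t => by
    rw [hlam, hlamA, hlamu, hlamw]; simp [k5, k6]
  -- the integrand in the scaled coordinates
  set G : ℝ → ℝ × ℝ → ℝ := fun δ p => f (A + p.1 • u + (δ * p.2) • w) *
    (deriv smoothStep p.2 *
      (smoothStep ((1 - p.1 - δ * p.2) / δ) * smoothStep (p.1 / δ))) with hG
  -- Substitute `x = A + s u + δ t w`: the coordinate of the apex becomes `δ t`, and the Jacobian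
  -- factor `δ` cancels the factor `1 / δ` of the derivative.
  have hint : ∀ δ : ℝ, 0 < δ →
      ∫ x, f x * (deriv smoothStep (T.lam F.1 F.2 x / δ) / δ *
        (smoothStep (T.lam F.1 (F.2 + 1) x / δ) * smoothStep (T.lam F.1 (F.2 + 2) x / δ)))
      = T.dArea F.1 * ∫ p, G δ p := by
    intro δ hδ
    have e : u 0 * (δ • w) 1 - u 1 * (δ • w) 0 = δ * (u 0 * w 1 - u 1 * w 0) := by
      simp only [PiLp.smul_apply, smul_eq_mul]; ring
    have hne : u 0 * (δ • w) 1 - u 1 * (δ • w) 0 ≠ 0 := by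
      rw [e]
      exact mul_ne_zero hδ.ne' fun h => by rw [h, abs_zero] at hdA; exact hdpos.ne' hdA
    rw [integral_plane_eq_integral_prod _ A u (δ • w) hne, e, abs_mul, ← hdA, abs_of_pos hδ,
      mul_comm δ, mul_assoc, ← integral_const_mul]
    congr 1
    refine integral_congr_ae (Filter.Eventually.of_forall fun p => ?_)
    simp only [hG, smul_smul, l0, l1, l2]
    rw [mul_comm p.2 δ, mul_div_cancel_left₀ _ hδ.ne']
    field_simp
  set g : ℝ × ℝ → ℝ := fun p =>
    (Set.Ioo (0 : ℝ) 1).indicator (fun s => f (A + s • u)) p.1 * deriv smoothStep p.2 with hg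
  have hlim : ∫ p, g p = ∫ t in (0 : ℝ)..1, f (AffineMap.lineMap (T.faceA F) (T.faceB F) t) := by
    rw [hg, Measure.volume_eq_prod, integral_prod_mul
      ((Set.Ioo (0 : ℝ) 1).indicator (fun s => f (A + s • u))), integral_deriv_smoothStep, mul_one,
      integral_indicator measurableSet_Ioo, intervalIntegral.integral_of_le zero_le_one,
      integral_Ioc_eq_integral_Ioo]
    congr 1
    funext t
    rw [AffineMap.lineMap_apply_module', add_comm]
  rw [← hlim]
  -- The scaled integrand lives on points of the triangle with parameters in the fixed rectangle
  -- `[0, 1] × [1, 2]`, which provides an integrable majorant independent of `δ`.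
  have hzero : ∀ δ : ℝ, 0 < δ → ∀ p : ℝ × ℝ,
      ¬ (p.1 ∈ Set.Icc (0 : ℝ) 1 ∧ p.2 ∈ Set.Icc (1 : ℝ) 2 ∧ δ * p.2 ≤ 1 - p.1) → G δ p = 0 := by
    intro δ hδ p hp
    simp only [hG]
    by_cases hp2 : p.2 ∈ Set.Icc (1 : ℝ) 2
    swap
    · rw [deriv_smoothStep_eq_zero hp2]; ring
    by_cases hp1 : p.1 ≤ 0
    · rw [smoothStep_eq_zero (t := p.1 / δ)]
      · ring
      · exact (div_nonpos_of_nonpos_of_nonneg hp1 hδ.le).trans zero_le_one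
    · rw [smoothStep_eq_zero (t := (1 - p.1 - δ * p.2) / δ)]
      · ring
      · rw [div_le_one hδ]
        by_contra hlt
        have h3 : 0 < δ * p.2 := mul_pos hδ (by linarith [hp2.1])
        exact hp ⟨⟨by linarith, by linarith⟩, hp2, by linarith⟩
  have hmain : Filter.Tendsto (fun δ => ∫ p, G δ p) (nhdsWithin 0 (Set.Ioi 0))
      (nhds (∫ p, g p)) := by
    refine tendsto_integral_filter_of_dominated_convergence
      ((Set.Icc (0 : ℝ) 1 ×ˢ Set.Icc (1 : ℝ) 2).indicator fun _ => C₂ * C₁) ?_ ?_ ?_ ?_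
    · refine Filter.Eventually.of_forall fun δ => ?_
      have hs := smoothStep_contDiff.continuous
      have hd := continuous_deriv_smoothStep
      have : Continuous (G δ) := by
        simp only [hG]
        fun_prop
      exact this.aestronglyMeasurable
    · filter_upwards [self_mem_nhdsWithin] with δ hδ
      have hδ' : 0 < δ := hδ
      refine Filter.Eventually.of_forall fun p => ?_
      by_cases hp : p.1 ∈ Set.Icc (0 : ℝ) 1 ∧ p.2 ∈ Set.Icc (1 : ℝ) 2 ∧ δ * p.2 ≤ 1 - p.1
      · rw [Set.indicator_of_mem (show p ∈ Set.Icc (0 : ℝ) 1 ×ˢ Set.Icc (1 : ℝ) 2 from ⟨hp.1, hp.2.1⟩)]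
        have hx : A + p.1 • u + (δ * p.2) • w ∈ T.cell F.1 := by
          rw [T.mem_cell]
          intro i
          have : i = F.2 ∨ i = F.2 + 1 ∨ i = F.2 + 2 := by
            generalize F.2 = j; revert i j; decide
          rcases this with h | h | h <;> rw [h]
          · rw [l0]; exact mul_nonneg hδ'.le (by linarith [hp.2.1.1])
          · rw [l1]; linarith [hp.2.2]
          · rw [l2]; exact hp.1.1
        simp only [hG, norm_mul]
        have b1 := hC₂ _ hx
        have b2 := hC₁ p.2
        have b3 : ‖smoothStep ((1 - p.1 - δ * p.2) / δ)‖ * ‖smoothStep (p.1 / δ)‖ ≤ 1 := by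
          rw [Real.norm_of_nonneg (smoothStep_nonneg _), Real.norm_of_nonneg (smoothStep_nonneg _)]
          exact mul_le_one₀ (smoothStep_le_one _) (smoothStep_nonneg _) (smoothStep_le_one _)
        have b4 : ‖deriv smoothStep p.2‖ * (‖smoothStep ((1 - p.1 - δ * p.2) / δ)‖ *
            ‖smoothStep (p.1 / δ)‖) ≤ C₁ * 1 :=
          mul_le_mul b2 b3 (by positivity) hC₁0
        rw [mul_one] at b4
        exact mul_le_mul b1 b4 (by positivity) ((norm_nonneg _).trans b1)
      · rw [hzero δ hδ' p hp, norm_zero]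
        exact Set.indicator_nonneg (fun _ _ => mul_nonneg
          ((norm_nonneg _).trans (hC₂ _ (T.faceA_mem_cell F))) hC₁0) _
    · refine (integrable_indicator_iff (measurableSet_Icc.prod measurableSet_Icc)).2 ?_
      exact integrableOn_const ((isCompact_Icc.prod isCompact_Icc).measure_lt_top.ne)
    · refine Filter.Eventually.of_forall fun p => ?_
      by_cases hp1 : p.1 ∈ Set.Ioo (0 : ℝ) 1
      · have e1 : Filter.Tendsto (fun δ : ℝ => 1 - p.1 - δ * p.2) (nhdsWithin 0 (Set.Ioi 0))
            (nhds (1 - p.1)) := by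
          have : Continuous fun δ : ℝ => 1 - p.1 - δ * p.2 := by fun_prop
          simpa using (this.tendsto 0).mono_left nhdsWithin_le_nhds
        have e2 := eventually_smoothStep_div (by linarith [hp1.2]) e1
        have e3 := eventually_smoothStep_div (f := fun _ => p.1) hp1.1 tendsto_const_nhds
        have e4 : Filter.Tendsto (fun δ : ℝ => f (A + p.1 • u + (δ * p.2) • w) *
            deriv smoothStep p.2) (nhdsWithin 0 (Set.Ioi 0)) (nhds (g p)) := by
          have : Continuous fun δ : ℝ => f (A + p.1 • u + (δ * p.2) • w) *
            deriv smoothStep p.2 := by fun_prop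
          have h5 := (this.tendsto 0).mono_left (nhdsWithin_le_nhds (s := Set.Ioi 0))
          simp only [hg, Set.indicator_of_mem hp1]
          simpa using h5
        refine e4.congr' ?_
        filter_upwards [e2, e3] with δ h2 h3
        simp only [hG, h2, h3, mul_one]
      -- Outside the open interval the limit is zero; at `s = 0` the cut-off of the coordinate `s`
      -- vanishes for every `δ`.
      · have : g p = 0 := by simp only [hg, Set.indicator_of_notMem hp1, zero_mul]
        rw [this]
        refine tendsto_const_nhds.congr' ?_
        filter_upwards [self_mem_nhdsWithin] with δ hδ
        have hδ' : 0 < δ := hδ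
        symm
        by_cases hb : p.1 ∈ Set.Icc (0 : ℝ) 1 ∧ p.2 ∈ Set.Icc (1 : ℝ) 2 ∧ δ * p.2 ≤ 1 - p.1
        · have h3 : 0 < δ * p.2 := mul_pos hδ' (by linarith [hb.2.1.1])
          have h0 : p.1 = 0 := by
            by_contra hne
            exact hp1 ⟨lt_of_le_of_ne hb.1.1 (Ne.symm hne), by linarith [hb.2.2]⟩
          simp only [hG]
          rw [h0, zero_div, smoothStep_eq_zero zero_le_one]; ring
        · exact hzero δ hδ' p hb
  refine (hmain.const_mul (T.dArea F.1)).congr' ?_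
  filter_upwards [self_mem_nhdsWithin] with δ hδ
  exact (hint δ hδ).symm

end Triangulation

/-- Tietze's theorem. The cut-off integrals run over the whole plane and need continuous integrands
there, while `β` is continuous only on the closure of `Ω`. -/
lemma exists_continuous_extension {s : Set Plane} (hs : IsClosed s) {β : Plane → Plane}
    (hβ : ContinuousOn β s) : ∃ β' : Plane → Plane, Continuous β' ∧ Set.EqOn β' β s := by
  obtain ⟨g, hg⟩ := ContinuousMap.exists_restrict_eq hs ⟨s.domRestrict β, hβ.domRestrict⟩
  refine ⟨g, g.continuous, fun x hx => ?_⟩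
  exact congrArg (fun f => f ⟨x, hx⟩) hg

namespace Triangulation

variable {Ω : Set Plane} (T : Triangulation Ω)

lemma hasFDerivAt_lam (K : Fin T.numCells) (j : Fin 3) (x : Plane) :
    HasFDerivAt (T.lam K j) (innerSL ℝ (T.glam K j)) x := by
  have h : (T.lam K j : Plane → ℝ) = fun y => innerSL ℝ (T.glam K j) y + T.lam K j 0 := by
    funext y
    have := T.lam_sub K j y 0
    rw [sub_zero] at this
    rw [innerSL_apply_apply, ← this]; ring
  rw [h]
  exact (innerSL ℝ (T.glam K j)).hasFDerivAt.add_const _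

lemma contDiff_lam (K : Fin T.numCells) (j : Fin 3) {n : WithTop ℕ∞} :
    ContDiff ℝ n (T.lam K j) := by
  have h : (T.lam K j : Plane → ℝ) = fun y => innerSL ℝ (T.glam K j) y + T.lam K j 0 := by
    funext y
    have := T.lam_sub K j y 0
    rw [sub_zero] at this
    rw [innerSL_apply_apply, ← this]; ring
  rw [h]
  exact (innerSL ℝ (T.glam K j)).contDiff.add contDiff_const

lemma volume_frontier_cell (K : Fin T.numCells) : volume (frontier (T.cell K)) = 0 :=
  (T.convex_cell K).addHaar_frontier volume

/-- On each triangle, the weak divergence theorem holds as an inequality for velocities with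
nonpositive divergence. -/
lemma sum_edgeIntegral_le_integral_cell (hΩ : IsOpen Ω) (hreg : interior (closure Ω) = Ω)
    {β : Plane → Plane}
    (hβ : IsAdmissibleVelocity Ω 0 β) {g : Plane → ℝ}
    (hg : ContDiff ℝ ((⊤ : ℕ∞) : WithTop ℕ∞) g) (hg0 : ∀ x, 0 ≤ g x) (K : Fin T.numCells) :
    ∑ j, edgeIntegral (T.faceA (K, j)) (T.faceB (K, j))
        (fun x => inner ℝ (β x) (T.normal (K, j)) * g x)
      ≤ ∫ x in T.cell K, fderiv ℝ g x (β x) := by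
  obtain ⟨β', hβc, hβe⟩ := exists_continuous_extension isClosed_closure hβ.continuousOn
  set E : ℝ → Fin 3 → Plane → ℝ := fun δ j x => smoothStep (T.lam K j x / δ) with hE
  set P : ℝ → Plane → ℝ := fun δ x => E δ 0 x * (E δ 1 x * E δ 2 x) with hP
  set f : Fin 3 → Plane → ℝ := fun j x => g x * inner ℝ (T.glam K j) (β' x) with hf
  set Q : ℝ → Fin 3 → Plane → ℝ := fun δ j x => f j x *
    (deriv smoothStep (T.lam K j x / δ) / δ * (E δ (j + 1) x * E δ (j + 2) x)) with hQ
  have hgd : Continuous fun x => fderiv ℝ g x (β' x) :=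
    (hg.continuous_fderiv (by simp)).clm_apply hβc
  have hEc : ∀ δ j, Continuous (E δ j) := fun δ j =>
    smoothStep_contDiff.continuous.comp ((T.continuous_lam K j).div_const δ)
  have hfc : ∀ j, Continuous (f j) := fun j => hg.continuous.mul (continuous_const.inner hβc)
  have hQc : ∀ δ j, Continuous (Q δ j) := fun δ j =>
    (hfc j).mul (((continuous_deriv_smoothStep.comp ((T.continuous_lam K j).div_const δ)).div_const
      δ).mul ((hEc δ _).mul (hEc δ _)))
  have hPc : ∀ δ, Continuous (P δ) := fun δ => (hEc δ 0).mul ((hEc δ 1).mul (hEc δ 2))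
  have hE0 : ∀ {δ : ℝ} {j x}, 0 < δ → T.lam K j x ≤ δ → E δ j x = 0 := fun hδ hx =>
    smoothStep_eq_zero ((div_le_one hδ).2 hx)
  have hP0 : ∀ {δ : ℝ} {j x}, 0 < δ → T.lam K j x ≤ δ → P δ x = 0 := by
    intro δ j x hδ hx
    have h := hE0 hδ hx
    simp only [hP]
    fin_cases j <;> simp only [Fin.zero_eta, Fin.mk_one, Fin.reduceFinMk] at h <;> rw [h] <;> ring
  have hQ0 : ∀ {δ : ℝ} {j x}, 0 < δ → x ∉ T.cell K → Q δ j x = 0 := by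
    intro δ j x hδ hx
    rw [T.mem_cell] at hx
    push Not at hx
    obtain ⟨i, hi⟩ := hx
    have : i = j ∨ i = j + 1 ∨ i = j + 2 := by clear * -; revert i j; decide
    simp only [hQ]
    rcases this with rfl | rfl | rfl
    · rw [deriv_smoothStep_eq_zero]
      · ring
      · intro h
        linarith [h.1, div_neg_of_neg_of_pos hi hδ]
    · rw [hE0 hδ (hi.le.trans hδ.le)]; ring
    · rw [hE0 hδ (hi.le.trans hδ.le)]; ring
  have hPcell : ∀ {δ : ℝ} {x}, 0 < δ → x ∉ T.cell K → P δ x = 0 := by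
    intro δ x hδ hx
    rw [T.mem_cell] at hx
    push Not at hx
    obtain ⟨i, hi⟩ := hx
    exact hP0 hδ (hi.le.trans hδ.le)
  -- the test function and its derivative
  have hfd : ∀ (δ : ℝ) (x : Plane), fderiv ℝ (fun y => g y * P δ y) x (β' x)
      = fderiv ℝ g x (β' x) * P δ x + ∑ j, Q δ j x := by
    intro δ x
    have hEd : ∀ j, HasFDerivAt (E δ j)
        ((deriv smoothStep (T.lam K j x / δ)) • (δ⁻¹ • innerSL ℝ (T.glam K j))) x := fun j => by
      have h1 : HasFDerivAt (fun y => T.lam K j y / δ) (δ⁻¹ • innerSL ℝ (T.glam K j)) x := by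
        simpa only [div_eq_mul_inv] using (T.hasFDerivAt_lam K j x).mul_const δ⁻¹
      exact (smoothStep_hasDerivAt _).comp_hasFDerivAt x h1
    have hgx : HasFDerivAt g (fderiv ℝ g x) x := (hg.differentiable (by simp) x).hasFDerivAt
    have h := hgx.mul ((hEd 0).mul ((hEd 1).mul (hEd 2)))
    have h' : fderiv ℝ (fun y => g y * P δ y) x = _ := h.fderiv
    rw [h', Fin.sum_univ_three]
    simp only [hQ, hf, hP, show (0 : Fin 3) + 1 = 1 from rfl, show (0 : Fin 3) + 2 = 2 from rfl,
      show (1 : Fin 3) + 1 = 2 from rfl, show (1 : Fin 3) + 2 = 0 from rfl,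
      show (2 : Fin 3) + 1 = 0 from rfl, show (2 : Fin 3) + 2 = 1 from rfl,
      add_apply, smul_apply, innerSL_apply_apply,
      smul_eq_mul, Pi.mul_apply]
    ring
  -- For fixed `δ` the function `g P` is smooth, nonnegative and supported where all coordinates are
  -- at least `δ`, so it is an admissible test function. The product rule splits the result into an
  -- interior part and one term for each face.
  have hnonneg : ∀ δ : ℝ, 0 < δ →
      0 ≤ (∫ x, fderiv ℝ g x (β' x) * P δ x) + ∑ j, ∫ x, Q δ j x := by
    intro δ hδ
    have hsm : ContDiff ℝ ((⊤ : ℕ∞) : WithTop ℕ∞) fun y => g y * P δ y := by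
      have : ∀ j, ContDiff ℝ ((⊤ : ℕ∞) : WithTop ℕ∞) (E δ j) := fun j =>
        smoothStep_contDiff.comp ((T.contDiff_lam K j).div_const δ)
      exact hg.mul ((this 0).mul ((this 1).mul (this 2)))
    have hts : tsupport (fun y => g y * P δ y) ⊆ {x | ∀ j, δ ≤ T.lam K j x} := by
      refine closure_minimal ?_ ?_
      · intro x hx j
        by_contra hlt
        apply hx
        simp only [hP0 hδ (not_le.1 hlt).le, mul_zero]
      · rw [Set.ofPred_forall]
        exact isClosed_iInter fun j => isClosed_le continuous_const (T.continuous_lam K j)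
    have htint : tsupport (fun y => g y * P δ y) ⊆ interior (T.cell K) := fun x hx =>
      T.mem_interior_cell.2 fun j => hδ.trans_le (hts hx j)
    have hint : interior (T.cell K) ⊆ Ω := by
      exact (interior_mono (T.cell_subset_closure K)).trans hreg.subset
    have hcs : HasCompactSupport fun y => g y * P δ y :=
      (T.isCompact_cell K).of_isClosed_subset (isClosed_tsupport _) (htint.trans interior_subset)
    have h1 := hβ.integral_nonneg hsm hcs (htint.trans hint)
      (fun x => mul_nonneg (hg0 x) (mul_nonneg (smoothStep_nonneg _)
        (mul_nonneg (smoothStep_nonneg _) (smoothStep_nonneg _))))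
    have h2 : ∫ x in Ω, fderiv ℝ (fun y => g y * P δ y) x (β x)
        = ∫ x, fderiv ℝ (fun y => g y * P δ y) x (β' x) := by
      rw [← setIntegral_eq_integral_of_forall_compl_eq_zero (s := Ω)
        (f := fun x => fderiv ℝ (fun y => g y * P δ y) x (β' x))]
      · refine setIntegral_congr_fun hΩ.measurableSet fun x hx => ?_
        rw [hβe (subset_closure hx)]
      · intro x hx
        have : x ∉ tsupport (fun y => g y * P δ y) := fun h => hx (hint (htint h))
        have h3 : fderiv ℝ (fun y => g y * P δ y) x = 0 := by
          by_contra hne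
          exact this (support_fderiv_subset ℝ hne)
        rw [h3]; rfl
    rw [h2] at h1
    simp only [hfd] at h1
    rwa [integral_add, integral_finsetSum] at h1
    · intro j _
      exact (hQc δ j).integrable_of_hasCompactSupport
        (HasCompactSupport.intro (T.isCompact_cell K) fun x hx => hQ0 hδ hx)
    · exact (hgd.mul (hPc δ)).integrable_of_hasCompactSupport
        (HasCompactSupport.intro (T.isCompact_cell K) fun x hx => by
          rw [Pi.mul_apply, hPcell hδ hx, mul_zero])
    · exact integrable_finsetSum _ fun j _ => (hQc δ j).integrable_of_hasCompactSupport
        (HasCompactSupport.intro (T.isCompact_cell K) fun x hx => hQ0 hδ hx)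
  -- The cut-offs converge to the indicator of the open triangle, whose boundary is a null set.
  have hlim1 : Filter.Tendsto (fun δ : ℝ => ∫ x, fderiv ℝ g x (β' x) * P δ x)
      (nhdsWithin 0 (Set.Ioi 0)) (nhds (∫ x in T.cell K, fderiv ℝ g x (β x))) := by
    have e1 : ∫ x in T.cell K, fderiv ℝ g x (β x)
        = ∫ x, (interior (T.cell K)).indicator (fun x => fderiv ℝ g x (β' x)) x := by
      rw [integral_indicator isOpen_interior.measurableSet]
      have hae : (interior (T.cell K) : Set Plane) =ᵐ[volume] T.cell K :=
        interior_ae_eq_of_null_frontier (T.volume_frontier_cell K)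
      rw [setIntegral_congr_set hae]
      refine setIntegral_congr_fun (T.isClosed_cell K).measurableSet fun x hx => ?_
      rw [hβe (T.cell_subset_closure K hx)]
    rw [e1]
    obtain ⟨C, hC⟩ := (T.isCompact_cell K).exists_bound_of_continuousOn hgd.continuousOn
    refine tendsto_integral_filter_of_dominated_convergence
      ((T.cell K).indicator fun _ => C) ?_ ?_ ?_ ?_
    · exact Filter.Eventually.of_forall fun δ => (hgd.mul (hPc δ)).aestronglyMeasurable
    · filter_upwards [self_mem_nhdsWithin] with δ hδ
      refine Filter.Eventually.of_forall fun x => ?_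
      by_cases hx : x ∈ T.cell K
      · rw [Set.indicator_of_mem hx, norm_mul]
        have : ‖P δ x‖ ≤ 1 := by
          have a := smoothStep_nonneg
          have b := smoothStep_le_one
          rw [Real.norm_of_nonneg (mul_nonneg (a _) (mul_nonneg (a _) (a _)))]
          exact mul_le_one₀ (b _) (mul_nonneg (a _) (a _)) (mul_le_one₀ (b _) (a _) (b _))
        calc _ ≤ C * 1 := mul_le_mul (hC x hx) this (norm_nonneg _) ((norm_nonneg _).trans (hC x hx))
          _ = C := mul_one C
      · rw [hPcell hδ hx, Set.indicator_of_notMem hx, mul_zero, norm_zero]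
    · refine (integrable_indicator_iff (T.isClosed_cell K).measurableSet).2 ?_
      exact integrableOn_const (T.isCompact_cell K).measure_lt_top.ne
    · refine Filter.Eventually.of_forall fun x => ?_
      by_cases hx : x ∈ interior (T.cell K)
      · rw [Set.indicator_of_mem hx]
        have hpos := T.mem_interior_cell.1 hx
        have e := fun j => eventually_smoothStep_div (f := fun _ => T.lam K j x) (hpos j)
          tendsto_const_nhds
        refine tendsto_const_nhds.congr' ?_
        filter_upwards [e 0, e 1, e 2] with δ h0 h1 h2
        simp only [hP, hE, h0, h1, h2, mul_one]
      · rw [Set.indicator_of_notMem hx]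
        rw [T.mem_interior_cell] at hx
        push Not at hx
        obtain ⟨j, hj⟩ := hx
        refine tendsto_const_nhds.congr' ?_
        filter_upwards [self_mem_nhdsWithin] with δ hδ
        rw [hP0 hδ (hj.trans (le_of_lt hδ)), mul_zero]
  have hlim2 := fun j => T.tendsto_integral_cutoff (K, j) (hfc j)
  have hlim := hlim1.add (tendsto_finsetSum Finset.univ fun j _ => hlim2 j)
  have hfin := ge_of_tendsto hlim (by
    filter_upwards [self_mem_nhdsWithin] with δ hδ using hnonneg δ hδ)
  -- Twice the area times the gradient of the apex coordinate is minus the length of the face times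
  -- the outward normal, so the limit terms are minus the fluxes.
  have hedge : ∀ j, edgeIntegral (T.faceA (K, j)) (T.faceB (K, j))
        (fun x => inner ℝ (β x) (T.normal (K, j)) * g x)
      = -(T.dArea K * ∫ t in (0 : ℝ)..1,
          f j (AffineMap.lineMap (T.faceA (K, j)) (T.faceB (K, j)) t)) := by
    intro j
    rw [edgeIntegral, ← intervalIntegral.integral_const_mul, ← intervalIntegral.integral_const_mul,
      ← intervalIntegral.integral_neg]
    refine intervalIntegral.integral_congr fun t ht => ?_
    rw [Set.uIcc_of_le zero_le_one] at ht
    have hmem : AffineMap.lineMap (T.faceA (K, j)) (T.faceB (K, j)) t ∈ closure Ω := by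
      refine T.cell_subset_closure K (T.face_subset_cell (K, j) ?_)
      rw [face, segment_eq_image_lineMap]
      exact ⟨t, ht, rfl⟩
    rw [← hβe hmem]
    simp only [hf]
    have hn := T.dist_smul_normal (K, j)
    rw [← mul_assoc, ← real_inner_smul_right, hn, inner_neg_right, real_inner_smul_right,
      real_inner_comm]
    ring
  simp only [hedge, Finset.sum_neg_distrib]
  linarith

lemma edgeIntegral_comm (a b : Plane) (f : Plane → ℝ) :
    edgeIntegral a b f = edgeIntegral b a f := by
  rw [edgeIntegral, edgeIntegral, dist_comm]
  congr 1
  have := intervalIntegral.integral_comp_sub_left (a := 0) (b := 1)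
    (fun t : ℝ => f (AffineMap.lineMap a b t)) 1
  rw [sub_self, sub_zero] at this
  rw [← this]
  refine intervalIntegral.integral_congr fun t _ => ?_
  simp only [AffineMap.lineMap_apply_one_sub]

end Triangulation

/-! ### Polynomials on the plane -/

/-- The function on the plane given by a polynomial. -/
def polyFun (q : MvPolynomial (Fin 2) ℝ) (x : Plane) : ℝ := MvPolynomial.eval (fun i => x i) q

/-- The gradient of a polynomial. -/
def polyGrad (q : MvPolynomial (Fin 2) ℝ) (x : Plane) : Plane :=
  WithLp.toLp 2 fun i => polyFun (MvPolynomial.pderiv i q) x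

lemma hasFDerivAt_polyFun (q : MvPolynomial (Fin 2) ℝ) (x : Plane) :
    HasFDerivAt (polyFun q) (innerSL ℝ (polyGrad q x)) x := by
  induction q using MvPolynomial.induction_on with
  | C a =>
    have h1 : polyFun (MvPolynomial.C a) = fun _ => a := by funext y; simp [polyFun]
    have h2 : innerSL ℝ (polyGrad (MvPolynomial.C a) x) = 0 := by
      ext y; simp [polyGrad, polyFun, plane_inner]
    rw [h1, h2]; exact hasFDerivAt_const a x
  | add p q hp hq =>
    have h1 : polyFun (p + q) = fun y => polyFun p y + polyFun q y := by funext y; simp [polyFun]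
    have h2 : innerSL ℝ (polyGrad (p + q) x) = innerSL ℝ (polyGrad p x)
        + innerSL ℝ (polyGrad q x) := by
      ext y; simp [polyGrad, polyFun, plane_inner]; ring
    rw [h1, h2]; exact hp.add hq
  | mul_X p i hp =>
    have h1 : polyFun (p * MvPolynomial.X i) = fun y => polyFun p y * y i := by
      funext y; simp [polyFun]
    have hi : HasFDerivAt (fun y : Plane => y i) (EuclideanSpace.proj i : Plane →L[ℝ] ℝ) x :=
      (EuclideanSpace.proj i : Plane →L[ℝ] ℝ).hasFDerivAt
    have h2 : innerSL ℝ (polyGrad (p * MvPolynomial.X i) x)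
        = polyFun p x • (EuclideanSpace.proj i : Plane →L[ℝ] ℝ)
          + x i • innerSL ℝ (polyGrad p x) := by
      ext y
      fin_cases i <;> simp [polyGrad, polyFun, plane_inner, MvPolynomial.pderiv_X] <;> ring
    rw [h1, h2]
    exact hp.mul hi

lemma contDiff_polyFun (q : MvPolynomial (Fin 2) ℝ) {n : WithTop ℕ∞} :
    ContDiff ℝ n (polyFun q) := by
  induction q using MvPolynomial.induction_on with
  | C a =>
    have h1 : polyFun (MvPolynomial.C a) = fun _ => a := by funext y; simp [polyFun]
    rw [h1]; exact contDiff_const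
  | add p q hp hq =>
    have h1 : polyFun (p + q) = fun y => polyFun p y + polyFun q y := by funext y; simp [polyFun]
    rw [h1]; exact hp.add hq
  | mul_X p i hp =>
    have h1 : polyFun (p * MvPolynomial.X i) = fun y => polyFun p y * y i := by
      funext y; simp [polyFun]
    rw [h1]
    exact hp.mul (EuclideanSpace.proj i : Plane →L[ℝ] ℝ).contDiff

lemma continuous_polyFun (q : MvPolynomial (Fin 2) ℝ) : Continuous (polyFun q) :=
  (contDiff_polyFun q (n := 0)).continuous

lemma continuous_polyGrad (q : MvPolynomial (Fin 2) ℝ) : Continuous (polyGrad q) :=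
  (PiLp.continuous_toLp 2 _).comp (continuous_pi fun _ => continuous_polyFun _)

lemma exists_polyFun_comp_affine {k : ℕ} (q : MvPolynomial (Fin 2) ℝ) (hq : q.totalDegree ≤ k)
    (c : Plane) (h : ℝ) : ∃ q' : MvPolynomial (Fin 2) ℝ, q'.totalDegree ≤ k ∧
      ∀ y, polyFun q' y = polyFun q (c + h • y) := by
  set l : Fin 2 → MvPolynomial (Fin 2) ℝ := fun i =>
    MvPolynomial.C (c i) + MvPolynomial.C h * MvPolynomial.X i with hl
  have hldeg : ∀ i, (l i).totalDegree ≤ 1 := fun i => by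
    refine (MvPolynomial.totalDegree_add _ _).trans (max_le ?_ ?_)
    · simp
    · refine (MvPolynomial.totalDegree_mul _ _).trans ?_
      simp
  refine ⟨MvPolynomial.bind₁ l q, ?_, fun y => ?_⟩
  · rw [q.as_sum, map_sum]
    refine (MvPolynomial.totalDegree_finsetSum _ _).trans (Finset.sup_le fun d hd => ?_)
    rw [MvPolynomial.bind₁_monomial]
    refine (MvPolynomial.totalDegree_mul _ _).trans ?_
    rw [MvPolynomial.totalDegree_C, zero_add]
    refine (MvPolynomial.totalDegree_finsetProd _ _).trans ?_
    refine le_trans ?_ ((MvPolynomial.le_totalDegree hd).trans hq)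
    rw [Finsupp.sum]
    refine Finset.sum_le_sum fun i _ => ?_
    refine (MvPolynomial.totalDegree_pow _ _).trans ?_
    calc d i * (l i).totalDegree ≤ d i * 1 := Nat.mul_le_mul_left _ (hldeg i)
      _ = d i := mul_one _
  · rw [polyFun, polyFun, MvPolynomial.eval, MvPolynomial.eval₂Hom_bind₁]
    congr 1
    congr 1
    funext i
    simp [hl]

/-- The polynomial vanishes almost everywhere, hence by continuity everywhere on the open ball. The
ball contains a product of infinite sets, on which only the zero polynomial vanishes. -/
lemma eq_zero_of_integral_polyFun_sq {s : ℝ} (hs : 0 < s) (q : MvPolynomial (Fin 2) ℝ)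
    (hq : ∫ x in Metric.closedBall (0 : Plane) s, polyFun q x ^ 2 = 0) : q = 0 := by
  have hc : Continuous fun x => polyFun q x ^ 2 := (continuous_polyFun q).pow 2
  have hint : IntegrableOn (fun x => polyFun q x ^ 2) (Metric.closedBall (0 : Plane) s) :=
    hc.continuousOn.integrableOn_compact (isCompact_closedBall _ _)
  have hae := (setIntegral_eq_zero_iff_of_nonneg_ae
    (Filter.Eventually.of_forall fun x => sq_nonneg (polyFun q x)) hint).1 hq
  have hae' := ae_restrict_of_ae_restrict_of_subset (Metric.ball_subset_closedBall) hae
  have heq := Measure.eqOn_open_of_ae_eq hae' Metric.isOpen_ball hc.continuousOn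
    continuousOn_const
  refine MvPolynomial.funext_set (fun _ => Set.Ioo (0 : ℝ) (s / 2))
    (fun _ => Set.Ioo_infinite (by linarith)) fun x hx => ?_
  have hx0 := hx 0 (Set.mem_univ _)
  have hx1 := hx 1 (Set.mem_univ _)
  have hmem : WithLp.toLp 2 x ∈ Metric.ball (0 : Plane) s := by
    rw [mem_ball_zero_iff]
    refine lt_of_pow_lt_pow_left₀ 2 hs.le ?_
    rw [plane_norm_sq]
    simp only
    nlinarith [hx0.1, hx0.2, hx1.1, hx1.2]
  have := heq hmem
  rw [map_zero]
  exact pow_eq_zero_iff (two_ne_zero) |>.1 this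

/-- On a finite-dimensional space of continuous functions, values are controlled by a mean square
over a compact set, as soon as the mean square is definite. -/
lemma exists_sq_le_integral_sq {n : ℕ} (f : Fin n → Plane → ℝ) (hf : ∀ i, Continuous (f i))
    {B B' : Set Plane} (hB : IsCompact B) (hB' : IsCompact B')
    (hdef : ∀ a : Fin n → ℝ, ∫ x in B, (∑ i, a i * f i x) ^ 2 = 0 → a = 0) :
    ∃ C, 0 ≤ C ∧ ∀ a : Fin n → ℝ, ∀ x ∈ B',
      (∑ i, a i * f i x) ^ 2 ≤ C * ∫ x in B, (∑ i, a i * f i x) ^ 2 := by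
  set Q : (Fin n → ℝ) → ℝ := fun a => ∫ x in B, (∑ i, a i * f i x) ^ 2 with hQ
  have hQ' : ∀ a, Q a = ∑ i, ∑ j, a i * a j * ∫ x in B, f i x * f j x := by
    intro a
    have e : ∀ x, (∑ i, a i * f i x) ^ 2 = ∑ i, ∑ j, a i * a j * (f i x * f j x) := fun x => by
      rw [sq, Finset.sum_mul_sum]
      refine Finset.sum_congr rfl fun i _ => Finset.sum_congr rfl fun j _ => by ring
    have hi : ∀ i j, Integrable (fun x => a i * a j * (f i x * f j x)) (volume.restrict B) :=
      fun i j => ((continuous_const.mul ((hf i).mul (hf j))).continuousOn.integrableOn_compact hB)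
    simp only [hQ, e]
    rw [integral_finsetSum _ fun i _ => integrable_finsetSum _ fun j _ => hi i j]
    refine Finset.sum_congr rfl fun i _ => ?_
    rw [integral_finsetSum _ fun j _ => hi i j]
    exact Finset.sum_congr rfl fun j _ => integral_const_mul _ _
  have hQc : Continuous Q := by
    rw [funext hQ']
    fun_prop
  have hQ0 : ∀ a, 0 ≤ Q a := fun a => integral_nonneg fun x => sq_nonneg _
  have hQs : ∀ (t : ℝ) a, Q (t • a) = t ^ 2 * Q a := fun t a => by
    simp only [hQ', Finset.mul_sum, Pi.smul_apply, smul_eq_mul]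
    refine Finset.sum_congr rfl fun i _ => Finset.sum_congr rfl fun j _ => by ring
  -- The mean square is a continuous definite quadratic form, so it has a positive minimum on the
  -- unit sphere of coefficients; homogeneity carries this to all coefficients.
  obtain ⟨m, hm, hmQ⟩ : ∃ m, 0 < m ∧ ∀ a ∈ Metric.sphere (0 : Fin n → ℝ) 1, m ≤ Q a := by
    rcases (Metric.sphere (0 : Fin n → ℝ) 1).eq_empty_or_nonempty with h | h
    · exact ⟨1, one_pos, by simp [h]⟩
    · obtain ⟨a, ha, hmin⟩ := (isCompact_sphere (0 : Fin n → ℝ) 1).exists_isMinOn h hQc.continuousOn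
      refine ⟨Q a, lt_of_le_of_ne (hQ0 a) fun h0 => ?_, fun b hb => hmin hb⟩
      have := hdef a h0.symm
      rw [this] at ha
      simp at ha
  have hlow : ∀ a, m * ‖a‖ ^ 2 ≤ Q a := fun a => by
    rcases eq_or_ne a 0 with rfl | ha
    · simpa using hQ0 0
    · have hna : ‖a‖ ≠ 0 := norm_ne_zero_iff.2 ha
      have h1 := hmQ (‖a‖⁻¹ • a) (by simp [norm_smul, hna])
      rw [hQs, inv_pow] at h1
      have h2 : 0 < ‖a‖ ^ 2 := by positivity
      rw [← div_eq_inv_mul, le_div_iff₀ h2] at h1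
      exact h1
  choose c hc using fun i => hB'.exists_bound_of_continuousOn (hf i).continuousOn
  refine ⟨(∑ i, |c i|) ^ 2 / m, by positivity, fun a x hx => ?_⟩
  have h1 : |∑ i, a i * f i x| ≤ ‖a‖ * ∑ i, |c i| := by
    rw [Finset.mul_sum]
    refine (Finset.abs_sum_le_sum_abs _ _).trans (Finset.sum_le_sum fun i _ => ?_)
    rw [abs_mul]
    exact mul_le_mul (norm_le_pi_norm a i) ((hc i x hx).trans (le_abs_self _)) (abs_nonneg _)
      (norm_nonneg _)
  have h2 : (∑ i, a i * f i x) ^ 2 ≤ (‖a‖ * ∑ i, |c i|) ^ 2 := by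
    rw [← sq_abs]
    exact pow_le_pow_left₀ (abs_nonneg _) h1 2
  rw [div_mul_eq_mul_div, le_div_iff₀ hm]
  calc (∑ i, a i * f i x) ^ 2 * m ≤ (‖a‖ * ∑ i, |c i|) ^ 2 * m := by gcongr
    _ = (∑ i, |c i|) ^ 2 * (m * ‖a‖ ^ 2) := by ring
    _ ≤ (∑ i, |c i|) ^ 2 * Q a := by gcongr; exact hlow a

/-- Polynomials of degree at most `k` form a finite-dimensional space on which the mean square over
a ball is definite, so it controls the values on any other compact set. -/
lemma exists_polyFun_sq_le_unit (k : ℕ) {s : ℝ} (hs : 0 < s) : ∃ C, 0 ≤ C ∧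
    ∀ q : MvPolynomial (Fin 2) ℝ, q.totalDegree ≤ k → ∀ x ∈ Metric.closedBall (0 : Plane) 1,
      polyFun q x ^ 2 ≤ C * ∫ x in Metric.closedBall (0 : Plane) s, polyFun q x ^ 2 := by
  set b := Module.finBasis ℝ (MvPolynomial.restrictTotalDegree (Fin 2) ℝ k) with hb
  have hsum : ∀ (a : Fin _ → ℝ) (x : Plane), ∑ i, a i * polyFun (b i : MvPolynomial (Fin 2) ℝ) x
      = polyFun (∑ i, a i • b i : MvPolynomial.restrictTotalDegree (Fin 2) ℝ k) x := fun a x => by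
    simp [polyFun, map_sum, MvPolynomial.smul_eval]
  obtain ⟨C, hC0, hC⟩ := exists_sq_le_integral_sq
    (fun i => polyFun (b i : MvPolynomial (Fin 2) ℝ)) (fun i => continuous_polyFun _)
    (isCompact_closedBall (0 : Plane) s) (isCompact_closedBall (0 : Plane) 1) (by
      intro a ha
      simp only [hsum] at ha
      have h0 := eq_zero_of_integral_polyFun_sq hs _ ha
      have h1 : ∑ i, a i • b i = 0 := Subtype.ext h0
      funext i
      exact Fintype.linearIndependent_iff.1 b.linearIndependent a h1 i)
  refine ⟨C, hC0, fun q hq x hx => ?_⟩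
  set q' : MvPolynomial.restrictTotalDegree (Fin 2) ℝ k :=
    ⟨q, (MvPolynomial.mem_restrictTotalDegree _ _ _).2 hq⟩ with hq'
  have h := hC (fun i => b.repr q' i) x hx
  simp only [hsum, b.sum_repr] at h
  exact h

/-- Inverse estimate for polynomials on concentric balls. -/
lemma exists_polyFun_sq_le (k : ℕ) {s : ℝ} (hs : 0 < s) : ∃ C, 0 ≤ C ∧
    ∀ q : MvPolynomial (Fin 2) ℝ, q.totalDegree ≤ k → ∀ (c : Plane) (h : ℝ), 0 < h →
      ∀ x ∈ Metric.closedBall c h,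
        h ^ 2 * polyFun q x ^ 2 ≤ C * ∫ x in Metric.closedBall c (h * s), polyFun q x ^ 2 := by
  obtain ⟨C, hC0, hC⟩ := exists_polyFun_sq_le_unit k hs
  refine ⟨C, hC0, fun q hq c h hh x hx => ?_⟩
  obtain ⟨q', hq', hqe⟩ := exists_polyFun_comp_affine q hq c h
  have hx' : h⁻¹ • (x - c) ∈ Metric.closedBall (0 : Plane) 1 := by
    rw [mem_closedBall_zero_iff, norm_smul, norm_inv, Real.norm_of_nonneg hh.le, ← dist_eq_norm,
      inv_mul_le_iff₀ hh, mul_one]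
    exact hx
  have h1 := hC q' hq' _ hx'
  rw [hqe, smul_smul, mul_inv_cancel₀ hh.ne', one_smul, add_sub_cancel] at h1
  -- The scaling `y ↦ c + h y` in the plane contributes the factor `h²`.
  have h2 : ∫ y in Metric.closedBall (0 : Plane) s, polyFun q' y ^ 2
      = (h ^ 2)⁻¹ * ∫ x in Metric.closedBall c (h * s), polyFun q x ^ 2 := by
    rw [← integral_indicator measurableSet_closedBall, ← integral_indicator measurableSet_closedBall]
    have e := Measure.integral_comp_smul (volume : Measure Plane)
      (fun y => (Metric.closedBall c (h * s)).indicator (fun x => polyFun q x ^ 2) (c + y)) h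
    rw [integral_add_left_eq_self (μ := volume)
      ((Metric.closedBall c (h * s)).indicator (fun x => polyFun q x ^ 2)) c] at e
    simp only [finrank_euclideanSpace, Fintype.card_fin, smul_eq_mul] at e
    rw [abs_of_nonneg (by positivity)] at e
    rw [← e]
    refine integral_congr_ae (Filter.Eventually.of_forall fun y => ?_)
    have hiff : y ∈ Metric.closedBall (0 : Plane) s ↔ c + h • y ∈ Metric.closedBall c (h * s) := by
      rw [mem_closedBall_zero_iff, mem_closedBall_iff_norm, add_sub_cancel_left, norm_smul,
        Real.norm_of_nonneg hh.le, mul_le_mul_iff_right₀ hh]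
    by_cases hy : y ∈ Metric.closedBall (0 : Plane) s
    · simp only
      rw [Set.indicator_of_mem hy, Set.indicator_of_mem (hiff.1 hy), hqe]
    · simp only
      rw [Set.indicator_of_notMem hy, Set.indicator_of_notMem (fun h' => hy (hiff.2 h'))]
  rw [h2] at h1
  have hh2 : 0 < h ^ 2 := by positivity
  calc h ^ 2 * polyFun q x ^ 2 ≤ h ^ 2 * (C * ((h ^ 2)⁻¹ *
        ∫ x in Metric.closedBall c (h * s), polyFun q x ^ 2)) := by gcongr
    _ = _ := by field_simp

/-! ### Integrals over segments -/

lemma intervalIntegrable_lineMap {a b : Plane} {f : Plane → ℝ}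
    (hf : ContinuousOn f (segment ℝ a b)) :
    IntervalIntegrable (fun t : ℝ => f (AffineMap.lineMap a b t)) volume 0 1 := by
  refine ContinuousOn.intervalIntegrable ?_
  rw [Set.uIcc_of_le zero_le_one]
  exact hf.comp (AffineMap.lineMap_continuous).continuousOn fun t ht => lineMap_mem_segment _ _ _ ht

lemma edgeIntegral_congr {a b : Plane} {f g : Plane → ℝ} (h : Set.EqOn f g (segment ℝ a b)) :
    edgeIntegral a b f = edgeIntegral a b g := by
  rw [edgeIntegral, edgeIntegral]
  congr 1
  refine intervalIntegral.integral_congr fun t ht => ?_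
  rw [Set.uIcc_of_le zero_le_one] at ht
  exact h (lineMap_mem_segment _ _ _ ht)

lemma edgeIntegral_mono {a b : Plane} {f g : Plane → ℝ} (hf : ContinuousOn f (segment ℝ a b))
    (hg : ContinuousOn g (segment ℝ a b)) (h : ∀ x ∈ segment ℝ a b, f x ≤ g x) :
    edgeIntegral a b f ≤ edgeIntegral a b g := by
  refine mul_le_mul_of_nonneg_left ?_ dist_nonneg
  exact intervalIntegral.integral_mono_on zero_le_one (intervalIntegrable_lineMap hf)
    (intervalIntegrable_lineMap hg) fun t ht => h _ (lineMap_mem_segment _ _ _ ht)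

lemma edgeIntegral_const (a b : Plane) (c : ℝ) : edgeIntegral a b (fun _ => c) = dist a b * c := by
  simp [edgeIntegral]

lemma edgeIntegral_const_mul (a b : Plane) (c : ℝ) (f : Plane → ℝ) :
    edgeIntegral a b (fun x => c * f x) = c * edgeIntegral a b f := by
  rw [edgeIntegral, intervalIntegral.integral_const_mul, edgeIntegral]; ring

lemma edgeIntegral_add {a b : Plane} {f g : Plane → ℝ} (hf : ContinuousOn f (segment ℝ a b))
    (hg : ContinuousOn g (segment ℝ a b)) :
    edgeIntegral a b (fun x => f x + g x) = edgeIntegral a b f + edgeIntegral a b g := by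
  rw [edgeIntegral, intervalIntegral.integral_add (intervalIntegrable_lineMap hf)
    (intervalIntegrable_lineMap hg), edgeIntegral, edgeIntegral]; ring

lemma edgeIntegral_sub {a b : Plane} {f g : Plane → ℝ} (hf : ContinuousOn f (segment ℝ a b))
    (hg : ContinuousOn g (segment ℝ a b)) :
    edgeIntegral a b (fun x => f x - g x) = edgeIntegral a b f - edgeIntegral a b g := by
  rw [edgeIntegral, intervalIntegral.integral_sub (intervalIntegrable_lineMap hf)
    (intervalIntegrable_lineMap hg), edgeIntegral, edgeIntegral]; ring

lemma edgeIntegral_nonneg {a b : Plane} {f : Plane → ℝ} (h : ∀ x ∈ segment ℝ a b, 0 ≤ f x) :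
    0 ≤ edgeIntegral a b f :=
  mul_nonneg dist_nonneg (intervalIntegral.integral_nonneg zero_le_one fun _ ht =>
    h _ (lineMap_mem_segment _ _ _ ht))

/-- An integral over a segment is bounded by the length times a bound of the integrand. -/
lemma abs_edgeIntegral_le {a b : Plane} {f : Plane → ℝ} {c : ℝ}
    (h : ∀ x ∈ segment ℝ a b, |f x| ≤ c) : |edgeIntegral a b f| ≤ dist a b * c := by
  rw [edgeIntegral, abs_mul, abs_of_nonneg dist_nonneg]
  refine mul_le_mul_of_nonneg_left ?_ dist_nonneg
  have := intervalIntegral.norm_integral_le_of_norm_le_const (a := 0) (b := 1) (C := c)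
    (f := fun t : ℝ => f (AffineMap.lineMap a b t)) fun t ht => by
      rw [Set.uIoc_of_le zero_le_one] at ht
      exact h _ (lineMap_mem_segment _ _ _ ⟨ht.1.le, ht.2⟩)
  simpa using this

namespace Triangulation

variable {Ω : Set Plane} (T : Triangulation Ω)

/-! ### Finite element functions on a triangle -/

/-- A triangle is convex with nonempty interior, so derivatives within it are unique even at
boundary points, and the gradient is that of the polynomial. -/
lemma cellGrad_eq_polyGrad {v : Plane → ℝ} {K : Fin T.numCells} {q : MvPolynomial (Fin 2) ℝ}
    (hq : ∀ x ∈ T.cell K, v x = polyFun q x) {x : Plane} (hx : x ∈ T.cell K) :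
    T.cellGrad v K x = polyGrad q x := by
  have hu : UniqueDiffWithinAt ℝ (T.cell K) x :=
    uniqueDiffOn_convex (T.convex_cell K) (T.interior_cell_nonempty K) x hx
  have h : HasFDerivWithinAt v (innerSL ℝ (polyGrad q x)) (T.cell K) x :=
    (hasFDerivAt_polyFun q x).hasFDerivWithinAt.congr hq (hq x hx)
  rw [cellGrad, gradientWithin, h.fderivWithin hu]
  exact (InnerProductSpace.toDual ℝ Plane).symm_apply_apply (polyGrad q x)

lemma exists_polyFun {k : ℕ} {v : Plane → ℝ} (hv : v ∈ T.feSpace k) (K : Fin T.numCells) :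
    ∃ q : MvPolynomial (Fin 2) ℝ, q.totalDegree ≤ k ∧ ∀ x ∈ T.cell K, v x = polyFun q x :=
  hv.2 K

lemma continuousOn_cellGrad {k : ℕ} {v : Plane → ℝ} (hv : v ∈ T.feSpace k) (K : Fin T.numCells) :
    ContinuousOn (T.cellGrad v K) (T.cell K) := by
  obtain ⟨q, -, hq⟩ := T.exists_polyFun hv K
  exact (continuous_polyGrad q).continuousOn.congr fun x hx => T.cellGrad_eq_polyGrad hq hx

lemma continuousOn_cell {k : ℕ} {v : Plane → ℝ} (hv : v ∈ T.feSpace k) (K : Fin T.numCells) :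
    ContinuousOn v (T.cell K) := hv.1.mono (T.cell_subset_closure K)

lemma cellGrad_add {k : ℕ} {v w : Plane → ℝ} (hv : v ∈ T.feSpace k) (hw : w ∈ T.feSpace k)
    (α : ℝ) {K : Fin T.numCells} {x : Plane} (hx : x ∈ T.cell K) :
    T.cellGrad (fun y => v y + α * w y) K x = T.cellGrad v K x + α • T.cellGrad w K x := by
  obtain ⟨q, -, hq⟩ := T.exists_polyFun hv K
  obtain ⟨r, -, hr⟩ := T.exists_polyFun hw K
  have h : ∀ y ∈ T.cell K, v y + α * w y = polyFun (q + MvPolynomial.C α * r) y := fun y hy => by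
    rw [hq y hy, hr y hy]; simp [polyFun]
  rw [T.cellGrad_eq_polyGrad hq hx, T.cellGrad_eq_polyGrad hr hx, T.cellGrad_eq_polyGrad h hx]
  ext i
  simp [polyGrad, polyFun]

lemma feSpace_add {k : ℕ} {v w : Plane → ℝ} (hv : v ∈ T.feSpace k) (hw : w ∈ T.feSpace k)
    (α : ℝ) : (fun y => v y + α * w y) ∈ T.feSpace k := by
  refine ⟨hv.1.add (continuousOn_const.mul hw.1), fun K => ?_⟩
  obtain ⟨q, hqd, hq⟩ := hv.2 K
  obtain ⟨r, hrd, hr⟩ := hw.2 K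
  refine ⟨q + MvPolynomial.C α * r, ?_, fun x hx => ?_⟩
  · refine (MvPolynomial.totalDegree_add _ _).trans (max_le hqd ?_)
    refine (MvPolynomial.totalDegree_mul _ _).trans ?_
    rw [MvPolynomial.totalDegree_C, zero_add]; exact hrd
  · simp only
    rw [hq x hx, hr x hx]; simp

/-- The squared gradient norm on a triangle. -/
def cellEnergy (v : Plane → ℝ) (K : Fin T.numCells) : ℝ :=
  ∫ x in T.cell K, ‖T.cellGrad v K x‖ ^ 2

lemma cellEnergy_nonneg (v : Plane → ℝ) (K : Fin T.numCells) : 0 ≤ T.cellEnergy v K :=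
  integral_nonneg fun _ => sq_nonneg _

/-! ### Coercivity of the form on the diagonal -/

/-- The squared weighted boundary norm `‖|β · n|^{1/2} v‖²`. -/
def fluxNormSq (β : Plane → Plane) (v : Plane → ℝ) : ℝ :=
  T.boundaryIntegral fun F x => |inner ℝ (β x) (T.normal F)| * v x ^ 2

/-- The two boundary terms have opposite signs and cancel on the diagonal. -/
lemma nitscheForm_self (v : Plane → ℝ) : T.nitscheForm v v = ∑ K, T.cellEnergy v K := by
  rw [nitscheForm, domainIntegral]
  simp only [real_inner_self_eq_norm_sq, mul_comm (v _), sub_add_cancel, cellEnergy]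

lemma face_subset_closure (F : Fin T.numCells × Fin 3) :
    segment ℝ (T.faceA F) (T.faceB F) ⊆ closure Ω :=
  (T.face_subset_cell F).trans (T.cell_subset_closure F.1)

/-- The triangle inequality for the flux is applied to `g = v²`, with `∇(v²) = 2 v ∇v`. Since `v` is
continuous and neighbouring normals are opposite, the fluxes through interior faces cancel. -/
lemma sum_edgeIntegral_le_convection (hΩ : IsOpen Ω) (hreg : interior (closure Ω) = Ω)
    {β : Plane → Plane} (hβ : IsAdmissibleVelocity Ω 0 β) {k : ℕ} {v : Plane → ℝ}
    (hv : v ∈ T.feSpace k) :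
    1 / 2 * T.boundaryIntegral (fun F x => inner ℝ (β x) (T.normal F) * v x ^ 2)
      ≤ T.domainIntegral (fun K x => (0 * v x + inner ℝ (β x) (T.cellGrad v K x)) * v x) := by
  set e : Fin T.numCells × Fin 3 → ℝ := fun F => edgeIntegral (T.faceA F) (T.faceB F)
    (fun x => inner ℝ (β x) (T.normal F) * v x ^ 2) with he
  have hodd : ∀ F G, T.Partner F G → e G = -e F := by
    intro F G h
    have h1 : e G = edgeIntegral (T.faceA F) (T.faceB F)
        (fun x => inner ℝ (β x) (T.normal G) * v x ^ 2) := by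
      rcases T.partner_ends h with ⟨h1, h2⟩ | ⟨h1, h2⟩
      · rw [h1, h2]
      · rw [h1, h2, edgeIntegral_comm]
    rw [h1, T.partner_normal h]
    simp only [he, inner_neg_right]
    rw [← neg_one_mul, ← edgeIntegral_const_mul]
    congr 1
    funext x
    ring
  have hcell : ∀ K, 1 / 2 * ∑ j, e (K, j)
      ≤ ∫ x in T.cell K, (0 * v x + inner ℝ (β x) (T.cellGrad v K x)) * v x := by
    intro K
    obtain ⟨q, -, hq⟩ := T.exists_polyFun hv K
    have h := T.sum_edgeIntegral_le_integral_cell hΩ hreg hβ (g := fun x => polyFun q x ^ 2)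
      ((contDiff_polyFun q).pow 2) (fun x => sq_nonneg _) K
    have h1 : ∀ j, e (K, j) = edgeIntegral (T.faceA (K, j)) (T.faceB (K, j))
        (fun x => inner ℝ (β x) (T.normal (K, j)) * polyFun q x ^ 2) := fun j =>
      edgeIntegral_congr fun x hx => by
        rw [hq x (T.face_subset_cell (K, j) hx)]
    simp only [h1]
    have h2 : ∫ x in T.cell K, (0 * v x + inner ℝ (β x) (T.cellGrad v K x)) * v x
        = 1 / 2 * ∫ x in T.cell K, fderiv ℝ (fun x => polyFun q x ^ 2) x (β x) := by
      rw [← integral_const_mul]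
      refine setIntegral_congr_fun (T.isClosed_cell K).measurableSet fun x hx => ?_
      have hd : HasFDerivAt (fun x => polyFun q x ^ 2) _ x := (hasFDerivAt_polyFun q x).pow 2
      rw [hd.fderiv, T.cellGrad_eq_polyGrad hq hx, hq x hx]
      simp [real_inner_comm]
      ring
    rw [h2]
    exact mul_le_mul_of_nonneg_left h (by norm_num)
  have hsum : T.boundaryIntegral (fun F x => inner ℝ (β x) (T.normal F) * v x ^ 2)
      = ∑ K, ∑ j, e (K, j) := by
    rw [boundaryIntegral, ← T.sum_faces_eq_sum_boundaryFaces hΩ hreg e hodd, Fintype.sum_prod_type]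
  rw [hsum, Finset.mul_sum, domainIntegral]
  exact Finset.sum_le_sum fun K _ => hcell K

/-- The boundary integral of half of `(β · n) v²` minus the inflow part `min(β · n, 0) v²` is that
of half of `|β · n| v²`. -/
lemma convDiffForm_self_ge (hΩ : IsOpen Ω) (hreg : interior (closure Ω) = Ω)
    {β : Plane → Plane} (hβ : IsAdmissibleVelocity Ω 0 β) {k : ℕ} {v : Plane → ℝ}
    (hv : v ∈ T.feSpace k) (ε : ℝ) :
    1 / 2 * T.fluxNormSq β v + ε * ∑ K, T.cellEnergy v K ≤ T.convDiffForm 0 ε β v v := by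
  have h1 := T.sum_edgeIntegral_le_convection hΩ hreg hβ hv
  have h2 : T.boundaryIntegral (fun F => {x | inner ℝ (β x) (T.normal F) < 0}.indicator
        fun x => inner ℝ (β x) (T.normal F) * v x * v x)
      = 1 / 2 * T.boundaryIntegral (fun F x => inner ℝ (β x) (T.normal F) * v x ^ 2)
        - 1 / 2 * T.fluxNormSq β v := by
    rw [fluxNormSq, boundaryIntegral, boundaryIntegral, boundaryIntegral, Finset.mul_sum,
      Finset.mul_sum, ← Finset.sum_sub_distrib]
    refine Finset.sum_congr rfl fun F _ => ?_
    have hb : ContinuousOn (fun x => inner ℝ (β x) (T.normal F))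
        (segment ℝ (T.faceA F) (T.faceB F)) :=
      (hβ.continuousOn.mono (T.face_subset_closure F)).inner continuousOn_const
    have hvc : ContinuousOn v (segment ℝ (T.faceA F) (T.faceB F)) :=
      hv.1.mono (T.face_subset_closure F)
    have hsub := edgeIntegral_sub (f := fun x => inner ℝ (β x) (T.normal F) * v x ^ 2)
      (g := fun x => |inner ℝ (β x) (T.normal F)| * v x ^ 2)
      (hb.mul (hvc.pow 2)) (hb.abs.mul (hvc.pow 2))
    rw [← mul_sub, ← hsub, ← edgeIntegral_const_mul]
    congr 1
    funext x
    by_cases hx : inner ℝ (β x) (T.normal F) < 0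
    · rw [Set.indicator_of_mem (by exact hx), abs_of_neg hx]; ring
    · rw [Set.indicator_of_notMem (by exact hx), abs_of_nonneg (not_lt.1 hx)]; ring
  rw [convDiffForm, h2, nitscheForm_self]
  linarith

/-! ### Regular meshes -/

/-- All triangles have size comparable to the mesh parameter, with constant `M`. -/
structure Regular (M : ℝ) : Prop where
  one_le : 1 ≤ M
  h_pos : 0 < T.h
  ball : ∀ K, ∃ c, Metric.closedBall c (T.h / M) ⊆ T.cell K
  h_le : ∀ K, T.h ≤ M * T.hK K

lemma hK_le_h (K : Fin T.numCells) : T.hK K ≤ T.h :=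
  le_ciSup (Set.finite_range T.hK).bddAbove K

lemma dist_le_hK {K : Fin T.numCells} {x y : Plane} (hx : x ∈ T.cell K) (hy : y ∈ T.cell K) :
    dist x y ≤ T.hK K :=
  Metric.dist_le_diam_of_mem (T.isCompact_cell K).isBounded hx hy

lemma dist_le_h {K : Fin T.numCells} {x y : Plane} (hx : x ∈ T.cell K) (hy : y ∈ T.cell K) :
    dist x y ≤ T.h := (T.dist_le_hK hx hy).trans (T.hK_le_h K)

lemma hK_pos (K : Fin T.numCells) : 0 < T.hK K :=
  (T.dist_face_pos (K, 0)).trans_le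
    (T.dist_le_hK (T.faceA_mem_cell (K, 0)) (T.faceB_mem_cell (K, 0)))

lemma rhoK_bddAbove (K : Fin T.numCells) :
    BddAbove {r : ℝ | ∃ c : Plane, Metric.closedBall c r ⊆ T.cell K} := by
  refine ⟨T.hK K, ?_⟩
  rintro r ⟨c, hc⟩
  rcases lt_or_ge r 0 with hr | hr
  · exact hr.le.trans (T.hK_pos K).le
  · have h1 : c + r • EuclideanSpace.single (0 : Fin 2) (1 : ℝ) ∈ T.cell K := hc (by
      rw [mem_closedBall_iff_norm, add_sub_cancel_left, norm_smul, Real.norm_of_nonneg hr]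
      simp)
    have h2 := T.dist_le_hK h1 (hc (Metric.mem_closedBall_self hr))
    rw [dist_eq_norm, add_sub_cancel_left, norm_smul, Real.norm_of_nonneg hr] at h2
    simpa using h2

lemma rhoK_pos (K : Fin T.numCells) : 0 < T.rhoK K := by
  obtain ⟨c, hc⟩ := T.interior_cell_nonempty K
  obtain ⟨r, hr, hrs⟩ := Metric.nhds_basis_closedBall.mem_iff.1 (mem_interior_iff_mem_nhds.1 hc)
  exact lt_of_lt_of_le hr (le_csSup (T.rhoK_bddAbove K) ⟨c, hrs⟩)

/-- The two mesh conditions bound `h` by a multiple of every `ρ_K`. The factor `2` makes the radius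
strictly smaller than the supremum `ρ_K`, so that a ball of at least this radius is available. -/
lemma regular_of_shapeRegular {cρ cq : ℝ} (hρ : T.ShapeRegular cρ) (hq : T.QuasiUniform cq)
    (hne : Nonempty (Fin T.numCells)) : T.Regular (2 * (max 1 cρ * max 1 cq)) := by
  have hK₀ := T.hK_pos hne.some
  have hh : 0 < T.h := hK₀.trans_le (T.hK_le_h _)
  have hm1 : 1 ≤ max 1 cρ := le_max_left _ _
  have hm2 : 1 ≤ max 1 cq := le_max_left _ _
  have hm : 1 ≤ max 1 cρ * max 1 cq := by nlinarith
  have hle : ∀ K, T.h ≤ max 1 cq * T.hK K := fun K =>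
    (hq K).trans (mul_le_mul_of_nonneg_right (le_max_right _ _) (T.hK_pos K).le)
  refine ⟨by linarith, hh, fun K => ?_, fun K => (hle K).trans ?_⟩
  · have h1 : T.hK K ≤ max 1 cρ * T.rhoK K :=
      ((div_le_iff₀ (T.rhoK_pos K)).1 (hρ K)).trans
        (mul_le_mul_of_nonneg_right (le_max_right _ _) (T.rhoK_pos K).le)
    have h2 : T.h / (2 * (max 1 cρ * max 1 cq)) < T.rhoK K := by
      rw [div_lt_iff₀ (by positivity)]
      have h3 : T.h ≤ max 1 cq * (max 1 cρ * T.rhoK K) :=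
        (hle K).trans (mul_le_mul_of_nonneg_left h1 (by positivity))
      have h4 : 0 < max 1 cq * (max 1 cρ * T.rhoK K) := by
        have := T.rhoK_pos K
        positivity
      nlinarith
    obtain ⟨r, ⟨c, hc⟩, hr⟩ := exists_lt_of_lt_csSup
      (s := {r : ℝ | ∃ c : Plane, Metric.closedBall c r ⊆ T.cell K})
      -- A closed ball of negative radius is empty, so `-1` always belongs to the set of radii.
      (Set.nonempty_of_mem (x := -1) ⟨0, by
        rw [Metric.closedBall_eq_empty.2 (by norm_num)]; exact Set.empty_subset _⟩) h2
    exact ⟨c, (Metric.closedBall_subset_closedBall hr.le).trans hc⟩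
  · refine mul_le_mul_of_nonneg_right ?_ (T.hK_pos K).le
    nlinarith

section regular

variable {T} {M : ℝ}

lemma Regular.M_pos (hT : T.Regular M) : 0 < M := one_pos.trans_le hT.one_le

/-- From the centre of the inscribed ball, moving by its radius `h / M` in the direction of the
gradient stays in the triangle, where the coordinate only takes values in `[0, 1]`. -/
lemma Regular.norm_glam_le (hT : T.Regular M) (K : Fin T.numCells) (j : Fin 3) :
    ‖T.glam K j‖ ≤ M / T.h := by
  obtain ⟨c, hc⟩ := hT.ball K
  have hM := hT.M_pos
  have hh := hT.h_pos
  have hg : 0 < ‖T.glam K j‖ := norm_pos_iff.2 (T.glam_ne_zero K j)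
  set r := T.h / M with hr
  have hr0 : 0 < r := div_pos hh hM
  have hmem : c + (r / ‖T.glam K j‖) • T.glam K j ∈ T.cell K := hc (by
    rw [mem_closedBall_iff_norm, add_sub_cancel_left, norm_smul, Real.norm_of_nonneg (by positivity),
      div_mul_cancel₀ _ hg.ne'])
  have h1 := T.lam_sub K j (c + (r / ‖T.glam K j‖) • T.glam K j) c
  rw [add_sub_cancel_left, inner_smul_right, real_inner_self_eq_norm_sq] at h1
  have h2 := T.lam_le_one hmem j
  have h3 := T.mem_cell.1 (hc (Metric.mem_closedBall_self hr0.le)) j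
  have h4 : r / ‖T.glam K j‖ * ‖T.glam K j‖ ^ 2 = r * ‖T.glam K j‖ := by field_simp
  have h5 : r * ‖T.glam K j‖ ≤ 1 := by linarith
  rw [hr] at h5
  rw [le_div_iff₀ hh]
  rw [div_mul_eq_mul_div, div_le_one hM] at h5
  linarith

/-- The coordinate grows from `0` to `1` between the face and the apex, over a distance of at most
`h`. -/
lemma Regular.one_le_norm_glam (hT : T.Regular M) (K : Fin T.numCells) (j : Fin 3) :
    1 / T.h ≤ ‖T.glam K j‖ := by
  have h1 := T.glam_inner_apex (K, j)
  have h2 := real_inner_le_norm (T.glam K j) (T.apex (K, j) - T.faceA (K, j))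
  have h3 := T.dist_le_h (T.apex_mem_cell (K, j)) (T.faceA_mem_cell (K, j))
  rw [dist_eq_norm] at h3
  rw [div_le_iff₀ hT.h_pos, ← h1]
  exact h2.trans (mul_le_mul_of_nonneg_left h3 (norm_nonneg _))

lemma Regular.dist_face_le (_hT : T.Regular M) (F : Fin T.numCells × Fin 3) :
    dist (T.faceA F) (T.faceB F) ≤ T.h := T.dist_le_h (T.faceA_mem_cell F) (T.faceB_mem_cell F)

/-- One coordinate changes by `1` along the face, and its slope is at most `M / h`. -/
lemma Regular.le_dist_face (hT : T.Regular M) (F : Fin T.numCells × Fin 3) :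
    T.h / M ≤ dist (T.faceA F) (T.faceB F) := by
  have h1 := T.lam_sub F.1 (F.2 + 1) (T.faceA F) (T.faceB F)
  have h2 := real_inner_le_norm (T.glam F.1 (F.2 + 1)) (T.faceA F - T.faceB F)
  rw [← h1, ← dist_eq_norm, faceA, faceB, T.lam_vert, T.lam_vert, if_pos rfl, if_neg (by
    generalize F.2 = j; revert j; decide), sub_zero] at h2
  have h3 := h2.trans (mul_le_mul_of_nonneg_right (hT.norm_glam_le F.1 (F.2 + 1)) dist_nonneg)
  rw [div_mul_eq_mul_div, le_div_iff₀ hT.h_pos, one_mul] at h3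
  rw [div_le_iff₀ hT.M_pos, mul_comm]
  exact h3

/-- The volume of the unit disc. -/
def discVolume : ℝ := volume.real (Metric.ball (0 : Plane) 1)

lemma discVolume_pos : 0 < discVolume :=
  ENNReal.toReal_pos (Metric.measure_ball_pos volume _ one_pos).ne' measure_ball_lt_top.ne

lemma volume_real_closedBall (x : Plane) {r : ℝ} (hr : 0 ≤ r) :
    volume.real (Metric.closedBall x r) = r ^ 2 * discVolume := by
  rw [Measure.real, Measure.addHaar_closedBall _ _ hr, ENNReal.toReal_mul,
    ENNReal.toReal_ofReal (by positivity), finrank_euclideanSpace, Fintype.card_fin]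
  rfl

lemma Regular.volume_cell_le (hT : T.Regular M) (K : Fin T.numCells) :
    volume.real (T.cell K) ≤ discVolume * T.h ^ 2 := by
  rw [mul_comm, ← volume_real_closedBall (T.vert K 0) hT.h_pos.le]
  exact measureReal_mono (fun x hx => T.dist_le_h hx (T.vert_mem_cell K 0))
    measure_closedBall_lt_top.ne

lemma Regular.le_volume_interior (hT : T.Regular M) (K : Fin T.numCells) :
    (T.h / M) ^ 2 * discVolume ≤ volume.real (interior (T.cell K)) := by
  obtain ⟨c, hc⟩ := hT.ball K
  have hr : 0 ≤ T.h / M := (div_pos hT.h_pos hT.M_pos).le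
  have h1 : volume.real (interior (T.cell K)) = volume.real (T.cell K) :=
    measureReal_congr (interior_ae_eq_of_null_frontier (T.volume_frontier_cell K))
  rw [h1, ← volume_real_closedBall c hr]
  exact measureReal_mono hc (T.isCompact_cell K).measure_lt_top.ne

/-- A ball of radius `R h` contains a bounded number of triangles. -/
lemma Regular.card_le (hT : T.Regular M) {R : ℝ} (hR : 0 ≤ R) (x : Plane)
    (s : Finset (Fin T.numCells)) (hs : ∀ K ∈ s, T.cell K ⊆ Metric.closedBall x (R * T.h)) :
    (s.card : ℝ) ≤ (R * M) ^ 2 := by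
  have hh := hT.h_pos
  have hM := hT.M_pos
  -- Volume comparison: the interiors are disjoint, contained in the large ball, and each has at
  -- least the volume of a disc of radius `h / M`.
  have hd : Set.PairwiseDisjoint (s : Set (Fin T.numCells)) fun K => interior (T.cell K) := by
    intro K _ L _ hne
    rw [Function.onFun, Set.disjoint_left]
    intro y hy hy'
    exact hne (T.eq_of_mem_interior_cell hy (interior_subset hy'))
  have h1 : volume.real (⋃ K ∈ s, interior (T.cell K))
      = ∑ K ∈ s, volume.real (interior (T.cell K)) :=
    measureReal_biUnion_finset hd (fun K _ => isOpen_interior.measurableSet)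
      (fun K _ => ((measure_mono interior_subset).trans_lt (T.isCompact_cell K).measure_lt_top).ne)
  have h2 : volume.real (⋃ K ∈ s, interior (T.cell K)) ≤ (R * T.h) ^ 2 * discVolume := by
    rw [← volume_real_closedBall x (by positivity)]
    refine measureReal_mono ?_ measure_closedBall_lt_top.ne
    exact Set.iUnion₂_subset fun K hK => interior_subset.trans (hs K hK)
  have h3 : (s.card : ℝ) * ((T.h / M) ^ 2 * discVolume) ≤ (R * T.h) ^ 2 * discVolume := by
    rw [← nsmul_eq_mul]
    refine le_trans ?_ h2
    rw [h1]
    exact Finset.card_nsmul_le_sum _ _ _ fun K _ => hT.le_volume_interior K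
  have h4 := discVolume_pos
  rw [← mul_assoc, mul_le_mul_iff_left₀ h4, div_pow, ← mul_div_assoc, div_le_iff₀ (by positivity)]
    at h3
  have h5 : 0 < T.h ^ 2 := by positivity
  have h6 : (s.card : ℝ) * T.h ^ 2 ≤ (R * M) ^ 2 * T.h ^ 2 := by
    calc _ ≤ _ := h3
      _ = _ := by ring
  exact le_of_mul_le_mul_right h6 h5

end regular

/-! ### Inverse estimate and oscillation of finite element functions. -/

lemma totalDegree_pderiv_le (q : MvPolynomial (Fin 2) ℝ) (i : Fin 2) :
    (MvPolynomial.pderiv i q).totalDegree ≤ q.totalDegree := by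
  conv_lhs => rw [q.as_sum, map_sum]
  refine (MvPolynomial.totalDegree_finsetSum _ _).trans (Finset.sup_le fun d hd => ?_)
  rw [MvPolynomial.pderiv_monomial]
  refine (MvPolynomial.totalDegree_monomial_le _ _).trans ?_
  refine le_trans ?_ (MvPolynomial.le_totalDegree hd)
  rw [Finsupp.sum_fintype _ _ (fun _ => rfl), Finsupp.sum_fintype _ _ (fun _ => rfl)]
  exact Finset.sum_le_sum fun j _ => Nat.sub_le _ _

/-- Inverse estimate for the gradient of finite element functions. -/
lemma exists_inverse_estimate (k : ℕ) {M : ℝ} (hM : 0 < M) : ∃ C, 0 ≤ C ∧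
    ∀ (Ω : Set Plane) (T : Triangulation Ω), T.Regular M → ∀ v ∈ T.feSpace k,
      ∀ K, ∀ x ∈ T.cell K, T.h ^ 2 * ‖T.cellGrad v K x‖ ^ 2 ≤ C * T.cellEnergy v K := by
  obtain ⟨C, hC0, hC⟩ := exists_polyFun_sq_le k (s := 1 / M) (by positivity)
  refine ⟨C, hC0, fun Ω T hT v hv K x hx => ?_⟩
  obtain ⟨q, hqd, hq⟩ := T.exists_polyFun hv K
  obtain ⟨c, hc⟩ := hT.ball K
  have hh := hT.h_pos
  have hcK : c ∈ T.cell K := hc (Metric.mem_closedBall_self (by positivity))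
  have hxb : x ∈ Metric.closedBall c T.h := T.dist_le_h hx hcK
  have hdeg : ∀ i, (MvPolynomial.pderiv i q).totalDegree ≤ k := fun i =>
    (totalDegree_pderiv_le q i).trans hqd
  -- The triangle lies between the concentric balls of radius `h / M` and `h`. The estimate is used
  -- for each partial derivative, again a polynomial of degree at most `k`.
  have h1 := fun i => hC _ (hdeg i) c T.h hh x hxb
  have hcont : ∀ i, Continuous fun y => polyFun (MvPolynomial.pderiv i q) y ^ 2 := fun i =>
    (continuous_polyFun _).pow 2
  have hint : ∀ i (s : Set Plane), IsCompact s →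
      IntegrableOn (fun y => polyFun (MvPolynomial.pderiv i q) y ^ 2) s := fun i s hs =>
    (hcont i).continuousOn.integrableOn_compact hs
  have h2 : ∀ i, ∫ y in Metric.closedBall c (T.h * (1 / M)),
      polyFun (MvPolynomial.pderiv i q) y ^ 2
      ≤ ∫ y in T.cell K, polyFun (MvPolynomial.pderiv i q) y ^ 2 := fun i => by
    rw [mul_one_div]
    exact setIntegral_mono_set (hint i _ (T.isCompact_cell K))
      (Filter.Eventually.of_forall fun y => sq_nonneg _) hc.eventuallyLE
  have h3 : T.cellEnergy v K = (∫ y in T.cell K, polyFun (MvPolynomial.pderiv 0 q) y ^ 2)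
      + ∫ y in T.cell K, polyFun (MvPolynomial.pderiv 1 q) y ^ 2 := by
    rw [cellEnergy, ← integral_add (hint 0 _ (T.isCompact_cell K)) (hint 1 _ (T.isCompact_cell K))]
    refine setIntegral_congr_fun (T.isClosed_cell K).measurableSet fun y hy => ?_
    simp only [T.cellGrad_eq_polyGrad hq hy, plane_norm_sq]
    rfl
  have h4 : ‖T.cellGrad v K x‖ ^ 2 = polyFun (MvPolynomial.pderiv 0 q) x ^ 2
      + polyFun (MvPolynomial.pderiv 1 q) x ^ 2 := by
    rw [T.cellGrad_eq_polyGrad hq hx, plane_norm_sq]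
    rfl
  rw [h3, h4, mul_add, mul_add]
  exact add_le_add ((h1 0).trans (mul_le_mul_of_nonneg_left (h2 0) hC0))
    ((h1 1).trans (mul_le_mul_of_nonneg_left (h2 1) hC0))

lemma abs_sub_le_of_cellGrad_le {k : ℕ} {v : Plane → ℝ} (hv : v ∈ T.feSpace k)
    {K : Fin T.numCells} {o : ℝ} (hh : 0 < T.h)
    (ho : ∀ x ∈ T.cell K, ‖T.cellGrad v K x‖ ≤ o / T.h) {x y : Plane}
    (hx : x ∈ T.cell K) (hy : y ∈ T.cell K) : |v x - v y| ≤ o := by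
  obtain ⟨q, hqd, hq⟩ := T.exists_polyFun hv K
  have h := (T.convex_cell K).norm_image_sub_le_of_norm_hasFDerivWithin_le (f := polyFun q)
    (f' := fun z => innerSL ℝ (polyGrad q z)) (C := o / T.h)
    (fun z _ => (hasFDerivAt_polyFun q z).hasFDerivWithinAt)
    (fun z hz => by rw [innerSL_apply_norm, ← T.cellGrad_eq_polyGrad hq hz]; exact ho z hz) hy hx
  rw [← hq x hx, ← hq y hy, ← dist_eq_norm x y] at h
  have h0 : 0 ≤ o / T.h := (norm_nonneg _).trans (ho x hx)
  calc |v x - v y| ≤ o / T.h * dist x y := h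
    _ ≤ o / T.h * T.h := mul_le_mul_of_nonneg_left (T.dist_le_h hx hy) h0
    _ = o := div_mul_cancel₀ _ hh.ne'

open Classical in
/-- Along a connected set, a continuous function varies at most by the sum of its oscillations
on the triangles that meet the set. -/
lemma abs_sub_le_sum_of_isPreconnected {v : Plane → ℝ} (hv : ContinuousOn v (closure Ω))
    {o : Fin T.numCells → ℝ} (ho : ∀ K, ∀ x ∈ T.cell K, ∀ y ∈ T.cell K, |v x - v y| ≤ o K)
    {S : Set Plane} (hS : IsPreconnected S) (hSΩ : S ⊆ closure Ω) {x y : Plane} (hx : x ∈ S)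
    (hy : y ∈ S) :
    |v x - v y| ≤ ∑ K ∈ Finset.univ.filter (fun K => (S ∩ T.cell K).Nonempty), o K := by
  have ho0 : ∀ K, 0 ≤ o K := fun K =>
    (abs_nonneg _).trans (ho K _ (T.vert_mem_cell K 0) _ (T.vert_mem_cell K 0))
  have himg : IsPreconnected (v '' S) := hS.image v (hv.mono hSΩ)
  -- The interval between the two values is covered by the images of the triangles that meet `S`, so
  -- its length is at most the sum of the diameters of these images. No path through the mesh has to
  -- be selected.
  have hsub : Set.uIcc (v y) (v x) ⊆ ⋃ K ∈ Finset.univ.filter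
      (fun K => (S ∩ T.cell K).Nonempty), v '' T.cell K := by
    intro t ht
    obtain ⟨z, hz, rfl⟩ := himg.ordConnected.uIcc_subset ⟨y, hy, rfl⟩ ⟨x, hx, rfl⟩ ht
    obtain ⟨K, hK⟩ := T.exists_mem_cell (hSΩ hz)
    simp only [Set.mem_iUnion]
    exact ⟨K, by simpa using ⟨z, hz, hK⟩, z, hK, rfl⟩
  have hvol : ∀ K, volume (v '' T.cell K) ≤ ENNReal.ofReal (o K) := fun K => by
    refine (Real.volume_le_diam _).trans (Metric.ediam_le ?_)
    rintro _ ⟨a, ha, rfl⟩ _ ⟨b, hb, rfl⟩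
    rw [edist_dist, Real.dist_eq]
    exact ENNReal.ofReal_le_ofReal (ho K a ha b hb)
  have h1 : volume (Set.uIcc (v y) (v x)) ≤ ∑ K ∈ Finset.univ.filter
      (fun K => (S ∩ T.cell K).Nonempty), ENNReal.ofReal (o K) :=
    (measure_mono hsub).trans ((measure_biUnion_finset_le _ _).trans
      (Finset.sum_le_sum fun K _ => hvol K))
  rw [Real.volume_interval, ← ENNReal.ofReal_sum_of_nonneg fun K _ => ho0 K,
    ENNReal.ofReal_le_ofReal_iff (Finset.sum_nonneg fun K _ => ho0 K)] at h1
  exact h1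

/-! ### Piecewise linear interpolation -/

/-- The affine function on the triangle `K` with given nodal values. -/
def cellInterp (g : Plane → ℝ) (K : Fin T.numCells) (x : Plane) : ℝ :=
  ∑ j, g (T.vert K j) * T.lam K j x

open Classical in
/-- The continuous piecewise linear function with given nodal values. -/
def interp (g : Plane → ℝ) (x : Plane) : ℝ :=
  if hx : ∃ K, x ∈ T.cell K then T.cellInterp g hx.choose x else 0

lemma cellInterp_vert (g : Plane → ℝ) (K : Fin T.numCells) (j : Fin 3) :
    T.cellInterp g K (T.vert K j) = g (T.vert K j) := by
  simp [cellInterp, lam_vert]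

lemma cellInterp_combo (g : Plane → ℝ) (K : Fin T.numCells) {x y : Plane} {a b : ℝ}
    (hab : a + b = 1) : T.cellInterp g K (a • x + b • y)
      = a * T.cellInterp g K x + b * T.cellInterp g K y := by
  simp only [cellInterp, Finset.mul_sum, ← Finset.sum_add_distrib]
  refine Finset.sum_congr rfl fun j _ => ?_
  rw [Convex.combo_affine_apply hab]
  simp only [smul_eq_mul]
  ring

/-- Both interpolants are affine and agree at the common vertices, hence on their convex hull, which
contains the intersection of the triangles. -/
lemma cellInterp_eq (g : Plane → ℝ) {K L : Fin T.numCells} {x : Plane} (hK : x ∈ T.cell K)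
    (hL : x ∈ T.cell L) : T.cellInterp g K x = T.cellInterp g L x := by
  have hc : Convex ℝ {y | T.cellInterp g K y = T.cellInterp g L y} := by
    intro y hy z hz a b _ _ hab
    rw [Set.mem_ofPred_eq] at hy hz ⊢
    rw [cellInterp_combo _ _ _ hab, cellInterp_combo _ _ _ hab, hy, hz]
  refine convexHull_min ?_ hc (T.conforming K L ⟨hK, hL⟩)
  rintro y ⟨⟨i, hi⟩, ⟨j, hj⟩⟩
  rw [Set.mem_ofPred_eq]
  rw [← hi, cellInterp_vert, hi, ← hj, cellInterp_vert]

lemma interp_eq (g : Plane → ℝ) {K : Fin T.numCells} {x : Plane} (hK : x ∈ T.cell K) :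
    T.interp g x = T.cellInterp g K x := by
  have hx : ∃ K, x ∈ T.cell K := ⟨K, hK⟩
  rw [interp, dif_pos hx]
  exact T.cellInterp_eq g hx.choose_spec hK

lemma continuous_cellInterp (g : Plane → ℝ) (K : Fin T.numCells) :
    Continuous (T.cellInterp g K) := by
  unfold cellInterp
  exact continuous_finsetSum _ fun j _ => continuous_const.mul (T.continuous_lam K j)

lemma continuousOn_interp (g : Plane → ℝ) : ContinuousOn (T.interp g) (closure Ω) := by
  have h : ContinuousOn (T.interp g) (⋃ K, T.cell K) :=
    (locallyFinite_of_finite _).continuousOn_iUnion (fun K => T.isClosed_cell K) fun K =>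
      (T.continuous_cellInterp g K).continuousOn.congr fun x hx => T.interp_eq g hx
  have hcov : ⋃ K, T.cell K = closure Ω := T.covers
  rwa [hcov] at h

lemma exists_linear_polyFun (a : ℝ) (b : Plane) : ∃ q : MvPolynomial (Fin 2) ℝ,
    q.totalDegree ≤ 1 ∧ (∀ x, polyFun q x = a + inner ℝ b x) ∧ ∀ x, polyGrad q x = b := by
  refine ⟨MvPolynomial.C a + (MvPolynomial.C (b 0) * MvPolynomial.X 0
    + MvPolynomial.C (b 1) * MvPolynomial.X 1), ?_, fun x => ?_, fun x => ?_⟩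
  · have h : ∀ i, (MvPolynomial.C (b i) * MvPolynomial.X i :
        MvPolynomial (Fin 2) ℝ).totalDegree ≤ 1 := fun i => by
      refine (MvPolynomial.totalDegree_mul _ _).trans ?_
      simp
    refine (MvPolynomial.totalDegree_add _ _).trans (max_le (by simp) ?_)
    exact (MvPolynomial.totalDegree_add _ _).trans (max_le (h 0) (h 1))
  · simp [polyFun, plane_inner]
  · apply plane_ext <;> simp [polyGrad, polyFun, MvPolynomial.pderiv_X]

lemma exists_polyFun_interp (g : Plane → ℝ) (K : Fin T.numCells) :
    ∃ q : MvPolynomial (Fin 2) ℝ, q.totalDegree ≤ 1 ∧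
      (∀ x ∈ T.cell K, T.interp g x = polyFun q x) ∧
      ∀ x, polyGrad q x = ∑ j, g (T.vert K j) • T.glam K j := by
  obtain ⟨q, h1, h2, h3⟩ := exists_linear_polyFun (T.cellInterp g K 0)
    (∑ j, g (T.vert K j) • T.glam K j)
  refine ⟨q, h1, fun x hx => ?_, h3⟩
  rw [T.interp_eq g hx, h2, sum_inner, cellInterp, cellInterp, ← Finset.sum_add_distrib]
  refine Finset.sum_congr rfl fun j _ => ?_
  have := T.lam_sub K j x 0
  rw [sub_zero] at this
  rw [real_inner_smul_left, ← this]; ring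

lemma interp_mem_feSpace (g : Plane → ℝ) {k : ℕ} (hk : 1 ≤ k) : T.interp g ∈ T.feSpace k :=
  ⟨T.continuousOn_interp g, fun K => by
    obtain ⟨q, h1, h2, -⟩ := T.exists_polyFun_interp g K
    exact ⟨q, h1.trans hk, h2⟩⟩

lemma cellGrad_interp (g : Plane → ℝ) {K : Fin T.numCells} {x : Plane} (hx : x ∈ T.cell K) :
    T.cellGrad (T.interp g) K x = ∑ j, g (T.vert K j) • T.glam K j := by
  obtain ⟨q, -, h2, h3⟩ := T.exists_polyFun_interp g K
  rw [T.cellGrad_eq_polyGrad h2 hx, h3]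

end Triangulation

/-! ### Distances between the sides of a polygon -/

lemma exists_pos_le_of_finite {ι : Type*} [Finite ι] (f : ι → ℝ) (hf : ∀ i, 0 < f i) :
    ∃ c, 0 < c ∧ ∀ i, c ≤ f i := by
  rcases isEmpty_or_nonempty ι with h | h
  · exact ⟨1, one_pos, fun i => h.elim i⟩
  · obtain ⟨i, hi⟩ := Finite.exists_min f
    exact ⟨f i, hf i, hi⟩

/-- The distance of two segments that can only meet in a common end point `P` grows at least
linearly away from `P`. -/
lemma exists_mul_le_dist_segment {P Q A B : Plane} (hPQ : P ≠ Q) (hAB : A ≠ B)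
    (hmeet : segment ℝ P Q ∩ segment ℝ A B ⊆ ({P, Q} ∩ {A, B} : Set Plane)) :
    ∃ c, 0 < c ∧ ∀ t ∈ Set.Icc (0 : ℝ) (1 / 2), ∀ y ∈ segment ℝ A B,
      c * t ≤ dist (AffineMap.lineMap P Q t) y := by
  by_cases hP : P ∈ segment ℝ A B
  -- If `P` lies on the other segment, it is an end point of it. The distance of the points at
  -- parameters `t` and `s` is then homogeneous of degree one in `(t, s)`, and it suffices to
  -- minimize it over `t + s = 1`.
  · obtain ⟨W, hWP, hseg⟩ : ∃ W, W ≠ P ∧ segment ℝ A B = segment ℝ P W := by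
      rcases (hmeet ⟨left_mem_segment ℝ P Q, hP⟩).2 with h | h
      · exact ⟨B, by rw [h]; exact hAB.symm, by rw [h]⟩
      · have h' : P = B := h
        exact ⟨A, by rw [h']; exact hAB, by rw [h', segment_symm]⟩
    have hc : IsCompact (segment ℝ ((1 : ℝ), (0 : ℝ)) (0, 1)) := by
      rw [segment_eq_image_lineMap]
      exact isCompact_Icc.image AffineMap.lineMap_continuous
    have hcont : Continuous fun q : ℝ × ℝ => ‖q.1 • (Q - P) - q.2 • (W - P)‖ := by fun_prop
    obtain ⟨q, hq, hmin⟩ := hc.exists_isMinOn ⟨_, left_mem_segment ℝ _ _⟩ hcont.continuousOn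
    have hform : ∀ q ∈ segment ℝ ((1 : ℝ), (0 : ℝ)) (0, 1), 0 ≤ q.1 ∧ 0 ≤ q.2 ∧ q.1 + q.2 = 1 := by
      rintro _ ⟨a, b, ha, hb, hab, rfl⟩
      simpa using ⟨ha, hb, hab⟩
    obtain ⟨h1, h2, h3⟩ := hform q hq
    have hpos : 0 < ‖q.1 • (Q - P) - q.2 • (W - P)‖ := by
      rw [norm_pos_iff, sub_ne_zero]
      intro heq
      have hx1 : AffineMap.lineMap P Q q.1 ∈ segment ℝ P Q :=
        lineMap_mem_segment ℝ P Q ⟨h1, by linarith⟩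
      have hx2 : AffineMap.lineMap P W q.2 ∈ segment ℝ P W :=
        lineMap_mem_segment ℝ P W ⟨h2, by linarith⟩
      have hx3 : AffineMap.lineMap P Q q.1 = AffineMap.lineMap P W q.2 := by
        rw [AffineMap.lineMap_apply_module', AffineMap.lineMap_apply_module', heq]
      rw [← hseg, ← hx3] at hx2
      have hQP : Q - P ≠ 0 := sub_ne_zero.2 hPQ.symm
      have hWP' : W - P ≠ 0 := sub_ne_zero.2 hWP
      rcases (hmeet ⟨hx1, hx2⟩).1 with h | h
      · rw [AffineMap.lineMap_apply_module', add_eq_right] at h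
        rw [h] at heq
        have e1 := (smul_eq_zero.1 h).resolve_right hQP
        have e2 := (smul_eq_zero.1 heq.symm).resolve_right hWP'
        linarith
      · have h' : AffineMap.lineMap P Q q.1 = Q := h
        rw [AffineMap.lineMap_apply_module', ← eq_sub_iff_add_eq] at h'
        have e1 : (q.1 - 1) • (Q - P) = 0 := by rw [sub_smul, one_smul, h', sub_self]
        have e2 := (smul_eq_zero.1 e1).resolve_right hQP
        have e3 : q.2 = 0 := by linarith
        rw [e3, zero_smul, h'] at heq
        exact hQP heq
    refine ⟨_, hpos, fun t ht y hy => ?_⟩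
    rw [hseg, segment_eq_image_lineMap] at hy
    obtain ⟨s, hs, rfl⟩ := hy
    rcases eq_or_lt_of_le ht.1 with h0 | h0
    · rw [← h0, mul_zero]; exact dist_nonneg
    · have hts : 0 < t + s := by linarith [hs.1]
      have hmem : (t / (t + s), s / (t + s)) ∈ segment ℝ ((1 : ℝ), (0 : ℝ)) (0, 1) :=
        ⟨t / (t + s), s / (t + s), (div_pos h0 hts).le, div_nonneg hs.1 hts.le,
          by rw [← add_div, div_self hts.ne'], by simp⟩
      have h5 := hmin hmem
      have h6 : (t / (t + s)) • (Q - P) - (s / (t + s)) • (W - P)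
          = (t + s)⁻¹ • (t • (Q - P) - s • (W - P)) := by
        rw [smul_sub (t + s)⁻¹, smul_smul, smul_smul, div_eq_inv_mul, div_eq_inv_mul]
      have h5' : ‖q.1 • (Q - P) - q.2 • (W - P)‖
          ≤ ‖(t / (t + s)) • (Q - P) - (s / (t + s)) • (W - P)‖ := h5
      rw [h6, norm_smul, norm_inv, Real.norm_of_nonneg hts.le, ← div_eq_inv_mul,
        le_div_iff₀ hts] at h5'
      rw [AffineMap.lineMap_apply_module', AffineMap.lineMap_apply_module', dist_eq_norm,
        add_sub_add_right_eq_sub]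
      exact (mul_le_mul_of_nonneg_left (by linarith [hs.1]) hpos.le).trans h5'
  -- If `P` is not on the segment, the half of `PQ` next to `P` is a compact set disjoint from it:
  -- the only other possible meeting point `Q` is excluded by `t ≤ 1 / 2`. The distance is then
  -- bounded below, and `t ≤ 1`.
  · have hcl : IsClosed (segment ℝ A B) := by
      rw [segment_eq_image_lineMap]
      exact (isCompact_Icc.image AffineMap.lineMap_continuous).isClosed
    have hne : (segment ℝ A B).Nonempty := ⟨A, left_mem_segment ℝ A B⟩
    have hcont : Continuous fun t : ℝ =>
        Metric.infDist (AffineMap.lineMap P Q t : Plane) (segment ℝ A B) :=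
      (Metric.continuous_infDist_pt _).comp AffineMap.lineMap_continuous
    obtain ⟨t₀, ht₀, hmin⟩ := (isCompact_Icc (a := (0 : ℝ)) (b := 1 / 2)).exists_isMinOn
      ⟨0, by norm_num⟩ hcont.continuousOn
    have hpos : 0 < Metric.infDist (AffineMap.lineMap P Q t₀ : Plane) (segment ℝ A B) := by
      rw [← hcl.notMem_iff_infDist_pos hne]
      intro hmem
      have hx1 : AffineMap.lineMap P Q t₀ ∈ segment ℝ P Q :=
        lineMap_mem_segment ℝ P Q ⟨ht₀.1, by linarith [ht₀.2]⟩
      rcases (hmeet ⟨hx1, hmem⟩).1 with h | h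
      · exact hP (h ▸ hmem)
      · have h' : AffineMap.lineMap P Q t₀ = Q := h
        rw [AffineMap.lineMap_apply_module', ← eq_sub_iff_add_eq] at h'
        have e1 : (t₀ - 1) • (Q - P) = 0 := by rw [sub_smul, one_smul, h', sub_self]
        have e2 := (smul_eq_zero.1 e1).resolve_right (sub_ne_zero.2 hPQ.symm)
        linarith [ht₀.2]
    refine ⟨_, hpos, fun t ht y hy => ?_⟩
    have h1 := hmin ht
    have h2 := Metric.infDist_le_dist_of_mem (x := (AffineMap.lineMap P Q t : Plane)) hy
    calc _ ≤ Metric.infDist (AffineMap.lineMap P Q t₀ : Plane) (segment ℝ A B) * 1 :=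
          mul_le_mul_of_nonneg_left (by linarith [ht.2]) hpos.le
      _ ≤ _ := by rw [mul_one]; exact le_trans h1 h2

namespace IsPolygonalDomain

variable {Ω : Set Plane} {m : ℕ} {p : Fin m → Plane} {next : Equiv.Perm (Fin m)}

lemma corner_ne (hΩ : IsPolygonalDomain Ω p next) (i : Fin m) : p i ≠ p (next i) := fun h =>
  hΩ.next_ne i (hΩ.corner_injective h).symm

lemma side_subset_frontier (hΩ : IsPolygonalDomain Ω p next) (i : Fin m) :
    segment ℝ (p i) (p (next i)) ⊆ frontier Ω := by
  rw [hΩ.frontier_eq]; exact Set.subset_iUnion (fun i => segment ℝ (p i) (p (next i))) i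

lemma exists_mem_side (hΩ : IsPolygonalDomain Ω p next) {x : Plane} (hx : x ∈ frontier Ω) :
    ∃ i, x ∈ segment ℝ (p i) (p (next i)) := by
  rw [hΩ.frontier_eq] at hx; exact Set.mem_iUnion.1 hx

/-- A point of a side with distance `s` to the corners has distance at least `c s` to the other
sides. -/
lemma exists_mul_min_le_dist (hΩ : IsPolygonalDomain Ω p next) :
    ∃ c, 0 < c ∧ ∀ i j, i ≠ j → ∀ t ∈ Set.Icc (0 : ℝ) 1,
      ∀ y ∈ segment ℝ (p j) (p (next j)),
        c * min t (1 - t) ≤ dist (AffineMap.lineMap (p i) (p (next i)) t) y := by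
  have key : ∀ q : {q : Fin m × Fin m // q.1 ≠ q.2}, ∃ c, 0 < c ∧ ∀ t ∈ Set.Icc (0 : ℝ) 1,
      ∀ y ∈ segment ℝ (p q.1.2) (p (next q.1.2)),
        c * min t (1 - t) ≤ dist (AffineMap.lineMap (p q.1.1) (p (next q.1.1)) t) y := by
    rintro ⟨⟨i, j⟩, hij⟩
    have hm := hΩ.sides_meet i j hij
    obtain ⟨c₁, hc₁, h₁⟩ := exists_mul_le_dist_segment (hΩ.corner_ne i) (hΩ.corner_ne j) hm
    obtain ⟨c₂, hc₂, h₂⟩ := exists_mul_le_dist_segment (hΩ.corner_ne i).symm (hΩ.corner_ne j)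
      (by rw [segment_symm, Set.pair_comm]; exact hm)
    refine ⟨min c₁ c₂, lt_min hc₁ hc₂, fun t ht y hy => ?_⟩
    rcases le_total t (1 / 2) with h | h
    · rw [min_eq_left (show t ≤ 1 - t by linarith)]
      exact (mul_le_mul_of_nonneg_right (min_le_left _ _) ht.1).trans (h₁ t ⟨ht.1, h⟩ y hy)
    · rw [min_eq_right (show 1 - t ≤ t by linarith)]
      have h3 := h₂ (1 - t) ⟨by linarith [ht.2], by linarith⟩ y hy
      rw [AffineMap.lineMap_apply_one_sub] at h3
      exact (mul_le_mul_of_nonneg_right (min_le_right _ _) (by linarith [ht.2])).trans h3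
  choose c hc hcd using key
  obtain ⟨c₀, hc₀, hle⟩ := exists_pos_le_of_finite c hc
  refine ⟨c₀, hc₀, fun i j hij t ht y hy => ?_⟩
  refine le_trans ?_ (hcd ⟨(i, j), hij⟩ t ht y hy)
  exact mul_le_mul_of_nonneg_right (hle _) (le_min ht.1 (by linarith [ht.2]))

lemma isClosed_side (i : Fin m) : IsClosed (segment ℝ (p i) (p (next i))) := by
  rw [segment_eq_image_lineMap]
  exact (isCompact_Icc.image AffineMap.lineMap_continuous).isClosed

lemma eventually_not_mem_side (z : Plane) : ∀ᶠ y in nhds z, ∀ i,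
    z ∉ segment ℝ (p i) (p (next i)) → y ∉ segment ℝ (p i) (p (next i)) := by
  rw [Filter.eventually_all]
  intro i
  by_cases hi : z ∈ segment ℝ (p i) (p (next i))
  · exact Filter.Eventually.of_forall fun y h => absurd hi h
  · filter_upwards [(isClosed_side (p := p) (next := next) i).isOpen_compl.mem_nhds hi] with y hy _
      using hy

/-- A segment on the boundary starts within a single side. -/
lemma exists_side_of_segment (hΩ : IsPolygonalDomain Ω p next) {z a : Plane}
    (h : segment ℝ z a ⊆ frontier Ω) : ∃ i, z ∈ segment ℝ (p i) (p (next i)) ∧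
      ∃ t : ℝ, 0 < t ∧ t ≤ 1 ∧ AffineMap.lineMap z a t ∈ segment ℝ (p i) (p (next i)) := by
  have hcont : Filter.Tendsto (fun t : ℝ => (AffineMap.lineMap z a t : Plane))
      (nhdsWithin 0 (Set.Ioi 0)) (nhds z) := by
    have : Continuous fun t : ℝ => (AffineMap.lineMap z a t : Plane) := AffineMap.lineMap_continuous
    simpa using (this.tendsto 0).mono_left nhdsWithin_le_nhds
  have h1 : ∀ᶠ t : ℝ in nhdsWithin 0 (Set.Ioi 0), t < 1 :=
    (gt_mem_nhds one_pos).filter_mono nhdsWithin_le_nhds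
  -- The sides are closed and finitely many, so a point close enough to `z` lies only on sides that
  -- contain `z`.
  obtain ⟨t, ⟨h2, ht1⟩, ht⟩ := (((hcont.eventually (eventually_not_mem_side
    (p := p) (next := next) z)).and h1).and self_mem_nhdsWithin).exists
  obtain ⟨i, hi⟩ := hΩ.exists_mem_side (h (lineMap_mem_segment ℝ z a ⟨le_of_lt ht, ht1.le⟩))
  refine ⟨i, ?_, t, ht, ht1.le, hi⟩
  by_contra hn
  exact h2 i hn hi

end IsPolygonalDomain

lemma mem_segment_of_dist_le {z q a x : Plane} (ha : a ∈ segment ℝ z q) (hx : x ∈ segment ℝ z q)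
    (h : dist x z ≤ dist a z) : x ∈ segment ℝ z a := by
  rw [segment_eq_image_lineMap] at ha hx
  obtain ⟨θ, hθ, rfl⟩ := ha
  obtain ⟨τ, hτ, rfl⟩ := hx
  rw [dist_lineMap_left, dist_lineMap_left, Real.norm_of_nonneg hθ.1, Real.norm_of_nonneg hτ.1] at h
  rcases eq_or_ne z q with rfl | hne
  · simp
  · have hd : 0 < dist z q := dist_pos.2 hne
    have hle : τ ≤ θ := le_of_mul_le_mul_right h hd
    rcases eq_or_lt_of_le hθ.1 with h0 | h0
    · have : τ = 0 := le_antisymm (hle.trans h0.symm.le) hτ.1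
      rw [this, ← h0]; exact right_mem_segment ℝ _ _
    · rw [segment_eq_image_lineMap]
      refine ⟨τ / θ, ⟨div_nonneg hτ.1 h0.le, (div_le_one h0).2 hle⟩, ?_⟩
      simp only [AffineMap.lineMap_apply_module', add_sub_cancel_right, smul_smul]
      rw [div_mul_cancel₀ _ h0.ne']

/-! ### Triangles at the corners of the boundary. -/

namespace Triangulation

variable {Ω : Set Plane} (T : Triangulation Ω)

lemma interior_cell_subset (hreg : interior (closure Ω) = Ω) (K : Fin T.numCells) :
    interior (T.cell K) ⊆ Ω :=
  (interior_mono (T.cell_subset_closure K)).trans hreg.subset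

lemma exists_mem_interior_cell {L : Fin T.numCells} {z : Plane} (hz : z ∈ T.cell L)
    {U : Set Plane} (hU : U ∈ nhds z) : ∃ x ∈ U, x ∈ interior (T.cell L) := by
  have h : z ∈ closure (interior (T.cell L)) := by
    rw [(T.convex_cell L).closure_interior_eq_closure_of_nonempty_interior
      (T.interior_cell_nonempty L)]
    exact subset_closure hz
  exact mem_closure_iff_nhds.1 h U hU

/-- Near the common vertex `z` of two boundary faces of a triangle, the boundary consists of these
two faces. -/
lemma frontier_near_corner {m : ℕ} {p : Fin m → Plane} {next : Equiv.Perm (Fin m)}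
    (hΩ : IsPolygonalDomain Ω p next) {K : Fin T.numCells} {i j l : Fin 3} (hij : i ≠ j)
    (hil : i ≠ l) (hjl : j ≠ l)
    (h1 : segment ℝ (T.vert K l) (T.vert K j) ⊆ frontier Ω)
    (h2 : segment ℝ (T.vert K l) (T.vert K i) ⊆ frontier Ω) :
    ∀ᶠ x in nhds (T.vert K l), x ∈ frontier Ω →
      x ∈ segment ℝ (T.vert K l) (T.vert K j) ∨ x ∈ segment ℝ (T.vert K l) (T.vert K i) := by
  set z := T.vert K l with hz
  set a := T.vert K j with ha
  set b := T.vert K i with hb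
  have hza : z ≠ a := fun h => hjl (T.vert_injective K h).symm
  have hzb : z ≠ b := fun h => hil (T.vert_injective K h).symm
  obtain ⟨i₁, hz₁, t₁, ht₁, ht₁', hm₁⟩ := hΩ.exists_side_of_segment h1
  obtain ⟨i₂, hz₂, t₂, ht₂, ht₂', hm₂⟩ := hΩ.exists_side_of_segment h2
  -- If both faces started within one side, `a - z` and `b - z` would be parallel; the coordinates
  -- of `a` and `b` separate them.
  have hne : i₁ ≠ i₂ := by
    rintro rfl
    rw [segment_eq_image_lineMap] at hz₁ hm₁ hm₂
    obtain ⟨s₀, -, e₀⟩ := hz₁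
    obtain ⟨s₁, -, e₁⟩ := hm₁
    obtain ⟨s₂, -, e₂⟩ := hm₂
    rw [AffineMap.lineMap_apply_module'] at e₀ e₁ e₂
    rw [AffineMap.lineMap_apply_module'] at e₁ e₂
    set u := p (next i₁) - p i₁
    have d₁ : t₁ • (a - z) = (s₁ - s₀) • u := by
      rw [sub_smul, ← add_sub_add_right_eq_sub (s₁ • u) (s₀ • u) (p i₁), e₁, e₀]; abel
    have d₂ : t₂ • (b - z) = (s₂ - s₀) • u := by
      rw [sub_smul, ← add_sub_add_right_eq_sub (s₂ • u) (s₀ • u) (p i₁), e₂, e₀]; abel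
    have c₁ := congrArg (inner ℝ (T.glam K i)) d₁
    have c₂ := congrArg (inner ℝ (T.glam K i)) d₂
    have c₃ := congrArg (inner ℝ (T.glam K j)) d₁
    rw [inner_smul_right, inner_smul_right, ← T.lam_sub, ha, hz, T.lam_vert, T.lam_vert,
      if_neg hij, if_neg hil, sub_zero, mul_zero] at c₁
    rw [inner_smul_right, inner_smul_right, ← T.lam_sub, hb, hz, T.lam_vert, T.lam_vert,
      if_pos rfl, if_neg hil, sub_zero, mul_one] at c₂
    rw [inner_smul_right, inner_smul_right, ← T.lam_sub, ha, hz, T.lam_vert, T.lam_vert,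
      if_pos rfl, if_neg hjl, sub_zero, mul_one] at c₃
    rcases mul_eq_zero.1 c₁.symm with h | h
    · rw [h, zero_mul] at c₃; exact ht₁.ne' c₃
    · rw [h, mul_zero] at c₂; exact ht₂.ne' c₂
  have hend := hΩ.sides_meet i₁ i₂ hne ⟨hz₁, hz₂⟩
  have hinj : ∀ {n n' : Fin m}, z = p n → z = p n' → n = n' := fun h h' =>
    hΩ.corner_injective (h.symm.trans h')
  -- Two sides meet at `z`, so `z` is a corner. Corners are distinct and `next` is a permutation, so
  -- only one side starts and only one side ends there.
  have honly : ∀ n, z ∈ segment ℝ (p n) (p (next n)) → n = i₁ ∨ n = i₂ := by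
    intro n hn
    by_contra! hcon
    have hn' := (hΩ.sides_meet n i₁ hcon.1 ⟨hn, hz₁⟩).1
    have key : ∀ {n n' : Fin m}, z = p (next n) → z = p (next n') → n = n' := fun h h' =>
      next.injective (hinj h h')
    rcases hend with ⟨e₁ | e₁, e₂ | e₂⟩
    · exact hne (hinj e₁ e₂)
    · rcases hn' with e | e
      · exact hcon.1 (hinj e e₁)
      · exact hcon.2 (key e e₂)
    · rcases hn' with e | e
      · exact hcon.2 (hinj e e₂)
      · exact hcon.1 (key e e₁)
    · exact hne (key e₁ e₂)
  have side : ∀ {n : Fin m} {c : Plane} {t : ℝ}, z ∈ ({p n, p (next n)} : Set Plane) → 0 < t →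
      t ≤ 1 → z ≠ c → AffineMap.lineMap z c t ∈ segment ℝ (p n) (p (next n)) →
      ∀ᶠ x in nhds z, x ∈ segment ℝ (p n) (p (next n)) → x ∈ segment ℝ z c := by
    intro n c t hzn ht ht' hzc hmem
    obtain ⟨q, hq⟩ : ∃ q, segment ℝ (p n) (p (next n)) = segment ℝ z q := by
      rcases hzn with h | h
      · exact ⟨p (next n), by rw [h]⟩
      · have h' : z = p (next n) := h
        exact ⟨p n, by rw [h', segment_symm]⟩
    rw [hq] at hmem ⊢
    have hr : 0 < dist (AffineMap.lineMap z c t : Plane) z := by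
      rw [dist_lineMap_left, Real.norm_of_nonneg ht.le]
      exact mul_pos ht (dist_pos.2 hzc)
    filter_upwards [Metric.ball_mem_nhds z hr] with x hx hxs
    have h3 := mem_segment_of_dist_le hmem hxs (le_of_lt hx)
    exact (convex_segment z c).segment_subset (left_mem_segment ℝ z c)
      (lineMap_mem_segment ℝ z c ⟨ht.le, ht'⟩) h3
  filter_upwards [side hend.1 ht₁ ht₁' hza hm₁, side hend.2 ht₂ ht₂' hzb hm₂,
    IsPolygonalDomain.eventually_not_mem_side (p := p) (next := next) z] with x hx₁ hx₂ hx₃ hxf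
  obtain ⟨n, hn⟩ := hΩ.exists_mem_side hxf
  have hzn : z ∈ segment ℝ (p n) (p (next n)) := by
    by_contra hcon
    exact hx₃ n hcon hn
  rcases honly n hzn with rfl | rfl
  · exact Or.inl (hx₁ hn)
  · exact Or.inr (hx₂ hn)

/-- A triangle with two boundary faces is the only one at their common vertex. -/
lemma eq_of_mem_cell_corner {m : ℕ} {p : Fin m → Plane} {next : Equiv.Perm (Fin m)}
    (hΩ : IsPolygonalDomain Ω p next) {K L : Fin T.numCells} {i j l : Fin 3} (hij : i ≠ j)
    (hil : i ≠ l) (hjl : j ≠ l)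
    (h1 : segment ℝ (T.vert K l) (T.vert K j) ⊆ frontier Ω)
    (h2 : segment ℝ (T.vert K l) (T.vert K i) ⊆ frontier Ω)
    (hL : T.vert K l ∈ T.cell L) : L = K := by
  by_contra hLK
  have hcov : ∀ n : Fin 3, n = i ∨ n = j ∨ n = l := by
    clear * - hij hil hjl; revert i j l; decide
  set z := T.vert K l with hz
  set a := T.vert K j with ha
  set b := T.vert K i with hb
  have hlz : T.lam K l z = 1 := by rw [hz, lam_vert, if_pos rfl]
  have hiz : T.lam K i z = 0 := by rw [hz, lam_vert, if_neg hil]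
  have hjz : T.lam K j z = 0 := by rw [hz, lam_vert, if_neg hjl]
  have hpos : ∀ᶠ x in nhds z, 0 < T.lam K l x :=
    (T.continuous_lam K l).continuousAt.eventually (lt_mem_nhds (by rw [hlz]; exact one_pos))
  obtain ⟨r, hr, hball⟩ := Metric.eventually_nhds_iff_ball.1
    ((T.frontier_near_corner hΩ hij hil hjl h1 h2).and hpos)
  have hcomb : ∀ (n : Fin 3) (c : Plane) (t : ℝ), T.lam K n (z + t • (c - z))
      = T.lam K n z + t * (T.lam K n c - T.lam K n z) := fun n c t => by
    have e := T.lam_sub K n (z + t • (c - z)) z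
    rw [add_sub_cancel_left, inner_smul_right, ← T.lam_sub] at e
    linarith
  -- `O` is the part of a small disc around `z` outside the triangle. It is the union of two convex
  -- pieces with a common point and misses the boundary; if another triangle touched `z`, `O` would
  -- meet `Ω` and hence lie in it.
  set O : Set Plane := (Metric.ball z r ∩ {x | T.lam K i x < 0}) ∪
    (Metric.ball z r ∩ {x | T.lam K j x < 0}) with hO
  have hconv : ∀ n, Convex ℝ (Metric.ball z r ∩ {x | T.lam K n x < 0}) := fun n =>
    (convex_ball z r).inter ((convex_Iio (0 : ℝ)).affine_preimage (T.lam K n))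
  have hOpre : IsPreconnected O := by
    obtain ⟨t, ht, htr⟩ : ∃ t : ℝ, 0 < t ∧ z - t • ((a - z) + (b - z)) ∈ Metric.ball z r := by
      have hcont : Filter.Tendsto (fun t : ℝ => z - t • ((a - z) + (b - z)))
          (nhdsWithin 0 (Set.Ioi 0)) (nhds z) := by
        have : Continuous fun t : ℝ => z - t • ((a - z) + (b - z)) := by fun_prop
        simpa using (this.tendsto 0).mono_left nhdsWithin_le_nhds
      obtain ⟨t, h, ht⟩ := ((hcont.eventually (Metric.ball_mem_nhds z hr)).and
        self_mem_nhdsWithin).exists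
      exact ⟨t, ht, h⟩
    have hval : ∀ n, T.lam K n (z - t • ((a - z) + (b - z))) = T.lam K n z
        - t * ((T.lam K n a - T.lam K n z) + (T.lam K n b - T.lam K n z)) := fun n => by
      have e := T.lam_sub K n (z - t • ((a - z) + (b - z))) z
      rw [sub_sub_cancel_left, inner_neg_right, inner_smul_right, inner_add_right, ← T.lam_sub,
        ← T.lam_sub] at e
      linarith
    refine IsPreconnected.union (z - t • ((a - z) + (b - z))) ⟨htr, ?_⟩ ⟨htr, ?_⟩
      (hconv i).isPreconnected (hconv j).isPreconnected
    · rw [Set.mem_ofPred_eq, hval, hiz, ha, hb, lam_vert, lam_vert, if_neg hij, if_pos rfl]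
      linarith
    · rw [Set.mem_ofPred_eq, hval, hjz, ha, hb, lam_vert, lam_vert, if_neg hij.symm, if_pos rfl]
      linarith
  have hseg : ∀ n n' : Fin 3, n ≠ l → ∀ x ∈ segment ℝ z (T.vert K n), 0 ≤ T.lam K n' x ∧
      (n' ≠ n → n' ≠ l → T.lam K n' x = 0) := by
    intro n n' _ x hx
    refine ⟨T.mem_cell.1 ((T.convex_cell K).segment_subset (T.vert_mem_cell K l)
      (T.vert_mem_cell K n) hx) n', fun h h' => ?_⟩
    rw [segment_eq_image_lineMap] at hx
    obtain ⟨t, -, rfl⟩ := hx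
    rw [AffineMap.lineMap_apply_module', add_comm, hcomb, hz, lam_vert, lam_vert, if_neg h,
      if_neg h']
    ring
  have hOf : ∀ x ∈ O, x ∉ frontier Ω := by
    intro x hx hxf
    have hxb : x ∈ Metric.ball z r := by
      rcases hx with h | h <;> exact h.1
    have hnn : 0 ≤ T.lam K i x ∧ 0 ≤ T.lam K j x := by
      rcases (hball x hxb).1 hxf with h | h
      · exact ⟨(hseg j i hjl x h).1, (hseg j j hjl x h).1⟩
      · exact ⟨(hseg i i hil x h).1, (hseg i j hil x h).1⟩
    rcases hx with h | h
    · exact absurd h.2 (not_lt.2 hnn.1)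
    · exact absurd h.2 (not_lt.2 hnn.2)
  obtain ⟨x, hxb, hxL⟩ := T.exists_mem_interior_cell hL (Metric.ball_mem_nhds z hr)
  have hxΩ : x ∈ Ω := T.interior_cell_subset hΩ.regular L hxL
  have hxO : x ∈ O := by
    have hxK : x ∉ T.cell K := fun h => hLK (T.eq_of_mem_interior_cell hxL h)
    rw [T.mem_cell] at hxK
    push Not at hxK
    obtain ⟨n, hn⟩ := hxK
    rcases hcov n with rfl | rfl | rfl
    · exact Or.inl ⟨hxb, hn⟩
    · exact Or.inr ⟨hxb, hn⟩
    · exact absurd (hball x hxb).2 (not_lt.2 hn.le)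
  have hOΩ : O ⊆ Ω := by
    refine hOpre.subset_left_of_subset_union hΩ.isOpen isClosed_closure.isOpen_compl
      (Set.disjoint_left.2 fun y hy hy' => hy' (subset_closure hy)) (fun y hy => ?_) ⟨x, hxO, hxΩ⟩
    by_contra hcon
    rw [Set.mem_union, not_or, Set.notMem_compl_iff] at hcon
    exact hOf y hy (by rw [hΩ.isOpen.frontier_eq]; exact ⟨hcon.2, hcon.1⟩)
  -- an inner point of the first face
  obtain ⟨t, ht, ht1, htr⟩ : ∃ t : ℝ, 0 < t ∧ t < 1 ∧ z + t • (a - z) ∈ Metric.ball z r := by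
    have hcont : Filter.Tendsto (fun t : ℝ => z + t • (a - z))
        (nhdsWithin 0 (Set.Ioi 0)) (nhds z) := by
      have : Continuous fun t : ℝ => z + t • (a - z) := by fun_prop
      simpa using (this.tendsto 0).mono_left nhdsWithin_le_nhds
    have h3 : ∀ᶠ t : ℝ in nhdsWithin 0 (Set.Ioi 0), t < 1 :=
      (gt_mem_nhds one_pos).filter_mono nhdsWithin_le_nhds
    obtain ⟨t, ⟨h, h1⟩, ht⟩ := (((hcont.eventually (Metric.ball_mem_nhds z hr)).and h3).and
      self_mem_nhdsWithin).exists
    exact ⟨t, ht, h1, h⟩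
  set y := z + t • (a - z) with hy
  have hyf : y ∈ frontier Ω := h1 (by
    rw [segment_eq_image_lineMap]
    exact ⟨t, ⟨ht.le, ht1.le⟩, by rw [AffineMap.lineMap_apply_module', add_comm]⟩)
  have hyj : 0 < T.lam K j y := by
    rw [hy, hcomb, hjz, ha, lam_vert, if_pos rfl]; linarith
  -- Around an inner point of the first face, `O` and the triangle together cover a full
  -- neighbourhood, which contradicts that the face is on the boundary.
  have hyint : y ∈ interior (closure Ω) := by
    rw [mem_interior_iff_mem_nhds]
    filter_upwards [Metric.isOpen_ball.mem_nhds htr,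
      (T.continuous_lam K j).continuousAt.eventually (lt_mem_nhds hyj)] with w hw hwj
    rcases lt_or_ge (T.lam K i w) 0 with h | h
    · exact subset_closure (hOΩ (Or.inl ⟨hw, h⟩))
    · refine T.cell_subset_closure K (T.mem_cell.2 fun n => ?_)
      rcases hcov n with rfl | rfl | rfl
      · exact h
      · exact hwj.le
      · exact (hball w hw).2.le
  rw [hΩ.regular] at hyint
  rw [hΩ.isOpen.frontier_eq] at hyf
  exact hyf.2 hyint

/-- If all three faces of a triangle lie on the boundary, there is no other triangle. -/
lemma eq_of_faces_subset_frontier {m : ℕ} {p : Fin m → Plane} {next : Equiv.Perm (Fin m)}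
    (hΩ : IsPolygonalDomain Ω p next) {K : Fin T.numCells}
    (h : ∀ j, (K, j) ∈ T.boundaryFaces) (L : Fin T.numCells) : L = K := by
  -- `Ω` misses the boundary of the triangle, so by connectedness it lies inside the triangle.
  have h1 : Ω ⊆ interior (T.cell K) ∪ (T.cell K)ᶜ := by
    intro x hx
    by_cases hxK : x ∈ T.cell K
    · left
      refine T.mem_interior_cell.2 fun j => lt_of_le_of_ne (T.mem_cell.1 hxK j) fun h0 => ?_
      have := T.mem_boundaryFaces.1 (h j) (T.mem_face.2 ⟨hxK, h0.symm⟩)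
      rw [hΩ.isOpen.frontier_eq] at this
      exact this.2 hx
    · exact Or.inr hxK
  obtain ⟨c, hc⟩ := T.interior_cell_nonempty K
  have h2 : Ω ⊆ interior (T.cell K) :=
    hΩ.isConnected.isPreconnected.subset_left_of_subset_union isOpen_interior
      (T.isClosed_cell K).isOpen_compl
      (Set.disjoint_left.2 fun y hy hy' => hy' (interior_subset hy)) h1
      ⟨c, T.interior_cell_subset hΩ.regular K hc, hc⟩
  obtain ⟨d, hd⟩ := T.interior_cell_nonempty L
  exact T.eq_of_mem_interior_cell hd
    (interior_subset (h2 (T.interior_cell_subset hΩ.regular L hd)))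

/-! ### Nodes that control the boundary values -/

/-- Nodal values of a function, cut off outside a finite set `G` of nodes and multiplied by `s`. -/
def nodal (G : Finset Plane) (s : ℝ) (φ : Plane → ℝ) : Plane → ℝ :=
  (G : Set Plane).indicator fun z => s * φ z

/-- A set of nodes at which the normal flux of piecewise linear functions is definite with sign `s`
and that can be reached from every boundary face within distance `R h`. -/
structure GoodNodes (M R : ℝ) (G : Finset Plane) (s : ℝ) : Prop where
  abs_sign : |s| = 1
  flux : ∀ φ : Plane → ℝ, 1 / M * ∑ z ∈ G, φ z ^ 2 ≤
    ∑ F ∈ T.boundaryFaces, ∑ j, nodal G s φ (T.vert F.1 j) * φ (T.vert F.1 j) *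
      (dist (T.faceA F) (T.faceB F) * inner ℝ (T.glam F.1 j) (T.normal F))
  near : ∀ F ∈ T.boundaryFaces, ∃ z ∈ G, ∃ S : Set Plane, IsPreconnected S ∧ S ⊆ closure Ω ∧
    S ⊆ Metric.closedBall (T.faceA F) (R * T.h) ∧ T.faceA F ∈ S ∧ z ∈ S

open Classical in
/-- The vertices off the boundary that are opposite to a boundary face. -/
def innerApexes : Finset Plane :=
  (T.boundaryFaces.filter fun F => T.apex F ∉ frontier Ω).image T.apex

lemma mem_innerApexes {z : Plane} :
    z ∈ T.innerApexes ↔ ∃ F ∈ T.boundaryFaces, T.apex F ∉ frontier Ω ∧ T.apex F = z := by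
  classical
  simp [innerApexes, and_assoc]

lemma faceA_mem_face (F : Fin T.numCells × Fin 3) : T.faceA F ∈ T.face F := left_mem_segment ℝ _ _

lemma faceB_mem_face (F : Fin T.numCells × Fin 3) : T.faceB F ∈ T.face F := right_mem_segment ℝ _ _

lemma inner_glam_normal_self (F : Fin T.numCells × Fin 3) :
    inner ℝ (T.glam F.1 F.2) (T.normal F) = -‖T.glam F.1 F.2‖ := by
  have hg : ‖T.glam F.1 F.2‖ ≠ 0 := norm_ne_zero_iff.2 (T.glam_ne_zero _ _)
  rw [normal_eq, inner_neg_right, inner_smul_right, real_inner_self_eq_norm_sq]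
  field_simp

lemma Regular.one_div_le_dist_mul {T : Triangulation Ω} {M : ℝ} (hT : T.Regular M)
    (F : Fin T.numCells × Fin 3) :
    1 / M ≤ dist (T.faceA F) (T.faceB F) * ‖T.glam F.1 F.2‖ := by
  have hM := hT.M_pos
  have hh := hT.h_pos
  calc 1 / M = T.h / M * (1 / T.h) := by field_simp
    _ ≤ _ := mul_le_mul (hT.le_dist_face F) (hT.one_le_norm_glam F.1 F.2) (by positivity)
        dist_nonneg

/-- All boundary nodes carry the value zero, so on a boundary face only the apex contributes. There
the normal derivative of its coordinate is `-‖∇λ‖`, and the sign `-1` makes the term nonnegative.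
Several faces may share an apex; one of them is enough for the lower bound. -/
lemma flux_innerApexes {M : ℝ} (hT : T.Regular M) (φ : Plane → ℝ) :
    1 / M * ∑ z ∈ T.innerApexes, φ z ^ 2 ≤
      ∑ F ∈ T.boundaryFaces, ∑ j, nodal T.innerApexes (-1) φ (T.vert F.1 j) * φ (T.vert F.1 j) *
        (dist (T.faceA F) (T.faceB F) * inner ℝ (T.glam F.1 j) (T.normal F)) := by
  classical
  have hM := hT.M_pos
  set D := T.boundaryFaces.filter fun F => T.apex F ∉ frontier Ω with hD
  have h1 : ∑ z ∈ T.innerApexes, φ z ^ 2 ≤ ∑ F ∈ D, φ (T.apex F) ^ 2 := by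
    have : T.innerApexes = D.image T.apex := by
      ext z
      simp [mem_innerApexes, hD, and_assoc]
    rw [this, ← Finset.sum_fiberwise_of_maps_to
      (fun F hF => Finset.mem_image_of_mem T.apex hF) (fun F => φ (T.apex F) ^ 2)]
    refine Finset.sum_le_sum fun z hz => ?_
    obtain ⟨F, hF, rfl⟩ := Finset.mem_image.1 hz
    exact Finset.single_le_sum (f := fun F => φ (T.apex F) ^ 2) (fun _ _ => sq_nonneg _)
      (Finset.mem_filter.2 ⟨hF, rfl⟩)
  have hnot : ∀ x ∈ frontier Ω, nodal T.innerApexes (-1) φ x = 0 := by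
    intro x hx
    refine Set.indicator_of_notMem (fun h => ?_) _
    obtain ⟨F, -, h2, h3⟩ := T.mem_innerApexes.1 (Finset.mem_coe.1 h)
    exact h2 (h3 ▸ hx)
  have hterm : ∀ F ∈ T.boundaryFaces,
      ∑ j, nodal T.innerApexes (-1) φ (T.vert F.1 j) * φ (T.vert F.1 j) *
        (dist (T.faceA F) (T.faceB F) * inner ℝ (T.glam F.1 j) (T.normal F))
      = -(nodal T.innerApexes (-1) φ (T.apex F) * φ (T.apex F) *
        (dist (T.faceA F) (T.faceB F) * ‖T.glam F.1 F.2‖)) := by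
    intro F hF
    have hf := T.mem_boundaryFaces.1 hF
    rw [sum_fin_three_shift _ F.2]
    have hA := hnot _ (hf (T.faceA_mem_face F))
    have hB := hnot _ (hf (T.faceB_mem_face F))
    rw [faceA] at hA
    rw [faceB] at hB
    rw [hA, hB, inner_glam_normal_self, apex]
    ring
  rw [Finset.sum_congr rfl hterm]
  have h2 : ∑ F ∈ D, 1 / M * φ (T.apex F) ^ 2 ≤ ∑ F ∈ T.boundaryFaces,
      -(nodal T.innerApexes (-1) φ (T.apex F) * φ (T.apex F) *
        (dist (T.faceA F) (T.faceB F) * ‖T.glam F.1 F.2‖)) := by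
    rw [hD, Finset.sum_filter]
    refine Finset.sum_le_sum fun F hF => ?_
    by_cases ha : T.apex F ∈ frontier Ω
    · rw [if_neg (not_not.2 ha), hnot _ ha]; simp
    · rw [if_pos ha]
      have hmem : T.apex F ∈ (T.innerApexes : Set Plane) :=
        Finset.mem_coe.2 (T.mem_innerApexes.2 ⟨F, hF, ha, rfl⟩)
      rw [nodal, Set.indicator_of_mem hmem]
      have := mul_le_mul_of_nonneg_right (hT.one_div_le_dist_mul F) (sq_nonneg (φ (T.apex F)))
      linarith
  rw [← Finset.mul_sum] at h2
  exact (mul_le_mul_of_nonneg_left h1 (by positivity)).trans h2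

/-- Let `l` be the vertex between the two boundary faces. It belongs to no other triangle, and its
opposite face is interior, since otherwise the triangle would be the whole mesh. Only the two faces
contribute, and as the gradients of the coordinates sum to zero, the total is twice the area times
`‖∇λ_l‖²`. -/
lemma exists_goodNodes_of_corner {m : ℕ} {p : Fin m → Plane} {next : Equiv.Perm (Fin m)}
    (hΩ : IsPolygonalDomain Ω p next) {M : ℝ} (hT : T.Regular M) (hnum : 1 < T.numCells)
    {K : Fin T.numCells} {i j : Fin 3} (hij : i ≠ j) (hi : (K, i) ∈ T.boundaryFaces)
    (hj : (K, j) ∈ T.boundaryFaces) : ∃ l, ∀ φ : Plane → ℝ,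
      1 / M * ∑ z ∈ {T.vert K l}, φ z ^ 2 ≤ ∑ F ∈ T.boundaryFaces,
        ∑ j, nodal {T.vert K l} 1 φ (T.vert F.1 j) * φ (T.vert F.1 j) *
        (dist (T.faceA F) (T.faceB F) * inner ℝ (T.glam F.1 j) (T.normal F)) := by
  classical
  have hM := hT.M_pos
  obtain ⟨l, hil, hjl, hcov⟩ : ∃ l, i ≠ l ∧ j ≠ l ∧ ∀ n, n = i ∨ n = j ∨ n = l := by
    clear * - hij; revert i j; decide
  have hface : ∀ n n' : Fin 3, n ≠ l → n' ≠ l → n ≠ n' → (K, n) ∈ T.boundaryFaces →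
      segment ℝ (T.vert K l) (T.vert K n') ⊆ frontier Ω := by
    intro n n' h1 h2 h3 hb
    have hb' := T.mem_boundaryFaces.1 hb
    have : (l = n + 1 ∧ n' = n + 2) ∨ (l = n + 2 ∧ n' = n + 1) := by
      clear * - h1 h2 h3; revert n n' l; decide
    rw [face, faceA, faceB] at hb'
    rcases this with ⟨e, e'⟩ | ⟨e, e'⟩
    · rw [e, e']; exact hb'
    · rw [e, e', segment_symm]; exact hb'
  have huniq : ∀ L n, T.vert L n = T.vert K l → L = K ∧ n = l := by
    intro L n h
    have hLK : L = K := T.eq_of_mem_cell_corner hΩ hij hil hjl (hface i j hil hjl hij hi)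
      (hface j i hjl hil hij.symm hj) (h ▸ T.vert_mem_cell L n)
    subst hLK
    exact ⟨rfl, T.vert_injective L h⟩
  have hl : (K, l) ∉ T.boundaryFaces := by
    intro hl
    have hall : ∀ n, (K, n) ∈ T.boundaryFaces := by
      intro n
      rcases hcov n with rfl | rfl | rfl <;> assumption
    have := T.eq_of_faces_subset_frontier hΩ hall
    have h0 := this ⟨0, by omega⟩
    have h1 := this ⟨1, hnum⟩
    have := h0.trans h1.symm
    simp at this
  refine ⟨l, fun φ => ?_⟩
  set E : Fin T.numCells × Fin 3 → ℝ := fun F =>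
    ∑ j, nodal {T.vert K l} 1 φ (T.vert F.1 j) * φ (T.vert F.1 j) *
        (dist (T.faceA F) (T.faceB F) * inner ℝ (T.glam F.1 j) (T.normal F)) with hE
  have hE0 : ∀ F, F.1 ≠ K → E F = 0 := by
    intro F hF
    refine Finset.sum_eq_zero fun n _ => ?_
    rw [nodal, Set.indicator_of_notMem]
    · ring
    · intro h
      simp only [Finset.coe_singleton, Set.mem_singleton_iff] at h
      exact hF (huniq _ _ h).1
  have hEK : ∀ n, E (K, n) = -(φ (T.vert K l) ^ 2 *
      (T.dArea K * inner ℝ (T.glam K l) (T.glam K n))) := by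
    intro n
    simp only [hE]
    rw [Finset.sum_eq_single l]
    · rw [nodal, Set.indicator_of_mem (by simp), ← real_inner_smul_right, dist_smul_normal,
        inner_neg_right, real_inner_smul_right]
      ring
    · intro n' _ hn'
      rw [nodal, Set.indicator_of_notMem]
      · ring
      · intro h
        simp only [Finset.coe_singleton, Set.mem_singleton_iff] at h
        exact hn' (huniq _ _ h).2
    · simp
  have hsum : ∑ F ∈ T.boundaryFaces, E F = E (K, i) + E (K, j) := by
    have hsub : ({(K, i), (K, j)} : Finset (Fin T.numCells × Fin 3)) ⊆ T.boundaryFaces := by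
      intro F hF
      simp only [Finset.mem_insert, Finset.mem_singleton] at hF
      rcases hF with rfl | rfl <;> assumption
    rw [← Finset.sum_subset hsub, Finset.sum_pair]
    · intro h
      exact hij (Prod.ext_iff.1 h).2
    · rintro ⟨L, n⟩ hF hn
      refine hE0 _ fun h => ?_
      simp only at h
      subst h
      rcases hcov n with rfl | rfl | rfl
      · exact hn (by simp)
      · exact hn (by simp)
      · exact hl hF
  rw [hsum, hEK, hEK, Finset.sum_singleton]
  have hg : T.glam K i + T.glam K j = -T.glam K l := by
    have h := T.sum_glam K
    have h2 : ∑ n, T.glam K n = T.glam K i + T.glam K j + T.glam K l := by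
      have : (Finset.univ : Finset (Fin 3)) = {i, j, l} := by
        ext n; simpa using hcov n
      rw [this, Finset.sum_insert (by simp [hij, hil]), Finset.sum_pair hjl]
      abel
    rw [h2] at h
    exact eq_neg_of_add_eq_zero_left h
  have h3 : -(φ (T.vert K l) ^ 2 * (T.dArea K * inner ℝ (T.glam K l) (T.glam K i)))
      + -(φ (T.vert K l) ^ 2 * (T.dArea K * inner ℝ (T.glam K l) (T.glam K j)))
      = (T.dArea K * ‖T.glam K l‖ * ‖T.glam K l‖) * φ (T.vert K l) ^ 2 := by
    have h4 : inner ℝ (T.glam K l) (T.glam K i) + inner ℝ (T.glam K l) (T.glam K j)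
        = -(‖T.glam K l‖ ^ 2) := by
      rw [← inner_add_right, hg, inner_neg_right, real_inner_self_eq_norm_sq]
    linear_combination (-φ (T.vert K l) ^ 2 * T.dArea K) * h4
  rw [h3]
  have h5 := hT.one_div_le_dist_mul (K, l)
  rw [dist_face] at h5
  exact mul_le_mul_of_nonneg_right h5 (sq_nonneg _)

/-- Every boundary point is close to a boundary face whose apex is off the boundary, if the mesh is
fine compared with the sides. -/
lemma exists_innerApex_near {m : ℕ} {p : Fin m → Plane} {next : Equiv.Perm (Fin m)}
    (hΩ : IsPolygonalDomain Ω p next) {M : ℝ} (hT : T.Regular M) {c : ℝ} (hc : 0 < c)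
    (hdist : ∀ i j, i ≠ j → ∀ t ∈ Set.Icc (0 : ℝ) 1, ∀ y ∈ segment ℝ (p j) (p (next j)),
        c * min t (1 - t) ≤ dist (AffineMap.lineMap (p i) (p (next i)) t) y)
    (hh : T.h / c < 1 / 6) {y : Plane} (hy : y ∈ frontier Ω) :
    ∃ z ∈ T.innerApexes, ∃ S : Set Plane, IsPreconnected S ∧ S ⊆ closure Ω ∧
      S ⊆ Metric.closedBall y ((2 * Metric.diam (closure Ω) / c + 1) * T.h) ∧ y ∈ S ∧ z ∈ S := by
  set τ := T.h / c with hτ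
  have hτ0 : 0 < τ := div_pos hT.h_pos hc
  have hcτ : c * τ = T.h := by rw [hτ]; field_simp
  obtain ⟨i, hi⟩ := hΩ.exists_mem_side hy
  have hi' := hi
  rw [segment_eq_image_lineMap] at hi'
  obtain ⟨s, hs, hsy⟩ := hi'
  have hinj : Function.Injective fun t : ℝ => (AffineMap.lineMap (p i) (p (next i)) t : Plane) :=
    AffineMap.lineMap_injective ℝ (hΩ.corner_ne i)
  have hfin : {t : ℝ | (AffineMap.lineMap (p i) (p (next i)) t : Plane) ∈
      Set.range fun q : Fin T.numCells × Fin 3 => T.vert q.1 q.2}.Finite :=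
    (Set.finite_range _).preimage hinj.injOn
  -- Shift the point along its side by between `τ` and `2 τ`, towards the farther corner. Since `τ <
  -- 1 / 6`, it ends up at parameter distance more than `τ` from both corners, and finitely many
  -- mesh vertices can be avoided.
  obtain ⟨t, htd, htτ, htτ', htv⟩ : ∃ t : ℝ, |t - s| ≤ 2 * τ ∧ τ < t ∧ τ < 1 - t ∧
      ∀ K j, (AffineMap.lineMap (p i) (p (next i)) t : Plane) ≠ T.vert K j := by
    rcases le_total s (1 / 2) with h | h
    · obtain ⟨t, ht, hn⟩ := ((Set.Ioo_infinite (show s + τ < s + 2 * τ by linarith)).sdiff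
        hfin).nonempty
      refine ⟨t, ?_, by linarith [ht.1, hs.1], by linarith [ht.2], fun K j he =>
        hn ⟨(K, j), he.symm⟩⟩
      rw [abs_le]; constructor <;> linarith [ht.1, ht.2]
    · obtain ⟨t, ht, hn⟩ := ((Set.Ioo_infinite (show s - 2 * τ < s - τ by linarith)).sdiff
        hfin).nonempty
      refine ⟨t, ?_, by linarith [ht.1], by linarith [ht.2, hs.2], fun K j he =>
        hn ⟨(K, j), he.symm⟩⟩
      rw [abs_le]; constructor <;> linarith [ht.1, ht.2]
  have ht01 : t ∈ Set.Icc (0 : ℝ) 1 := ⟨by linarith, by linarith⟩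
  set x : Plane := AffineMap.lineMap (p i) (p (next i)) t with hx
  have hxside : x ∈ segment ℝ (p i) (p (next i)) := lineMap_mem_segment ℝ _ _ ht01
  have hxf : x ∈ frontier Ω := hΩ.side_subset_frontier i hxside
  have hfar : ∀ j, j ≠ i → ∀ w ∈ segment ℝ (p j) (p (next j)), T.h < dist x w := by
    intro j hj w hw
    refine lt_of_lt_of_le ?_ (hdist i j hj.symm t ht01 w hw)
    rw [← hcτ]
    exact mul_lt_mul_of_pos_left (lt_min htτ htτ') hc
  obtain ⟨F, hF, hxF⟩ := T.exists_boundaryFace hΩ.isOpen hΩ.regular hxf htv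
  have hxface : x ∈ T.face F := openSegment_subset_segment ℝ _ _ hxF
  have hxcell := T.face_subset_cell F hxface
  have hside : ∀ w ∈ T.cell F.1, w ∈ frontier Ω → w ∈ segment ℝ (p i) (p (next i)) := by
    intro w hw hwf
    obtain ⟨j, hj⟩ := hΩ.exists_mem_side hwf
    by_cases hji : j = i
    · exact hji ▸ hj
    · exact absurd (T.dist_le_h hxcell hw) (not_le.2 (hfar j hji w hj))
  -- All other sides are farther than `h` from `x`, so the triangle meets the boundary only along
  -- side `i`. An apex on the boundary would make the three vertices collinear.
  have hapex : T.apex F ∉ frontier Ω := by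
    intro hcon
    have hFf := T.mem_boundaryFaces.1 hF
    have e0 := hside _ (T.apex_mem_cell F) hcon
    have e1 := hside _ (T.faceA_mem_cell F) (hFf (T.faceA_mem_face F))
    have e2 := hside _ (T.faceB_mem_cell F) (hFf (T.faceB_mem_face F))
    rw [segment_eq_image_lineMap] at e0 e1 e2
    obtain ⟨s₀, -, e₀⟩ := e0
    obtain ⟨s₁, -, e₁⟩ := e1
    obtain ⟨s₂, -, e₂⟩ := e2
    have d₁ : T.faceB F - T.faceA F = (s₂ - s₁) • (p (next i) - p i) := by
      rw [← e₁, ← e₂, AffineMap.lineMap_apply_module', AffineMap.lineMap_apply_module', sub_smul]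
      abel
    have d₂ : T.apex F - T.faceA F = (s₀ - s₁) • (p (next i) - p i) := by
      rw [← e₁, ← e₀, AffineMap.lineMap_apply_module', AffineMap.lineMap_apply_module', sub_smul]
      abel
    have c₁ := T.glam_inner_face F
    have c₂ := T.glam_inner_apex F
    rw [d₁, inner_smul_right] at c₁
    rw [d₂, inner_smul_right] at c₂
    rcases mul_eq_zero.1 c₁ with h | h
    · rw [h, zero_smul] at d₁
      exact T.faceA_ne_faceB F (sub_eq_zero.1 d₁).symm
    · rw [h, mul_zero] at c₂
      exact zero_ne_one c₂
  have hbd : Bornology.IsBounded (closure Ω) := hΩ.isBounded.closure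
  have hdiam : 0 ≤ Metric.diam (closure Ω) := Metric.diam_nonneg
  have hxy : dist x y ≤ 2 * Metric.diam (closure Ω) / c * T.h := by
    have h1 : dist x y = |t - s| * dist (p i) (p (next i)) := by
      rw [hx, ← hsy, dist_lineMap_lineMap, Real.dist_eq]
    have h2 : dist (p i) (p (next i)) ≤ Metric.diam (closure Ω) :=
      Metric.dist_le_diam_of_mem hbd
        (frontier_subset_closure (hΩ.side_subset_frontier i (left_mem_segment ℝ _ _)))
        (frontier_subset_closure (hΩ.side_subset_frontier i (right_mem_segment ℝ _ _)))
    rw [h1]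
    calc |t - s| * dist (p i) (p (next i)) ≤ 2 * τ * Metric.diam (closure Ω) :=
          mul_le_mul htd h2 dist_nonneg (by positivity)
      _ = _ := by rw [hτ]; field_simp
  have hh0 := hT.h_pos
  have hball : ∀ w, dist w x ≤ T.h →
      w ∈ Metric.closedBall y ((2 * Metric.diam (closure Ω) / c + 1) * T.h) := by
    intro w hw
    rw [Metric.mem_closedBall]
    calc dist w y ≤ dist w x + dist x y := dist_triangle _ _ _
      _ ≤ T.h + 2 * Metric.diam (closure Ω) / c * T.h := add_le_add hw hxy
      _ = _ := by ring
  refine ⟨T.apex F, T.mem_innerApexes.2 ⟨F, hF, hapex, rfl⟩,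
    segment ℝ y x ∪ segment ℝ x (T.apex F), ?_, ?_, ?_, Or.inl (left_mem_segment ℝ _ _),
    Or.inr (right_mem_segment ℝ _ _)⟩
  · exact IsPreconnected.union x (right_mem_segment ℝ _ _) (left_mem_segment ℝ _ _)
      (convex_segment _ _).isPreconnected (convex_segment _ _).isPreconnected
  · refine Set.union_subset ?_ ?_
    · exact ((convex_segment _ _).segment_subset hi hxside).trans
        ((hΩ.side_subset_frontier i).trans frontier_subset_closure)
    · exact ((T.convex_cell F.1).segment_subset hxcell (T.apex_mem_cell F)).trans
        (T.cell_subset_closure F.1)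
  · have hxb := hball x (by rw [dist_self]; exact hh0.le)
    refine Set.union_subset ?_ ?_
    · exact (convex_closedBall _ _).segment_subset (Metric.mem_closedBall_self (by positivity)) hxb
    · exact (convex_closedBall _ _).segment_subset hxb
        (hball _ (T.dist_le_h (T.apex_mem_cell F) hxcell))

/-- Good nodes exist, with a radius that only depends on the domain. -/
lemma exists_goodNodes {m : ℕ} {p : Fin m → Plane} {next : Equiv.Perm (Fin m)}
    (hΩ : IsPolygonalDomain Ω p next) : ∃ R, 0 < R ∧ ∀ (T : Triangulation Ω) (M : ℝ), T.Regular M →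
      1 < T.numCells → T.ResolvesBoundary → ∃ G s, T.GoodNodes M R G s := by
  obtain ⟨c, hc, hdist⟩ := hΩ.exists_mul_min_le_dist
  have hbd : Bornology.IsBounded (closure Ω) := hΩ.isBounded.closure
  have hdiam : 0 ≤ Metric.diam (closure Ω) := Metric.diam_nonneg
  -- If `h ≥ c / 6`, then `6 diam / c * h` is at least the diameter, and a ball of radius `R h`
  -- about any point of the closure covers the domain. In the fine case the smaller constant `2 diam
  -- / c + 1` is enough.
  refine ⟨6 * Metric.diam (closure Ω) / c + 1, by positivity, fun T M hT hnum hres => ?_⟩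
  have hh0 := hT.h_pos
  by_cases hh : T.h / c < 1 / 6
  · refine ⟨T.innerApexes, -1, by simp, T.flux_innerApexes hT, fun F hF => ?_⟩
    obtain ⟨z, hz, S, h1, h2, h3, h4, h5⟩ := T.exists_innerApex_near hΩ hT hc hdist hh
      (T.mem_boundaryFaces.1 hF (T.faceA_mem_face F))
    refine ⟨z, hz, S, h1, h2, h3.trans (Metric.closedBall_subset_closedBall ?_), h4, h5⟩
    gcongr
    norm_num
  · have hcoarse : ∀ z ∈ closure Ω, ∀ F ∈ T.boundaryFaces, ∃ S : Set Plane, IsPreconnected S ∧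
        S ⊆ closure Ω ∧
        S ⊆ Metric.closedBall (T.faceA F) ((6 * Metric.diam (closure Ω) / c + 1) * T.h) ∧
        T.faceA F ∈ S ∧ z ∈ S := by
      intro z hz F _
      have hA : T.faceA F ∈ closure Ω := T.cell_subset_closure F.1 (T.faceA_mem_cell F)
      refine ⟨closure Ω, hΩ.isConnected.isPreconnected.closure, subset_rfl, fun w hw => ?_, hA, hz⟩
      rw [Metric.mem_closedBall]
      refine (Metric.dist_le_diam_of_mem hbd hw hA).trans ?_
      rw [not_lt, le_div_iff₀ hc] at hh
      have h1 : Metric.diam (closure Ω) * c ≤ Metric.diam (closure Ω) * (6 * T.h) :=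
        mul_le_mul_of_nonneg_left (by linarith) hdiam
      calc Metric.diam (closure Ω) ≤ Metric.diam (closure Ω) * (6 * T.h) / c := by
            rwa [le_div_iff₀ hc]
        _ = 6 * Metric.diam (closure Ω) / c * T.h := by ring
        _ ≤ _ := by nlinarith
    rcases hres with ⟨F, hF, hFa⟩ | ⟨F, hF, F', hF', hFF, hne⟩
    · refine ⟨T.innerApexes, -1, by simp, T.flux_innerApexes hT, fun F' hF' => ?_⟩
      exact ⟨T.apex F, T.mem_innerApexes.2 ⟨F, hF, hFa, rfl⟩,
        hcoarse _ (T.cell_subset_closure F.1 (T.apex_mem_cell F)) F' hF'⟩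
    · obtain ⟨K, i⟩ := F
      obtain ⟨K', j⟩ := F'
      simp only at hFF
      subst hFF
      obtain ⟨l, hl⟩ := T.exists_goodNodes_of_corner hΩ hT hnum
        (fun h => hne (by rw [h])) hF hF'
      exact ⟨{T.vert K l}, 1, by simp, hl, fun F' hF' => ⟨T.vert K l, Finset.mem_singleton_self _,
        hcoarse _ (T.cell_subset_closure K (T.vert_mem_cell K l)) F' hF'⟩⟩

/-! ### Bounds for sums of integrals -/

lemma sum_boundaryFaces_le {b : Fin T.numCells → ℝ} (hb : ∀ K, 0 ≤ b K) :
    ∑ F ∈ T.boundaryFaces, b F.1 ≤ 3 * ∑ K, b K := by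
  calc ∑ F ∈ T.boundaryFaces, b F.1 ≤ ∑ F : Fin T.numCells × Fin 3, b F.1 :=
        Finset.sum_le_sum_of_subset_of_nonneg (Finset.subset_univ _) fun F _ _ => hb F.1
    _ = 3 * ∑ K, b K := by
        rw [Fintype.sum_prod_type, Finset.mul_sum]
        simp

lemma abs_domainIntegral_le {M : ℝ} (hT : T.Regular M) {f : Fin T.numCells → Plane → ℝ}
    {b : Fin T.numCells → ℝ} (hf : ∀ K, ∀ x ∈ T.cell K, |f K x| ≤ b K) :
    |T.domainIntegral f| ≤ discVolume * T.h ^ 2 * ∑ K, b K := by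
  rw [domainIntegral, Finset.mul_sum]
  refine (Finset.abs_sum_le_sum_abs _ _).trans (Finset.sum_le_sum fun K _ => ?_)
  have h1 := norm_setIntegral_le_of_norm_le_const (μ := volume) (f := f K) (C := b K)
    (T.isCompact_cell K).measure_lt_top (hf K)
  have hb : 0 ≤ b K := (abs_nonneg _).trans (hf K _ (T.vert_mem_cell K 0))
  calc _ ≤ b K * volume.real (T.cell K) := h1
    _ ≤ b K * (discVolume * T.h ^ 2) := mul_le_mul_of_nonneg_left (hT.volume_cell_le K) hb
    _ = _ := mul_comm _ _

lemma abs_boundaryIntegral_le {M : ℝ} (hT : T.Regular M) {f : Fin T.numCells × Fin 3 → Plane → ℝ}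
    {b : Fin T.numCells → ℝ} (hb : ∀ K, 0 ≤ b K)
    (hf : ∀ F ∈ T.boundaryFaces, ∀ x ∈ T.face F, |f F x| ≤ b F.1) :
    |T.boundaryIntegral f| ≤ 3 * T.h * ∑ K, b K := by
  rw [boundaryIntegral]
  refine (Finset.abs_sum_le_sum_abs _ _).trans ?_
  calc _ ≤ ∑ F ∈ T.boundaryFaces, T.h * b F.1 := Finset.sum_le_sum fun F hF =>
        (abs_edgeIntegral_le (hf F hF)).trans
          (mul_le_mul_of_nonneg_right (hT.dist_face_le F) (hb F.1))
    _ = T.h * ∑ F ∈ T.boundaryFaces, b F.1 := by rw [Finset.mul_sum]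
    _ ≤ T.h * (3 * ∑ K, b K) :=
        mul_le_mul_of_nonneg_left (T.sum_boundaryFaces_le hb) hT.h_pos.le
    _ = _ := by ring

/-! ### Linearity of the forms in the test function -/

/-- The inflow term, written with a continuous integrand. -/
lemma indicator_inflow_eq (β : Plane → Plane) (n : Plane) (u w : Plane → ℝ) :
    {x | inner ℝ (β x) n < 0}.indicator (fun x => inner ℝ (β x) n * u x * w x)
      = fun x => min (inner ℝ (β x) n) 0 * u x * w x := by
  funext x
  by_cases hx : inner ℝ (β x) n < 0
  · rw [Set.indicator_of_mem (by exact hx), min_eq_left hx.le]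
  · rw [Set.indicator_of_notMem (by exact hx), min_eq_right (not_lt.1 hx)]; ring

lemma domainIntegral_add {f g : Fin T.numCells → Plane → ℝ}
    (hf : ∀ K, ContinuousOn (f K) (T.cell K)) (hg : ∀ K, ContinuousOn (g K) (T.cell K)) (α : ℝ) :
    T.domainIntegral (fun K x => f K x + α * g K x)
      = T.domainIntegral f + α * T.domainIntegral g := by
  simp only [domainIntegral]
  rw [Finset.mul_sum, ← Finset.sum_add_distrib]
  refine Finset.sum_congr rfl fun K _ => ?_
  rw [integral_add ((hf K).integrableOn_compact (T.isCompact_cell K))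
    (((hg K).integrableOn_compact (T.isCompact_cell K)).const_mul α), integral_const_mul]

lemma domainIntegral_congr {f g : Fin T.numCells → Plane → ℝ}
    (h : ∀ K, ∀ x ∈ T.cell K, f K x = g K x) : T.domainIntegral f = T.domainIntegral g :=
  Finset.sum_congr rfl fun K _ =>
    setIntegral_congr_fun (T.isClosed_cell K).measurableSet fun x hx => h K x hx

lemma domainIntegral_mono {f g : Fin T.numCells → Plane → ℝ}
    (hf : ∀ K, ContinuousOn (f K) (T.cell K)) (hg : ∀ K, ContinuousOn (g K) (T.cell K))
    (h : ∀ K, ∀ x ∈ T.cell K, f K x ≤ g K x) : T.domainIntegral f ≤ T.domainIntegral g :=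
  Finset.sum_le_sum fun K _ =>
    setIntegral_mono_on ((hf K).integrableOn_compact (T.isCompact_cell K))
      ((hg K).integrableOn_compact (T.isCompact_cell K)) (T.isClosed_cell K).measurableSet (h K)

lemma boundaryIntegral_add {f g : Fin T.numCells × Fin 3 → Plane → ℝ}
    (hf : ∀ F, ContinuousOn (f F) (T.face F)) (hg : ∀ F, ContinuousOn (g F) (T.face F)) (α : ℝ) :
    T.boundaryIntegral (fun F x => f F x + α * g F x)
      = T.boundaryIntegral f + α * T.boundaryIntegral g := by
  simp only [boundaryIntegral]
  rw [Finset.mul_sum, ← Finset.sum_add_distrib]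
  refine Finset.sum_congr rfl fun F _ => ?_
  have h := edgeIntegral_add (f := f F) (g := fun x => α * g F x) (hf F)
    (continuousOn_const.mul (hg F))
  rw [h, edgeIntegral_const_mul]

lemma boundaryIntegral_congr {f g : Fin T.numCells × Fin 3 → Plane → ℝ}
    (h : ∀ F, ∀ x ∈ T.face F, f F x = g F x) : T.boundaryIntegral f = T.boundaryIntegral g :=
  Finset.sum_congr rfl fun F _ => edgeIntegral_congr fun x hx => h F x hx

lemma boundaryIntegral_mono {f g : Fin T.numCells × Fin 3 → Plane → ℝ}
    (hf : ∀ F, ContinuousOn (f F) (T.face F)) (hg : ∀ F, ContinuousOn (g F) (T.face F))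
    (h : ∀ F, ∀ x ∈ T.face F, f F x ≤ g F x) : T.boundaryIntegral f ≤ T.boundaryIntegral g :=
  Finset.sum_le_sum fun F _ => edgeIntegral_mono (hf F) (hg F) (h F)

lemma continuousOn_face {k : ℕ} {v : Plane → ℝ} (hv : v ∈ T.feSpace k)
    (F : Fin T.numCells × Fin 3) : ContinuousOn v (T.face F) :=
  (T.continuousOn_cell hv F.1).mono (T.face_subset_cell F)

lemma continuousOn_cellGrad_face {k : ℕ} {v : Plane → ℝ} (hv : v ∈ T.feSpace k)
    (F : Fin T.numCells × Fin 3) : ContinuousOn (T.cellGrad v F.1) (T.face F) :=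
  (T.continuousOn_cellGrad hv F.1).mono (T.face_subset_cell F)

lemma convDiffForm_add {β : Plane → Plane} (hβ : ContinuousOn β (closure Ω)) {k : ℕ}
    {v u w : Plane → ℝ} (hv : v ∈ T.feSpace k) (hu : u ∈ T.feSpace k) (hw : w ∈ T.feSpace k)
    (ε α : ℝ) : T.convDiffForm 0 ε β v (fun y => u y + α * w y)
      = T.convDiffForm 0 ε β v u + α * T.convDiffForm 0 ε β v w := by
  have hβK : ∀ K, ContinuousOn β (T.cell K) := fun K => hβ.mono (T.cell_subset_closure K)
  have hβF : ∀ F, ContinuousOn β (T.face F) := fun F => (hβK F.1).mono (T.face_subset_cell F)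
  have hβn : ∀ F, ContinuousOn (fun x => inner ℝ (β x) (T.normal F)) (T.face F) := fun F =>
    (hβF F).inner continuousOn_const
  have d1 : ∀ z : Plane → ℝ, z ∈ T.feSpace k → ∀ K, ContinuousOn
      (fun x => (0 * v x + inner ℝ (β x) (T.cellGrad v K x)) * z x) (T.cell K) := fun z hz K =>
    ((continuousOn_const.mul (T.continuousOn_cell hv K)).add
      ((hβK K).inner (T.continuousOn_cellGrad hv K))).mul (T.continuousOn_cell hz K)
  have d2 : ∀ z : Plane → ℝ, z ∈ T.feSpace k → ∀ F, ContinuousOn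
      (fun x => min (inner ℝ (β x) (T.normal F)) 0 * v x * z x) (T.face F) := fun z hz F =>
    (((hβn F).inf continuousOn_const).mul (T.continuousOn_face hv F)).mul
      (T.continuousOn_face hz F)
  have d3 : ∀ z : Plane → ℝ, z ∈ T.feSpace k → ∀ K, ContinuousOn
      (fun x => inner ℝ (T.cellGrad v K x) (T.cellGrad z K x)) (T.cell K) := fun z hz K =>
    (T.continuousOn_cellGrad hv K).inner (T.continuousOn_cellGrad hz K)
  have d4 : ∀ z : Plane → ℝ, z ∈ T.feSpace k → ∀ F, ContinuousOn
      (fun x => inner ℝ (T.cellGrad v F.1 x) (T.normal F) * z x) (T.face F) := fun z hz F =>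
    ((T.continuousOn_cellGrad_face hv F).inner continuousOn_const).mul (T.continuousOn_face hz F)
  have d5 : ∀ z : Plane → ℝ, z ∈ T.feSpace k → ∀ F, ContinuousOn
      (fun x => v x * inner ℝ (T.cellGrad z F.1 x) (T.normal F)) (T.face F) := fun z hz F =>
    (T.continuousOn_face hv F).mul ((T.continuousOn_cellGrad_face hz F).inner continuousOn_const)
  have e1 := T.domainIntegral_add (d1 u hu) (d1 w hw) α
  have e2 := T.boundaryIntegral_add (d2 u hu) (d2 w hw) α
  have e3 := T.domainIntegral_add (d3 u hu) (d3 w hw) α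
  have e4 := T.boundaryIntegral_add (d4 u hu) (d4 w hw) α
  have e5 := T.boundaryIntegral_add (d5 u hu) (d5 w hw) α
  simp only [convDiffForm, nitscheForm, indicator_inflow_eq]
  have f1 : T.domainIntegral (fun K x => (0 * v x + inner ℝ (β x) (T.cellGrad v K x)) *
      (u x + α * w x)) = _ := (T.domainIntegral_congr fun K x _ => by ring).trans e1
  have f2 : T.boundaryIntegral (fun F x => min (inner ℝ (β x) (T.normal F)) 0 * v x *
      (u x + α * w x)) = _ := (T.boundaryIntegral_congr fun F x _ => by ring).trans e2
  have f3 : T.domainIntegral (fun K x => inner ℝ (T.cellGrad v K x)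
      (T.cellGrad (fun y => u y + α * w y) K x)) = _ :=
    (T.domainIntegral_congr fun K x hx => by
      rw [T.cellGrad_add hu hw α hx, inner_add_right, real_inner_smul_right]).trans e3
  have f4 : T.boundaryIntegral (fun F x => inner ℝ (T.cellGrad v F.1 x) (T.normal F) *
      (u x + α * w x)) = _ := (T.boundaryIntegral_congr fun F x _ => by ring).trans e4
  have f5 : T.boundaryIntegral (fun F x => v x * inner ℝ
      (T.cellGrad (fun y => u y + α * w y) F.1 x) (T.normal F)) = _ :=
    (T.boundaryIntegral_congr fun F x hx => by
      rw [T.cellGrad_add hu hw α (T.face_subset_cell F hx), inner_add_left, real_inner_smul_left]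
      ring).trans e5
  rw [f1, f2, f3, f4, f5]
  ring

/-! ### Norms -/

/-- The boundary part of the squared energy norm. -/
def traceNormSq (v : Plane → ℝ) : ℝ :=
  T.boundaryIntegral fun F x => (T.hK F.1)⁻¹ * v x ^ 2

lemma normSqOneH_eq (v : Plane → ℝ) :
    T.normSqOneH v = ∑ K, T.cellEnergy v K + T.traceNormSq v := rfl

lemma traceNormSq_nonneg (v : Plane → ℝ) : 0 ≤ T.traceNormSq v :=
  Finset.sum_nonneg fun F _ => edgeIntegral_nonneg fun _ _ =>
    mul_nonneg (inv_nonneg.2 (T.hK_pos F.1).le) (sq_nonneg _)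

lemma fluxNormSq_nonneg (β : Plane → Plane) (v : Plane → ℝ) : 0 ≤ T.fluxNormSq β v :=
  Finset.sum_nonneg fun _ _ => edgeIntegral_nonneg fun _ _ =>
    mul_nonneg (abs_nonneg _) (sq_nonneg _)

lemma sum_cellEnergy_nonneg (v : Plane → ℝ) : 0 ≤ ∑ K, T.cellEnergy v K :=
  Finset.sum_nonneg fun K _ => T.cellEnergy_nonneg v K

lemma normSqOneH_nonneg (v : Plane → ℝ) : 0 ≤ T.normSqOneH v :=
  add_nonneg (T.sum_cellEnergy_nonneg v) (T.traceNormSq_nonneg v)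

lemma continuousOn_trace {k : ℕ} {v : Plane → ℝ} (hv : v ∈ T.feSpace k)
    (F : Fin T.numCells × Fin 3) :
    ContinuousOn (fun x => (T.hK F.1)⁻¹ * v x ^ 2) (T.face F) :=
  continuousOn_const.mul ((T.continuousOn_face hv F).pow 2)

lemma abs_inner_normal_le {β : Plane → Plane} {B : ℝ} (hB : ∀ x ∈ closure Ω, ‖β x‖ ≤ B)
    {F : Fin T.numCells × Fin 3} {x : Plane} (hx : x ∈ T.face F) :
    |inner ℝ (β x) (T.normal F)| ≤ B := by
  have h := abs_real_inner_le_norm (β x) (T.normal F)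
  rw [T.norm_normal, mul_one] at h
  exact h.trans (hB x (T.cell_subset_closure F.1 (T.face_subset_cell F hx)))

/-- The Péclet condition enters here: `|β · n| ≤ ε / h ≤ ε / h_K`. The weighted boundary norm is
thus dominated by the trace part of the energy norm. -/
lemma fluxNormSq_le {β : Plane → Plane} (hβ : ContinuousOn β (closure Ω)) {ε : ℝ} (hε : 0 < ε)
    (hB : ∀ x ∈ closure Ω, ‖β x‖ ≤ ε / T.h) {k : ℕ} {v : Plane → ℝ} (hv : v ∈ T.feSpace k) :
    T.fluxNormSq β v ≤ ε * T.traceNormSq v := by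
  have hβF : ∀ F, ContinuousOn β (T.face F) := fun F =>
    hβ.mono ((T.face_subset_cell F).trans (T.cell_subset_closure F.1))
  have h : ε * T.traceNormSq v
      = T.boundaryIntegral fun F x => ε * ((T.hK F.1)⁻¹ * v x ^ 2) := by
    rw [traceNormSq, boundaryIntegral, boundaryIntegral, Finset.mul_sum]
    exact Finset.sum_congr rfl fun F _ => (edgeIntegral_const_mul _ _ _ _).symm
  rw [h, fluxNormSq]
  refine T.boundaryIntegral_mono (fun F => (((hβF F).inner continuousOn_const).abs).mul
    ((T.continuousOn_face hv F).pow 2)) (fun F => continuousOn_const.mul (T.continuousOn_trace hv F))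
    fun F x hx => ?_
  rw [← mul_assoc]
  refine mul_le_mul_of_nonneg_right ?_ (sq_nonneg _)
  refine (T.abs_inner_normal_le hB hx).trans ?_
  rw [div_eq_mul_inv]
  exact mul_le_mul_of_nonneg_left (inv_anti₀ (T.hK_pos F.1) (T.hK_le_h F.1)) hε.le

lemma normBeta_sq (ε : ℝ) (hε : 0 < ε) (β : Plane → Plane) (v : Plane → ℝ) :
    T.normBeta ε β v ^ 2 = ε * T.normSqOneH v + 1 / 2 * T.fluxNormSq β v :=
  Real.sq_sqrt (add_nonneg (mul_nonneg hε.le (T.normSqOneH_nonneg v))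
    (mul_nonneg (by norm_num) (T.fluxNormSq_nonneg β v)))

lemma normBeta_sq_le {β : Plane → Plane} (hβ : ContinuousOn β (closure Ω)) {ε : ℝ} (hε : 0 < ε)
    (hB : ∀ x ∈ closure Ω, ‖β x‖ ≤ ε / T.h) {k : ℕ} {v : Plane → ℝ} (hv : v ∈ T.feSpace k) :
    T.normBeta ε β v ^ 2 ≤ 2 * ε * T.normSqOneH v := by
  rw [T.normBeta_sq ε hε]
  have h1 := T.fluxNormSq_le hβ hε hB hv
  have h2 : ε * T.traceNormSq v ≤ ε * T.normSqOneH v :=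
    mul_le_mul_of_nonneg_left (by rw [normSqOneH_eq]; linarith [T.sum_cellEnergy_nonneg v]) hε.le
  have h3 := mul_nonneg hε.le (T.normSqOneH_nonneg v)
  linarith

lemma normSqOneH_add_le {k : ℕ} {v w : Plane → ℝ} (hv : v ∈ T.feSpace k) (hw : w ∈ T.feSpace k)
    (α : ℝ) : T.normSqOneH (fun y => v y + α * w y)
      ≤ 2 * T.normSqOneH v + 2 * α ^ 2 * T.normSqOneH w := by
  have hvw := T.feSpace_add hv hw α
  have hn : ∀ z : Plane → ℝ, z ∈ T.feSpace k → ∀ K, ContinuousOn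
      (fun x => ‖T.cellGrad z K x‖ ^ 2) (T.cell K) := fun z hz K =>
    (T.continuousOn_cellGrad hz K).norm.pow 2
  have h0 : ∀ a b : ℝ, (a + b) ^ 2 ≤ 2 * a ^ 2 + 2 * b ^ 2 := fun a b => by
    nlinarith [sq_nonneg (a - b)]
  have d1 : T.domainIntegral (fun K x => ‖T.cellGrad (fun y => v y + α * w y) K x‖ ^ 2)
      ≤ 2 * T.domainIntegral (fun K x => ‖T.cellGrad v K x‖ ^ 2)
        + 2 * α ^ 2 * T.domainIntegral (fun K x => ‖T.cellGrad w K x‖ ^ 2) := by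
    -- The summand `0` allows a second use of additivity to extract the factor `2` from the first
    -- term.
    have e := T.domainIntegral_add (f := fun K x => 0 + 2 * ‖T.cellGrad v K x‖ ^ 2)
      (fun K => continuousOn_const.add (continuousOn_const.mul (hn v hv K))) (hn w hw) (2 * α ^ 2)
    have e' := T.domainIntegral_add (f := fun _ _ => 0) (fun _ => continuousOn_const) (hn v hv) 2
    have e0 : T.domainIntegral (fun _ _ => 0) = 0 := by simp [domainIntegral]
    rw [e', e0, zero_add] at e
    rw [← e]
    refine T.domainIntegral_mono (hn _ hvw)
      (fun K => (continuousOn_const.add (continuousOn_const.mul (hn v hv K))).add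
        (continuousOn_const.mul (hn w hw K))) fun K x hx => ?_
    rw [T.cellGrad_add hv hw α hx, zero_add]
    calc ‖T.cellGrad v K x + α • T.cellGrad w K x‖ ^ 2
        ≤ (‖T.cellGrad v K x‖ + |α| * ‖T.cellGrad w K x‖) ^ 2 := by
          refine pow_le_pow_left₀ (norm_nonneg _) ((norm_add_le _ _).trans ?_) 2
          rw [norm_smul, Real.norm_eq_abs]
      _ ≤ _ := h0 _ _
      _ = _ := by rw [mul_pow, sq_abs]; ring
  have d2 : T.traceNormSq (fun y => v y + α * w y)
      ≤ 2 * T.traceNormSq v + 2 * α ^ 2 * T.traceNormSq w := by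
    have e := T.boundaryIntegral_add (f := fun F x => 0 + 2 * ((T.hK F.1)⁻¹ * v x ^ 2))
      (fun F => continuousOn_const.add (continuousOn_const.mul (T.continuousOn_trace hv F)))
      (T.continuousOn_trace hw) (2 * α ^ 2)
    have e' := T.boundaryIntegral_add (f := fun _ _ => 0) (fun _ => continuousOn_const)
      (T.continuousOn_trace hv) 2
    have e0 : T.boundaryIntegral (fun _ _ => 0) = 0 := by simp [boundaryIntegral, edgeIntegral]
    rw [e', e0, zero_add] at e
    simp only [traceNormSq]
    rw [← e]
    refine T.boundaryIntegral_mono (T.continuousOn_trace hvw)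
      (fun F => (continuousOn_const.add (continuousOn_const.mul (T.continuousOn_trace hv F))).add
        (continuousOn_const.mul (T.continuousOn_trace hw F))) fun F x hx => ?_
    have h1 := mul_le_mul_of_nonneg_left (h0 (v x) (α * w x)) (inv_nonneg.2 (T.hK_pos F.1).le)
    linarith
  rw [normSqOneH_eq, normSqOneH_eq, normSqOneH_eq]
  have d1' : ∑ K, T.cellEnergy (fun y => v y + α * w y) K
      ≤ 2 * ∑ K, T.cellEnergy v K + 2 * α ^ 2 * ∑ K, T.cellEnergy w K := d1
  linarith

/-! ### Size of the test function -/

/-- The sum of the absolute nodal values on a triangle. -/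
def nodalSize (g : Plane → ℝ) (K : Fin T.numCells) : ℝ := ∑ j, |g (T.vert K j)|

lemma nodalSize_nonneg (g : Plane → ℝ) (K : Fin T.numCells) : 0 ≤ T.nodalSize g K :=
  Finset.sum_nonneg fun _ _ => abs_nonneg _

lemma abs_interp_le (g : Plane → ℝ) {K : Fin T.numCells} {x : Plane} (hx : x ∈ T.cell K) :
    |T.interp g x| ≤ T.nodalSize g K := by
  rw [T.interp_eq g hx, cellInterp]
  refine (Finset.abs_sum_le_sum_abs _ _).trans (Finset.sum_le_sum fun j _ => ?_)
  rw [abs_mul, abs_of_nonneg (a := T.lam K j x) (T.mem_cell.1 hx j)]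
  exact mul_le_of_le_one_right (abs_nonneg _) (T.lam_le_one hx j)

lemma norm_cellGrad_interp_le {M : ℝ} (hT : T.Regular M) (g : Plane → ℝ) {K : Fin T.numCells}
    {x : Plane} (hx : x ∈ T.cell K) :
    ‖T.cellGrad (T.interp g) K x‖ ≤ M / T.h * T.nodalSize g K := by
  rw [T.cellGrad_interp g hx, nodalSize, Finset.mul_sum]
  refine (norm_sum_le _ _).trans (Finset.sum_le_sum fun j _ => ?_)
  rw [norm_smul, Real.norm_eq_abs, mul_comm]
  exact mul_le_mul_of_nonneg_right (hT.norm_glam_le K j) (abs_nonneg _)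

/-- A node lies in at most `M²` triangles by volume comparison. The factor `9` is `3` from
Cauchy–Schwarz over the three vertices, times `3` because each vertex term is bounded by the sum
over all nodes of `G` in the triangle. -/
lemma sum_nodalSize_sq_le {M : ℝ} (hT : T.Regular M) {G : Finset Plane} {s : ℝ} (hs : |s| = 1)
    (φ : Plane → ℝ) :
    ∑ K, T.nodalSize (nodal G s φ) K ^ 2 ≤ 9 * M ^ 2 * ∑ z ∈ G, φ z ^ 2 := by
  classical
  have h1 : ∀ K, T.nodalSize (nodal G s φ) K ^ 2
      ≤ 9 * ∑ z ∈ G, if z ∈ T.cell K then φ z ^ 2 else 0 := fun K => by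
    have h2 : ∀ j, |nodal G s φ (T.vert K j)| ^ 2
        ≤ ∑ z ∈ G, if z ∈ T.cell K then φ z ^ 2 else 0 := fun j => by
      have h0 : ∀ z ∈ G, 0 ≤ if z ∈ T.cell K then φ z ^ 2 else 0 := fun z _ => by
        split_ifs <;> positivity
      by_cases hj : T.vert K j ∈ G
      · rw [nodal, Set.indicator_of_mem (by exact hj), abs_mul, hs, one_mul, sq_abs]
        refine le_trans ?_ (Finset.single_le_sum h0 hj)
        rw [if_pos (T.vert_mem_cell K j)]
      · rw [nodal, Set.indicator_of_notMem (by exact hj)]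
        simpa using Finset.sum_nonneg h0
    have h3 := sq_sum_le_card_mul_sum_sq (s := Finset.univ)
      (f := fun j => |nodal G s φ (T.vert K j)|)
    have h4 := Finset.sum_le_sum (s := Finset.univ) fun j _ => h2 j
    rw [Finset.sum_const, Finset.card_univ, Fintype.card_fin, nsmul_eq_mul] at h4
    rw [Finset.card_univ, Fintype.card_fin] at h3
    refine h3.trans ?_
    push_cast at h4 ⊢
    linarith
  calc _ ≤ ∑ K, 9 * ∑ z ∈ G, (if z ∈ T.cell K then φ z ^ 2 else 0) :=
        Finset.sum_le_sum fun K _ => h1 K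
    _ = 9 * ∑ z ∈ G, ∑ K, (if z ∈ T.cell K then φ z ^ 2 else 0) := by
        rw [← Finset.mul_sum, Finset.sum_comm]
    _ ≤ 9 * ∑ z ∈ G, M ^ 2 * φ z ^ 2 := by
        refine mul_le_mul_of_nonneg_left (Finset.sum_le_sum fun z _ => ?_) (by norm_num)
        rw [← Finset.sum_filter, Finset.sum_const, nsmul_eq_mul]
        refine mul_le_mul_of_nonneg_right ?_ (sq_nonneg _)
        have h := hT.card_le zero_le_one z (Finset.univ.filter fun K => z ∈ T.cell K)
          fun K hK x hx => by
            rw [one_mul]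
            exact T.dist_le_h hx (Finset.mem_filter.1 hK).2
        rwa [one_mul] at h
    _ = _ := by rw [← Finset.mul_sum]; ring

lemma normSqOneH_interp_le {M : ℝ} (hT : T.Regular M) (g : Plane → ℝ) :
    T.normSqOneH (T.interp g)
      ≤ (discVolume * M ^ 2 + 3 * M) * ∑ K, T.nodalSize g K ^ 2 := by
  have hh := hT.h_pos
  have hM := hT.M_pos
  have h1 := T.abs_domainIntegral_le hT (f := fun K x => ‖T.cellGrad (T.interp g) K x‖ ^ 2)
    (b := fun K => (M / T.h) ^ 2 * T.nodalSize g K ^ 2) fun K x hx => by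
      rw [abs_of_nonneg (sq_nonneg _), ← mul_pow]
      exact pow_le_pow_left₀ (norm_nonneg _) (T.norm_cellGrad_interp_le hT g hx) 2
  have h2 := T.abs_boundaryIntegral_le hT (f := fun F x => (T.hK F.1)⁻¹ * T.interp g x ^ 2)
    (b := fun K => M / T.h * T.nodalSize g K ^ 2) (fun K => by positivity) fun F _ x hx => by
      have hp := T.hK_pos F.1
      rw [abs_of_nonneg (by positivity)]
      refine mul_le_mul ?_ ?_ (sq_nonneg _) (by positivity)
      · rw [inv_eq_one_div, div_le_div_iff₀ hp hh, one_mul]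
        exact hT.h_le F.1
      · rw [← sq_abs]
        exact pow_le_pow_left₀ (abs_nonneg _) (T.abs_interp_le g (T.face_subset_cell F hx)) 2
  rw [← Finset.mul_sum] at h1 h2
  have e1 : discVolume * T.h ^ 2 * ((M / T.h) ^ 2 * ∑ K, T.nodalSize g K ^ 2)
      = discVolume * M ^ 2 * ∑ K, T.nodalSize g K ^ 2 := by field_simp
  have e2 : 3 * T.h * (M / T.h * ∑ K, T.nodalSize g K ^ 2)
      = 3 * M * ∑ K, T.nodalSize g K ^ 2 := by field_simp
  rw [e1] at h1
  rw [e2] at h2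
  rw [normSqOneH, add_mul]
  exact add_le_add ((le_abs_self _).trans h1) ((le_abs_self _).trans h2)

lemma fluxNormSq_interp_le {M : ℝ} (hT : T.Regular M) {β : Plane → Plane} {ε : ℝ} (hε : 0 < ε)
    (hB : ∀ x ∈ closure Ω, ‖β x‖ ≤ ε / T.h) (g : Plane → ℝ) :
    T.fluxNormSq β (T.interp g) ≤ 3 * ε * ∑ K, T.nodalSize g K ^ 2 := by
  have hh := hT.h_pos
  have h2 := T.abs_boundaryIntegral_le hT
    (f := fun F x => |inner ℝ (β x) (T.normal F)| * T.interp g x ^ 2)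
    (b := fun K => ε / T.h * T.nodalSize g K ^ 2) (fun K => by positivity) fun F _ x hx => by
      rw [abs_of_nonneg (by positivity)]
      refine mul_le_mul (T.abs_inner_normal_le hB hx) ?_ (sq_nonneg _) (by positivity)
      rw [← sq_abs]
      exact pow_le_pow_left₀ (abs_nonneg _) (T.abs_interp_le g (T.face_subset_cell F hx)) 2
  rw [← Finset.mul_sum] at h2
  refine ((le_abs_self _).trans h2).trans (le_of_eq ?_)
  field_simp

/-! ### The form evaluated at the test function -/

/-- Testing the boundary flux of a piecewise linear function against `v` gives the values of `v`
at the good nodes, up to the oscillation of `v`. -/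
lemma GoodNodes.le_boundaryIntegral_flux {T : Triangulation Ω} {M R : ℝ} {G : Finset Plane} {s : ℝ}
    (hG : T.GoodNodes M R G s) (hT : T.Regular M) {k : ℕ} {v : Plane → ℝ} (hv : v ∈ T.feSpace k)
    {o : Fin T.numCells → ℝ} (ho : ∀ K, ∀ x ∈ T.cell K, ∀ y ∈ T.cell K, |v x - v y| ≤ o K) :
    1 / M * ∑ z ∈ G, v z ^ 2 - 3 * M * ∑ K, o K * T.nodalSize (nodal G s v) K ≤
      T.boundaryIntegral (fun F x => v x *
        inner ℝ (T.cellGrad (T.interp (nodal G s v)) F.1 x) (T.normal F)) := by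
  have hh := hT.h_pos
  have hM := hT.M_pos
  have ho0 : ∀ K, 0 ≤ o K := fun K =>
    (abs_nonneg _).trans (ho K _ (T.vert_mem_cell K 0) _ (T.vert_mem_cell K 0))
  set g := nodal G s v with hg
  -- The gradient of the interpolant is constant on a triangle, so only `v` is integrated. Replacing
  -- `v` by its value at vertex `j` costs at most its oscillation; slope `M / h` and length `h`
  -- balance.
  have key : ∀ F, |edgeIntegral (T.faceA F) (T.faceB F) (fun x => v x *
        inner ℝ (T.cellGrad (T.interp g) F.1 x) (T.normal F))
      - ∑ j, g (T.vert F.1 j) * v (T.vert F.1 j) *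
        (dist (T.faceA F) (T.faceB F) * inner ℝ (T.glam F.1 j) (T.normal F))|
      ≤ M * (o F.1 * T.nodalSize g F.1) := fun F => by
    have hvF := T.continuousOn_face hv F
    have e1 : edgeIntegral (T.faceA F) (T.faceB F) (fun x => v x *
        inner ℝ (T.cellGrad (T.interp g) F.1 x) (T.normal F))
        = ∑ j, g (T.vert F.1 j) * inner ℝ (T.glam F.1 j) (T.normal F) *
          edgeIntegral (T.faceA F) (T.faceB F) v := by
      rw [← Finset.sum_mul, ← edgeIntegral_const_mul]
      refine edgeIntegral_congr fun x hx => ?_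
      rw [T.cellGrad_interp g (T.face_subset_cell F hx), sum_inner, mul_comm]
      simp only [real_inner_smul_left]
    rw [e1, ← Finset.sum_sub_distrib, nodalSize, Finset.mul_sum, Finset.mul_sum]
    refine (Finset.abs_sum_le_sum_abs _ _).trans (Finset.sum_le_sum fun j _ => ?_)
    have e2 : g (T.vert F.1 j) * inner ℝ (T.glam F.1 j) (T.normal F) *
          edgeIntegral (T.faceA F) (T.faceB F) v - g (T.vert F.1 j) * v (T.vert F.1 j) *
          (dist (T.faceA F) (T.faceB F) * inner ℝ (T.glam F.1 j) (T.normal F))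
        = g (T.vert F.1 j) * (inner ℝ (T.glam F.1 j) (T.normal F) *
          edgeIntegral (T.faceA F) (T.faceB F) (fun x => v x - v (T.vert F.1 j))) := by
      rw [edgeIntegral_sub hvF continuousOn_const, edgeIntegral_const]; ring
    have h1 : |inner ℝ (T.glam F.1 j) (T.normal F)| ≤ M / T.h := by
      have h := abs_real_inner_le_norm (T.glam F.1 j) (T.normal F)
      rw [T.norm_normal, mul_one] at h
      exact h.trans (hT.norm_glam_le F.1 j)
    have h2 : |edgeIntegral (T.faceA F) (T.faceB F) (fun x => v x - v (T.vert F.1 j))|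
        ≤ T.h * o F.1 :=
      (abs_edgeIntegral_le fun x hx => ho F.1 x (T.face_subset_cell F hx) _
        (T.vert_mem_cell F.1 j)).trans (mul_le_mul_of_nonneg_right (hT.dist_face_le F) (ho0 _))
    rw [e2, abs_mul, abs_mul]
    calc _ ≤ |g (T.vert F.1 j)| * (M / T.h * (T.h * o F.1)) :=
          mul_le_mul_of_nonneg_left (mul_le_mul h1 h2 (abs_nonneg _) (by positivity))
            (abs_nonneg _)
      _ = _ := by field_simp
  have h3 : ∑ F ∈ T.boundaryFaces, (∑ j, g (T.vert F.1 j) * v (T.vert F.1 j) *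
        (dist (T.faceA F) (T.faceB F) * inner ℝ (T.glam F.1 j) (T.normal F)))
      - ∑ F ∈ T.boundaryFaces, M * (o F.1 * T.nodalSize g F.1)
      ≤ T.boundaryIntegral (fun F x => v x *
        inner ℝ (T.cellGrad (T.interp g) F.1 x) (T.normal F)) := by
    rw [boundaryIntegral, ← Finset.sum_sub_distrib]
    refine Finset.sum_le_sum fun F _ => ?_
    have := (abs_le.1 (key F)).1
    linarith
  have h4 := T.sum_boundaryFaces_le (b := fun K => M * (o K * T.nodalSize g K))
    fun K => mul_nonneg hM.le (mul_nonneg (ho0 K) (T.nodalSize_nonneg g K))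
  rw [← Finset.mul_sum Finset.univ, ← mul_assoc] at h4
  have h5 := (hG.flux v).trans_eq (by rw [← hg])
  linarith

/-- Young's inequality with weight `|β · n|`. The coefficient `1 / 2` in front of the part in `v` is
the one provided by the diagonal term, which absorbs it completely. -/
lemma mul_inflow_le {β : Plane → Plane} (hβ : ContinuousOn β (closure Ω)) {k : ℕ}
    {v w : Plane → ℝ} (hv : v ∈ T.feSpace k) (hw : w ∈ T.feSpace k) (α : ℝ) :
    α * T.boundaryIntegral (fun F => {x | inner ℝ (β x) (T.normal F) < 0}.indicator
        fun x => inner ℝ (β x) (T.normal F) * v x * w x)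
      ≤ 1 / 2 * T.fluxNormSq β v + 1 / 2 * α ^ 2 * T.fluxNormSq β w := by
  have hβn : ∀ F, ContinuousOn (fun x => inner ℝ (β x) (T.normal F)) (T.face F) := fun F =>
    (hβ.mono ((T.face_subset_cell F).trans (T.cell_subset_closure F.1))).inner continuousOn_const
  simp only [indicator_inflow_eq, fluxNormSq, boundaryIntegral, Finset.mul_sum,
    ← Finset.sum_add_distrib]
  refine Finset.sum_le_sum fun F _ => ?_
  have c1 : ∀ z : Plane → ℝ, z ∈ T.feSpace k → ∀ c : ℝ, ContinuousOn
      (fun x => c * (|inner ℝ (β x) (T.normal F)| * z x ^ 2)) (T.face F) := fun z hz c =>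
    continuousOn_const.mul ((hβn F).abs.mul ((T.continuousOn_face hz F).pow 2))
  rw [← edgeIntegral_const_mul, ← edgeIntegral_const_mul, ← edgeIntegral_const_mul,
    ← edgeIntegral_add (c1 v hv _) (c1 w hw _)]
  refine edgeIntegral_mono (continuousOn_const.mul ((((hβn F).inf continuousOn_const).mul
    (T.continuousOn_face hv F)).mul (T.continuousOn_face hw F)))
    ((c1 v hv _).add (c1 w hw _)) fun x _ => ?_
  set b := inner ℝ (β x) (T.normal F)
  have h1 : |min b 0| ≤ |b| := by
    rcases le_total b 0 with h | h
    · rw [min_eq_left h]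
    · rw [min_eq_right h, abs_zero]; exact abs_nonneg _
  have h2 : |v x * (α * w x)| ≤ 1 / 2 * v x ^ 2 + 1 / 2 * (α * w x) ^ 2 := by
    rw [abs_le]
    constructor <;> nlinarith [sq_nonneg (v x + α * w x), sq_nonneg (v x - α * w x)]
  calc α * (min b 0 * v x * w x) = min b 0 * (v x * (α * w x)) := by ring
    _ ≤ |min b 0| * |v x * (α * w x)| := by rw [← abs_mul]; exact le_abs_self _
    _ ≤ |b| * (1 / 2 * v x ^ 2 + 1 / 2 * (α * w x) ^ 2) :=
        mul_le_mul h1 h2 (abs_nonneg _) (abs_nonneg _)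
    _ = _ := by ring

/-- Lower bound for the form at `v` and the function `v + α w`, where `w` interpolates the values
of `v` at the good nodes. -/
lemma GoodNodes.convDiffForm_ge {T : Triangulation Ω} {M R : ℝ} {G : Finset Plane} {s : ℝ}
    (hG : T.GoodNodes M R G s) (hT : T.Regular M) (hΩ : IsOpen Ω)
    (hreg : interior (closure Ω) = Ω) {β : Plane → Plane} (hβ : IsAdmissibleVelocity Ω 0 β)
    {ε : ℝ} (hε : 0 < ε) (hB : ∀ x ∈ closure Ω, ‖β x‖ ≤ ε / T.h) {k : ℕ} (hk : 1 ≤ k)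
    {v : Plane → ℝ} (hv : v ∈ T.feSpace k) {o : Fin T.numCells → ℝ}
    (ho : ∀ K, ∀ x ∈ T.cell K, ‖T.cellGrad v K x‖ ≤ o K / T.h) {α : ℝ} (hα : 0 ≤ α) :
    ε * (∑ K, T.cellEnergy v K + α / M * ∑ z ∈ G, v z ^ 2
        - α * (discVolume + discVolume * M + 3 + 3 * M) *
          ∑ K, o K * T.nodalSize (nodal G s v) K
        - 3 / 2 * α ^ 2 * ∑ K, T.nodalSize (nodal G s v) K ^ 2)
      ≤ T.convDiffForm 0 ε β v (fun y => v y + α * T.interp (nodal G s v) y) := by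
  have hh := hT.h_pos
  have hM := hT.M_pos
  have hosc : ∀ K, ∀ x ∈ T.cell K, ∀ y ∈ T.cell K, |v x - v y| ≤ o K := fun K x hx y hy =>
    T.abs_sub_le_of_cellGrad_le hv hh (ho K) hx hy
  have ho0 : ∀ K, 0 ≤ o K := fun K =>
    (abs_nonneg _).trans (hosc K _ (T.vert_mem_cell K 0) _ (T.vert_mem_cell K 0))
  have h5 := hG.le_boundaryIntegral_flux hT hv hosc
  set g := nodal G s v with hg
  have hw : T.interp g ∈ T.feSpace k := T.interp_mem_feSpace g hk
  have h0 := T.convDiffForm_self_ge hΩ hreg hβ hv ε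
  have h2 := T.mul_inflow_le hβ.continuousOn hv hw α
  have h2' := T.fluxNormSq_interp_le hT hε hB g
  have h1 := T.abs_domainIntegral_le hT
    (f := fun K x => (0 * v x + inner ℝ (β x) (T.cellGrad v K x)) * T.interp g x)
    (b := fun K => ε / T.h ^ 2 * (o K * T.nodalSize g K)) fun K x hx => by
      rw [zero_mul, zero_add, abs_mul]
      have e1 : |inner ℝ (β x) (T.cellGrad v K x)| ≤ ε / T.h * (o K / T.h) :=
        (abs_real_inner_le_norm _ _).trans (mul_le_mul (hB x (T.cell_subset_closure K hx))
          (ho K x hx) (norm_nonneg _) (by positivity))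
      calc _ ≤ ε / T.h * (o K / T.h) * T.nodalSize g K :=
            mul_le_mul e1 (T.abs_interp_le g hx) (abs_nonneg _)
              (mul_nonneg (by positivity) (div_nonneg (ho0 K) hh.le))
        _ = _ := by field_simp
  have h3 := T.abs_domainIntegral_le hT
    (f := fun K x => inner ℝ (T.cellGrad v K x) (T.cellGrad (T.interp g) K x))
    (b := fun K => M / T.h ^ 2 * (o K * T.nodalSize g K)) fun K x hx => by
      calc _ ≤ ‖T.cellGrad v K x‖ * ‖T.cellGrad (T.interp g) K x‖ := abs_real_inner_le_norm _ _
        _ ≤ o K / T.h * (M / T.h * T.nodalSize g K) :=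
            mul_le_mul (ho K x hx) (T.norm_cellGrad_interp_le hT g hx) (norm_nonneg _)
              (div_nonneg (ho0 K) hh.le)
        _ = _ := by field_simp
  have h4 := T.abs_boundaryIntegral_le hT
    (f := fun F x => inner ℝ (T.cellGrad v F.1 x) (T.normal F) * T.interp g x)
    (b := fun K => 1 / T.h * (o K * T.nodalSize g K))
    (fun K => mul_nonneg (by positivity) (mul_nonneg (ho0 K) (T.nodalSize_nonneg g K)))
    fun F _ x hx => by
      have hx' := T.face_subset_cell F hx
      rw [abs_mul]
      have e1 : |inner ℝ (T.cellGrad v F.1 x) (T.normal F)| ≤ o F.1 / T.h := by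
        have h := abs_real_inner_le_norm (T.cellGrad v F.1 x) (T.normal F)
        rw [T.norm_normal, mul_one] at h
        exact h.trans (ho F.1 x hx')
      calc _ ≤ o F.1 / T.h * T.nodalSize g F.1 :=
            mul_le_mul e1 (T.abs_interp_le g hx') (abs_nonneg _) (div_nonneg (ho0 _) hh.le)
        _ = _ := by field_simp
  rw [← Finset.mul_sum] at h1 h3 h4
  rw [T.convDiffForm_add hβ.continuousOn hv hv hw]
  set S := ∑ K, o K * T.nodalSize g K
  have r1 : discVolume * T.h ^ 2 * (ε / T.h ^ 2 * S) = ε * (discVolume * S) := by field_simp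
  have r3 : discVolume * T.h ^ 2 * (M / T.h ^ 2 * S) = discVolume * M * S := by field_simp
  have r4 : 3 * T.h * (1 / T.h * S) = 3 * S := by field_simp
  rw [r1] at h1
  rw [r3] at h3
  rw [r4] at h4
  have g1 := mul_le_mul_of_nonneg_left (abs_le.1 h1).1 hα
  have g3 := mul_le_mul_of_nonneg_left (abs_le.1 h3).1 (mul_nonneg hα hε.le)
  have g4 := mul_le_mul_of_nonneg_left (abs_le.1 h4).2 (mul_nonneg hα hε.le)
  have g5 := mul_le_mul_of_nonneg_left h5 (mul_nonneg hα hε.le)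
  have g2 := mul_le_mul_of_nonneg_left h2' (by positivity : 0 ≤ 1 / 2 * α ^ 2)
  generalize T.convDiffForm 0 ε β v v = A₀ at *
  rw [convDiffForm, nitscheForm]
  generalize T.domainIntegral (fun K x => (0 * v x + inner ℝ (β x) (T.cellGrad v K x)) *
    T.interp g x) = I₁ at *
  generalize T.boundaryIntegral (fun F => {x | inner ℝ (β x) (T.normal F) < 0}.indicator
    fun x => inner ℝ (β x) (T.normal F) * v x * T.interp g x) = I₂ at *
  generalize T.domainIntegral (fun K x => inner ℝ (T.cellGrad v K x)
    (T.cellGrad (T.interp g) K x)) = I₃ at *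
  generalize T.boundaryIntegral (fun F x => inner ℝ (T.cellGrad v F.1 x) (T.normal F) *
    T.interp g x) = I₄ at *
  generalize T.boundaryIntegral (fun F x => v x *
    inner ℝ (T.cellGrad (T.interp g) F.1 x) (T.normal F)) = I₅ at *
  -- The boundary terms in `v` from `h0` and `h2` cancel; the convection, gradient and the two
  -- Nitsche boundary terms give the four summands of the constant in front of `S`, and the inflow
  -- part in `w` gives `3 / 2 * α ^ 2`.
  linear_combination h0 + h2 + g1 + g2 + g3 + g4 + g5

/-! ### Control of the boundary values -/

open Classical in
lemma Regular.card_faces_le {T : Triangulation Ω} {M : ℝ} (hT : T.Regular M) {R : ℝ} (hR : 0 ≤ R)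
    (x : Plane) : (((Finset.univ : Finset (Fin T.numCells × Fin 3)).filter
      fun F => dist (T.faceA F) x ≤ R * T.h).card : ℝ) ≤ 3 * ((R + 1) * M) ^ 2 := by
  set s := (Finset.univ : Finset (Fin T.numCells)).filter
    fun K => T.cell K ⊆ Metric.closedBall x ((R + 1) * T.h) with hs
  have h1 : ((Finset.univ : Finset (Fin T.numCells × Fin 3)).filter
      fun F => dist (T.faceA F) x ≤ R * T.h) ⊆ s ×ˢ Finset.univ := fun F hF => by
    rw [Finset.mem_filter] at hF
    rw [Finset.mem_product, hs, Finset.mem_filter]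
    refine ⟨⟨Finset.mem_univ _, fun y hy => ?_⟩, Finset.mem_univ _⟩
    rw [Metric.mem_closedBall]
    have := T.dist_le_h hy (T.faceA_mem_cell F)
    linarith [dist_triangle y (T.faceA F) x, hF.2]
  have h2 := Finset.card_le_card h1
  rw [Finset.card_product, Finset.card_univ, Fintype.card_fin] at h2
  have h3 := hT.card_le (by linarith : 0 ≤ R + 1) x s fun K hK => (Finset.mem_filter.1 hK).2
  have h4 : ((((Finset.univ : Finset (Fin T.numCells × Fin 3)).filter
      fun F => dist (T.faceA F) x ≤ R * T.h).card : ℕ) : ℝ) ≤ s.card * 3 := by exact_mod_cast h2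
  linarith

/-- The boundary values of a finite element function are controlled by its values at the good
nodes and its oscillation. -/
lemma GoodNodes.traceNormSq_le {T : Triangulation Ω} {M R : ℝ} {G : Finset Plane} {s : ℝ}
    (hG : T.GoodNodes M R G s) (hT : T.Regular M) (hR : 0 ≤ R) {k : ℕ} {v : Plane → ℝ}
    (hv : v ∈ T.feSpace k) {o : Fin T.numCells → ℝ}
    (ho : ∀ K, ∀ x ∈ T.cell K, ∀ y ∈ T.cell K, |v x - v y| ≤ o K) :
    T.traceNormSq v ≤ 6 * ((R + 2) * M) ^ 2 * ∑ z ∈ G, v z ^ 2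
      + 24 * (((R + 2) * M) ^ 2) ^ 2 * ∑ K, o K ^ 2 := by
  classical
  have hh := hT.h_pos
  have hM := hT.M_pos
  have ho0 : ∀ K, 0 ≤ o K := fun K =>
    (abs_nonneg _).trans (ho K _ (T.vert_mem_cell K 0) _ (T.vert_mem_cell K 0))
  -- This one number bounds the triangles within radius `(R + 1) h` and, up to the factor `3`, the
  -- faces starting within `R h` or `(R + 1) h` of a point.
  set n := ((R + 2) * M) ^ 2 with hn
  have hmono : ((R + 1) * M) ^ 2 ≤ n :=
    pow_le_pow_left₀ (by positivity) (mul_le_mul_of_nonneg_right (by linarith) hM.le) 2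
  let N : Fin T.numCells × Fin 3 → Finset (Fin T.numCells) := fun F =>
    Finset.univ.filter fun K => T.cell K ⊆ Metric.closedBall (T.faceA F) ((R + 1) * T.h)
  have hmem : ∀ F K x, x ∈ T.cell K → dist x (T.faceA F) ≤ R * T.h → K ∈ N F :=
    fun F K x hx hd => by
      refine Finset.mem_filter.2 ⟨Finset.mem_univ _, fun y hy => ?_⟩
      rw [Metric.mem_closedBall]
      have := T.dist_le_h hy hx
      linarith [dist_triangle y x (T.faceA F)]
  have hpt : ∀ F ∈ T.boundaryFaces, edgeIntegral (T.faceA F) (T.faceB F)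
      (fun x => (T.hK F.1)⁻¹ * v x ^ 2)
      ≤ 2 * (∑ z ∈ G, if dist (T.faceA F) z ≤ R * T.h then v z ^ 2 else 0)
        + 8 * n * ∑ K ∈ N F, o K ^ 2 := fun F hF => by
    obtain ⟨z, hz, S, hS, hSΩ, hSR, hAS, hzS⟩ := hG.near F hF
    have hz2 : v z ^ 2 ≤ ∑ z ∈ G, if dist (T.faceA F) z ≤ R * T.h then v z ^ 2 else 0 := by
      refine le_trans ?_ (Finset.single_le_sum (f := fun z =>
        if dist (T.faceA F) z ≤ R * T.h then v z ^ 2 else 0)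
        (fun z _ => by split_ifs <;> positivity) hz)
      rw [if_pos (by rw [dist_comm]; exact hSR hzS)]
    have hsum : |v (T.faceA F) - v z| ≤ ∑ K ∈ N F, o K := by
      refine (T.abs_sub_le_sum_of_isPreconnected hv.1 ho hS hSΩ hAS hzS).trans
        (Finset.sum_le_sum_of_subset_of_nonneg (fun K hK => ?_) fun K _ _ => ho0 K)
      obtain ⟨x, hxS, hxK⟩ := (Finset.mem_filter.1 hK).2
      exact hmem F K x hxK (hSR hxS)
    have hF1 : o F.1 ≤ ∑ K ∈ N F, o K :=
      Finset.single_le_sum (fun K _ => ho0 K)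
        (hmem F F.1 _ (T.faceA_mem_cell F) (by rw [dist_self]; positivity))
    have hcs : (∑ K ∈ N F, o K) ^ 2 ≤ n * ∑ K ∈ N F, o K ^ 2 :=
      sq_sum_le_card_mul_sum_sq.trans (mul_le_mul_of_nonneg_right
        ((hT.card_le (by linarith : 0 ≤ R + 1) (T.faceA F) (N F)
          fun K hK => (Finset.mem_filter.1 hK).2).trans hmono)
        (Finset.sum_nonneg fun _ _ => sq_nonneg _))
    set q := ∑ K ∈ N F, o K with hq
    -- From `x` to the end point of the face, and from there to the good node: each step costs at
    -- most `q`, hence `2 v(z)² + 2 (2 q)²`.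
    have hvx : ∀ x ∈ T.face F, v x ^ 2 ≤ 2 * v z ^ 2 + 8 * q ^ 2 := fun x hx => by
      have h1 := ho F.1 x (T.face_subset_cell F hx) _ (T.faceA_mem_cell F)
      have h2 : |v x - v z| ≤ 2 * q := by
        have := abs_sub_le (v x) (v (T.faceA F)) (v z)
        linarith
      have h3 : (v x - v z) ^ 2 ≤ (2 * q) ^ 2 := by
        rw [← sq_abs]
        exact pow_le_pow_left₀ (abs_nonneg _) h2 2
      nlinarith [sq_nonneg (v x - 2 * v z)]
    have hp := T.hK_pos F.1
    have h4 := abs_edgeIntegral_le (a := T.faceA F) (b := T.faceB F)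
      (f := fun x => (T.hK F.1)⁻¹ * v x ^ 2) (c := (T.hK F.1)⁻¹ * (2 * v z ^ 2 + 8 * q ^ 2))
      fun x hx => by
        rw [abs_of_nonneg (by positivity)]
        exact mul_le_mul_of_nonneg_left (hvx x hx) (by positivity)
    have h5 : dist (T.faceA F) (T.faceB F) * (T.hK F.1)⁻¹ ≤ 1 := by
      rw [← div_eq_mul_inv, div_le_one hp]
      exact T.dist_le_hK (T.faceA_mem_cell F) (T.faceB_mem_cell F)
    have h6 : dist (T.faceA F) (T.faceB F) * ((T.hK F.1)⁻¹ * (2 * v z ^ 2 + 8 * q ^ 2))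
        ≤ 2 * v z ^ 2 + 8 * q ^ 2 := by
      rw [← mul_assoc]
      exact mul_le_of_le_one_left (by positivity) h5
    linarith [(le_abs_self _).trans h4]
  have hA : ∑ F ∈ T.boundaryFaces, ∑ z ∈ G, (if dist (T.faceA F) z ≤ R * T.h then v z ^ 2 else 0)
      ≤ 3 * n * ∑ z ∈ G, v z ^ 2 := by
    rw [Finset.sum_comm, Finset.mul_sum]
    refine Finset.sum_le_sum fun z _ => ?_
    rw [← Finset.sum_filter, Finset.sum_const, nsmul_eq_mul]
    refine mul_le_mul_of_nonneg_right ?_ (sq_nonneg _)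
    have h1 : ((T.boundaryFaces.filter fun F => dist (T.faceA F) z ≤ R * T.h).card : ℝ)
        ≤ ((Finset.univ.filter fun F => dist (T.faceA F) z ≤ R * T.h).card : ℝ) := by
      exact_mod_cast Finset.card_le_card
        (Finset.filter_subset_filter _ (Finset.subset_univ _))
    linarith [hT.card_faces_le hR z]
  have hB : ∑ F ∈ T.boundaryFaces, ∑ K ∈ N F, o K ^ 2 ≤ 3 * n * ∑ K, o K ^ 2 := by
    have e : ∀ F, ∑ K ∈ N F, o K ^ 2
        = ∑ K, if T.cell K ⊆ Metric.closedBall (T.faceA F) ((R + 1) * T.h) then o K ^ 2 else 0 :=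
      fun F => Finset.sum_filter _ _
    simp only [e]
    rw [Finset.sum_comm, Finset.mul_sum]
    refine Finset.sum_le_sum fun K _ => ?_
    rw [← Finset.sum_filter, Finset.sum_const, nsmul_eq_mul]
    refine mul_le_mul_of_nonneg_right ?_ (sq_nonneg _)
    have h1 : ((T.boundaryFaces.filter fun F =>
          T.cell K ⊆ Metric.closedBall (T.faceA F) ((R + 1) * T.h)).card : ℝ)
        ≤ ((Finset.univ.filter fun F =>
          dist (T.faceA F) (T.vert K 0) ≤ (R + 1) * T.h).card : ℝ) := by
      refine Nat.cast_le.2 (Finset.card_le_card fun F hF => ?_)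
      rw [Finset.mem_filter] at hF ⊢
      refine ⟨Finset.mem_univ _, ?_⟩
      rw [dist_comm]
      exact hF.2 (T.vert_mem_cell K 0)
    have h2 := hT.card_faces_le (by linarith : 0 ≤ R + 1) (T.vert K 0)
    rw [add_assoc, one_add_one_eq_two, ← hn] at h2
    linarith
  have hsum : T.traceNormSq v ≤ ∑ F ∈ T.boundaryFaces,
      (2 * (∑ z ∈ G, if dist (T.faceA F) z ≤ R * T.h then v z ^ 2 else 0)
        + 8 * n * ∑ K ∈ N F, o K ^ 2) := Finset.sum_le_sum hpt
  rw [Finset.sum_add_distrib, ← Finset.mul_sum, ← Finset.mul_sum] at hsum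
  have hn0 : 0 ≤ n := sq_nonneg _
  have := mul_le_mul_of_nonneg_left hB (by positivity : 0 ≤ 8 * n)
  linear_combination hsum + 2 * hA + this

/-! ### Functions of norm zero -/

lemma const_mem_feSpace (c : ℝ) (k : ℕ) : (fun _ => c) ∈ T.feSpace k :=
  ⟨continuousOn_const, fun _ => ⟨MvPolynomial.C c, by simp, fun x _ => by simp⟩⟩

lemma traceNormSq_const (c : ℝ) : T.traceNormSq (fun _ => c)
    = (∑ F ∈ T.boundaryFaces, dist (T.faceA F) (T.faceB F) * (T.hK F.1)⁻¹) * c ^ 2 := by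
  rw [traceNormSq, boundaryIntegral, Finset.sum_mul]
  refine Finset.sum_congr rfl fun F _ => ?_
  rw [edgeIntegral_const, mul_assoc]

lemma normSqOneH_const_pos (hne : T.boundaryFaces.Nonempty) {c : ℝ} (hc : c ≠ 0) :
    0 < T.normSqOneH (fun _ => c) := by
  rw [normSqOneH_eq, T.traceNormSq_const]
  refine add_pos_of_nonneg_of_pos (T.sum_cellEnergy_nonneg _) (mul_pos ?_ (by positivity))
  exact Finset.sum_pos (fun F _ => mul_pos (T.dist_face_pos F) (inv_pos.2 (T.hK_pos F.1))) hne

lemma normBeta_pos {ε : ℝ} (hε : 0 < ε) (β : Plane → Plane) {v : Plane → ℝ}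
    (h : 0 < T.normSqOneH v) : 0 < T.normBeta ε β v :=
  Real.sqrt_pos.2 (add_pos_of_pos_of_nonneg (mul_pos hε h)
    (mul_nonneg (by norm_num) (T.fluxNormSq_nonneg β v)))

lemma normSqOneH_congr {v w : Plane → ℝ} (h : Set.EqOn v w (closure Ω)) :
    T.normSqOneH v = T.normSqOneH w := by
  have hg : ∀ K, ∀ x ∈ T.cell K, T.cellGrad v K x = T.cellGrad w K x := fun K x hx => by
    have hK := h.mono (T.cell_subset_closure K)
    rw [cellGrad, cellGrad, gradientWithin, gradientWithin, fderivWithin_congr hK (hK hx)]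
  rw [normSqOneH, normSqOneH]
  congr 1
  · exact T.domainIntegral_congr fun K x hx => by rw [hg K x hx]
  · exact T.boundaryIntegral_congr fun F x hx => by rw [h (T.face_subset_closure F hx)]

lemma convDiffForm_eq_zero {w : Plane → ℝ} (h : ∀ x ∈ closure Ω, w x = 0) (σ ε : ℝ)
    (β : Plane → Plane) (v : Plane → ℝ) : T.convDiffForm σ ε β v w = 0 := by
  have hg : ∀ K, ∀ x ∈ T.cell K, T.cellGrad w K x = 0 := fun K x hx => by
    have hK : Set.EqOn w (fun _ => 0) (T.cell K) := fun y hy => h y (T.cell_subset_closure K hy)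
    rw [cellGrad, gradientWithin, fderivWithin_congr hK (hK hx)]
    simp
  have hd : T.domainIntegral (fun _ _ => 0) = 0 := by simp [domainIntegral]
  have hb : T.boundaryIntegral (fun _ _ => 0) = 0 := by simp [boundaryIntegral, edgeIntegral]
  have e1 : T.domainIntegral (fun K x => (σ * v x + inner ℝ (β x) (T.cellGrad v K x)) * w x) = 0 :=
    (T.domainIntegral_congr fun K x hx => by
      rw [h x (T.cell_subset_closure K hx), mul_zero]).trans hd
  have e2 : T.boundaryIntegral (fun F x => min (inner ℝ (β x) (T.normal F)) 0 * v x * w x) = 0 :=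
    (T.boundaryIntegral_congr fun F x hx => by
      rw [h x (T.face_subset_closure F hx), mul_zero]).trans hb
  have e3 : T.domainIntegral (fun K x => inner ℝ (T.cellGrad v K x) (T.cellGrad w K x)) = 0 :=
    (T.domainIntegral_congr fun K x hx => by rw [hg K x hx, inner_zero_right]).trans hd
  have e4 : T.boundaryIntegral
      (fun F x => inner ℝ (T.cellGrad v F.1 x) (T.normal F) * w x) = 0 :=
    (T.boundaryIntegral_congr fun F x hx => by
      rw [h x (T.face_subset_closure F hx), mul_zero]).trans hb
  have e5 : T.boundaryIntegral
      (fun F x => v x * inner ℝ (T.cellGrad w F.1 x) (T.normal F)) = 0 :=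
    (T.boundaryIntegral_congr fun F x hx => by
      rw [hg F.1 x (T.face_subset_cell F hx), inner_zero_left, mul_zero]).trans hb
  simp only [convDiffForm, nitscheForm, indicator_inflow_eq]
  rw [e1, e2, e3, e4, e5]
  ring

/-- A finite element function of energy norm zero vanishes. -/
lemma eq_zero_of_normSqOneH_eq_zero {M : ℝ} (hT : T.Regular M) (hΩ : IsPreconnected Ω)
    (hne : T.boundaryFaces.Nonempty) {k : ℕ} {w : Plane → ℝ} (hw : w ∈ T.feSpace k)
    (h : T.normSqOneH w = 0) : ∀ x ∈ closure Ω, w x = 0 := by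
  classical
  rw [normSqOneH_eq] at h
  have hE : ∀ K, T.cellEnergy w K = 0 := fun K =>
    le_antisymm (by
      have := Finset.single_le_sum (fun K _ => T.cellEnergy_nonneg w K) (Finset.mem_univ K)
      linarith [T.traceNormSq_nonneg w]) (T.cellEnergy_nonneg w K)
  obtain ⟨C, -, hC⟩ := exists_inverse_estimate k hT.M_pos
  have hosc : ∀ K, ∀ x ∈ T.cell K, ∀ y ∈ T.cell K, |w x - w y| ≤ 0 := fun K x hx y hy =>
    T.abs_sub_le_of_cellGrad_le hw hT.h_pos (fun z hz => by
      have h1 := hC Ω T hT w hw K z hz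
      rw [hE K, mul_zero] at h1
      have h2 : ‖T.cellGrad w K z‖ ^ 2 ≤ 0 := by
        by_contra hcon
        exact absurd h1 (not_le.2 (mul_pos (pow_pos hT.h_pos 2) (not_le.1 hcon)))
      rw [zero_div]
      exact (pow_eq_zero_iff two_ne_zero).1 (le_antisymm h2 (sq_nonneg _)) |>.le) hx hy
  obtain ⟨F, hF⟩ := hne
  -- All oscillations vanish, so `w` is constant on the connected closure; a nonzero constant would
  -- have a positive boundary norm.
  have hcon : Set.EqOn w (fun _ => w (T.faceA F)) (closure Ω) := fun x hx => by
    have := T.abs_sub_le_sum_of_isPreconnected hw.1 (o := fun _ => 0) hosc hΩ.closure subset_rfl hx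
      (T.cell_subset_closure F.1 (T.faceA_mem_cell F))
    rw [Finset.sum_const_zero] at this
    exact sub_eq_zero.1 (abs_eq_zero.1 (le_antisymm this (abs_nonneg _)))
  by_cases hc : w (T.faceA F) = 0
  · exact fun x hx => (hcon hx).trans hc
  · have h1 := T.normSqOneH_const_pos ⟨F, hF⟩ hc
    rw [← T.normSqOneH_congr hcon, normSqOneH_eq, h] at h1
    exact absurd h1 (lt_irrefl _)

end Triangulation

/-- For small `α` the form dominates its perturbation terms. -/
lemma exists_step_size {M C C₅ : ℝ} (hM : 0 < M) (hC : 0 ≤ C) (hC₅ : 0 < C₅) :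
    ∃ α, 0 < α ∧ α ≤ 1 ∧ ∀ X Y S P : ℝ, 0 ≤ X → 0 ≤ Y → P ≤ 9 * M ^ 2 * X →
      (∀ l, 0 < l → S ≤ 1 / 2 * (l * (C * Y) + P / l)) →
      Y / 2 + α * X / (2 * M) ≤ Y + α / M * X - α * C₅ * S - 3 / 2 * α ^ 2 * P := by
  -- With this weight, `P ≤ 9 M² X` turns the `P` part of Young's inequality into a quarter of `α X
  -- / M`. The bound `a` keeps the `Y` part below `Y / 2`, and `b` keeps the term of order `α²`
  -- below another quarter.
  set l := 18 * M ^ 3 * C₅ with hl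
  have hl0 : 0 < l := by positivity
  set a := 1 / (C₅ * l * C + 1) with ha
  set b := 1 / (54 * M ^ 3) with hb
  have ha0 : 0 < a := by positivity
  have hb0 : 0 < b := by positivity
  refine ⟨min a (min b 1), by positivity, (min_le_right _ _).trans (min_le_right _ _),
    fun X Y S P hX hY hP hS => ?_⟩
  set α := min a (min b 1) with hα
  have hα0 : 0 < α := by positivity
  have h1 : α * (C₅ * l * C) ≤ 1 := by
    calc α * (C₅ * l * C) ≤ a * (C₅ * l * C + 1) :=
          mul_le_mul (min_le_left _ _) (by linarith) (by positivity) ha0.le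
      _ = 1 := by rw [ha]; field_simp
  have h2 : α * (54 * M ^ 3) ≤ 1 := by
    calc α * (54 * M ^ 3) ≤ b * (54 * M ^ 3) :=
          mul_le_mul_of_nonneg_right ((min_le_right _ _).trans (min_le_left _ _)) (by positivity)
      _ = 1 := by rw [hb]; field_simp
  have h3 : α * C₅ * S ≤ 1 / 2 * Y + α * X / (4 * M) := by
    calc α * C₅ * S ≤ α * C₅ * (1 / 2 * (l * (C * Y) + P / l)) :=
          mul_le_mul_of_nonneg_left (hS l hl0) (by positivity)
      _ = 1 / 2 * (α * (C₅ * l * C) * Y) + α * P / (36 * M ^ 3) := by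
          rw [hl]; field_simp; ring
      _ ≤ 1 / 2 * (1 * Y) + α * (9 * M ^ 2 * X) / (36 * M ^ 3) := by gcongr
      _ = _ := by field_simp; ring
  have h4 : 3 / 2 * α ^ 2 * P ≤ α * X / (4 * M) := by
    calc 3 / 2 * α ^ 2 * P ≤ 3 / 2 * α ^ 2 * (9 * M ^ 2 * X) :=
          mul_le_mul_of_nonneg_left hP (by positivity)
      _ = (α * (54 * M ^ 3)) * (α * X / (4 * M)) := by field_simp; ring
      _ ≤ 1 * (α * X / (4 * M)) := mul_le_mul_of_nonneg_right h2 (by positivity)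
      _ = _ := one_mul _
  have h5 : α / M * X = α * X / (2 * M) + α * X / (4 * M) + α * X / (4 * M) := by
    field_simp; ring
  linarith

/-! ### Choice of the test function and the inf-sup bound. -/

namespace Triangulation

variable {Ω : Set Plane}

/-- For every finite element function there is a test function at which the form dominates the
product of the norms. -/
lemma exists_test_function {m : ℕ} {p : Fin m → Plane} {next : Equiv.Perm (Fin m)}
    (hΩ : IsPolygonalDomain Ω p next) {k : ℕ} (hk : 1 ≤ k) {M : ℝ} (hM : 0 < M) :
    ∃ c, 0 < c ∧ ∀ T : Triangulation Ω, T.Regular M → 1 < T.numCells → T.ResolvesBoundary →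
      ∀ (ε : ℝ) (β : Plane → Plane), 0 < ε → IsAdmissibleVelocity Ω 0 β →
        (∀ x ∈ closure Ω, ‖β x‖ ≤ ε / T.h) → ∀ v ∈ T.feSpace k, ∃ w ∈ T.feSpace k,
          c * T.normBeta ε β v ^ 2 ≤ T.convDiffForm 0 ε β v w ∧
          c * T.normBeta ε β v * T.normBeta ε β w ≤ T.convDiffForm 0 ε β v w := by
  obtain ⟨R, hR, hgood⟩ := exists_goodNodes hΩ
  obtain ⟨C, hC0, hC⟩ := exists_inverse_estimate k hM
  have hω := discVolume_pos
  obtain ⟨α, hα0, hα1, hα⟩ := exists_step_size (C₅ := discVolume + discVolume * M + 3 + 3 * M)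
    hM hC0 (by positivity)
  set n := ((R + 2) * M) ^ 2 with hn
  have hn0 : 0 ≤ n := sq_nonneg _
  set C₇ := 1 + 6 * n + 24 * n ^ 2 * C with hC₇
  have hC₇0 : 0 < C₇ := by positivity
  set C₉ := (discVolume * M ^ 2 + 3 * M) * (9 * M ^ 2) with hC₉
  have hC₉0 : 0 < C₉ := by positivity
  set c₁ := min (1 / 2) (α / (2 * M)) with hc₁
  have hc₁0 : 0 < c₁ := by positivity
  refine ⟨c₁ / (4 * (C₇ + C₉)), by positivity,
    fun T hT hnum hres ε β hε hβ hB v hv => ?_⟩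
  have hh := hT.h_pos
  obtain ⟨G, s, hG⟩ := hgood T M hT hnum hres
  set o : Fin T.numCells → ℝ := fun K => Real.sqrt (C * T.cellEnergy v K) with ho
  have ho2 : ∀ K, o K ^ 2 = C * T.cellEnergy v K := fun K =>
    Real.sq_sqrt (mul_nonneg hC0 (T.cellEnergy_nonneg v K))
  have hgrad : ∀ K, ∀ x ∈ T.cell K, ‖T.cellGrad v K x‖ ≤ o K / T.h := fun K x hx => by
    rw [le_div_iff₀ hh, mul_comm]
    refine Real.le_sqrt_of_sq_le ?_
    rw [mul_pow]
    exact hC Ω T hT v hv K x hx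
  have hosc : ∀ K, ∀ x ∈ T.cell K, ∀ y ∈ T.cell K, |v x - v y| ≤ o K := fun K x hx y hy =>
    T.abs_sub_le_of_cellGrad_le hv hh (hgrad K) hx hy
  set X := ∑ z ∈ G, v z ^ 2 with hX
  set Y := ∑ K, T.cellEnergy v K with hY
  have hX0 : 0 ≤ X := Finset.sum_nonneg fun _ _ => sq_nonneg _
  have hY0 : 0 ≤ Y := T.sum_cellEnergy_nonneg v
  have hoY : ∑ K, o K ^ 2 = C * Y := by
    rw [hY, Finset.mul_sum]
    exact Finset.sum_congr rfl fun K _ => ho2 K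
  set g := nodal G s v with hg
  have hP : ∑ K, T.nodalSize g K ^ 2 ≤ 9 * M ^ 2 * X := T.sum_nodalSize_sq_le hT hG.abs_sign v
  have hS : ∀ l : ℝ, 0 < l → ∑ K, o K * T.nodalSize g K
      ≤ 1 / 2 * (l * (C * Y) + (∑ K, T.nodalSize g K ^ 2) / l) := fun l hl => by
    rw [← hoY, Finset.mul_sum, Finset.sum_div, ← Finset.sum_add_distrib, Finset.mul_sum]
    refine Finset.sum_le_sum fun K _ => ?_
    have h1 : 0 ≤ (l * o K - T.nodalSize g K) ^ 2 / l := by positivity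
    have h2 : (l * o K - T.nodalSize g K) ^ 2 / l
        = l * o K ^ 2 + T.nodalSize g K ^ 2 / l - 2 * (o K * T.nodalSize g K) := by
      field_simp; ring
    linarith
  have hw : T.interp g ∈ T.feSpace k := T.interp_mem_feSpace g hk
  have hvw := T.feSpace_add hv hw α
  have hA := hG.convDiffForm_ge hT hΩ.isOpen hΩ.regular hβ hε hB hk hv hgrad hα0.le
  have hnv : T.normSqOneH v ≤ C₇ * (X + Y) := by
    rw [normSqOneH_eq]
    have h1 := hG.traceNormSq_le hT hR.le hv hosc
    rw [hoY, ← hn] at h1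
    have h2 : 0 ≤ (1 + 24 * n ^ 2 * C) * X + 6 * n * Y := by positivity
    rw [hC₇]
    linear_combination h1 + h2
  have hnw : T.normSqOneH (T.interp g) ≤ C₉ * X := by
    refine (T.normSqOneH_interp_le hT g).trans ?_
    rw [hC₉, mul_assoc _ (9 * M ^ 2) X]
    exact mul_le_mul_of_nonneg_left hP (by positivity)
  have hnvw : T.normSqOneH (fun y => v y + α * T.interp g y) ≤ 2 * (C₇ + C₉) * (X + Y) := by
    refine (T.normSqOneH_add_le hv hw α).trans ?_
    have h1 : α ^ 2 * T.normSqOneH (T.interp g) ≤ 1 * (C₉ * X) :=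
      mul_le_mul (pow_le_one₀ hα0.le hα1) hnw (T.normSqOneH_nonneg _) zero_le_one
    have h2 := mul_nonneg hC₉0.le hY0
    linear_combination 2 * hnv + 2 * h1 + 2 * h2
  -- A common bound for the squared norms of `v` and of the test function. The form is at least a
  -- fixed multiple of `D`, and the product of the norms is at most `D` as well.
  set D := 4 * (C₇ + C₉) * (ε * (X + Y)) with hD
  have hbv : T.normBeta ε β v ^ 2 ≤ D := by
    have h1 := T.normBeta_sq_le hβ.continuousOn hε hB hv
    have h2 := mul_le_mul_of_nonneg_left hnv (by positivity : 0 ≤ 2 * ε)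
    have h3 : 0 ≤ (2 * C₇ + 4 * C₉) * (ε * (X + Y)) := by positivity
    rw [hD]
    linear_combination h1 + h2 + h3
  have hbw : T.normBeta ε β (fun y => v y + α * T.interp g y) ^ 2 ≤ D := by
    have h1 := T.normBeta_sq_le hβ.continuousOn hε hB hvw
    have h2 := mul_le_mul_of_nonneg_left hnvw (by positivity : 0 ≤ 2 * ε)
    rw [hD]
    linear_combination h1 + h2
  have hlow : c₁ / (4 * (C₇ + C₉)) * D
      ≤ T.convDiffForm 0 ε β v (fun y => v y + α * T.interp g y) := by
    refine le_trans ?_ hA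
    have e : c₁ / (4 * (C₇ + C₉)) * D = ε * (c₁ * (X + Y)) := by rw [hD]; field_simp
    rw [e]
    refine mul_le_mul_of_nonneg_left (le_trans ?_ (hα X Y _ _ hX0 hY0 hP hS)) hε.le
    have h1 : c₁ * Y ≤ 1 / 2 * Y := mul_le_mul_of_nonneg_right (min_le_left _ _) hY0
    have h2 : c₁ * X ≤ α / (2 * M) * X := mul_le_mul_of_nonneg_right (min_le_right _ _) hX0
    have h3 : α / (2 * M) * X = α * X / (2 * M) := by ring
    linarith
  refine ⟨_, hvw, le_trans (mul_le_mul_of_nonneg_left hbv (by positivity)) hlow, ?_⟩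
  refine le_trans ?_ hlow
  rw [mul_assoc]
  refine mul_le_mul_of_nonneg_left ?_ (by positivity)
  nlinarith [sq_nonneg (T.normBeta ε β v - T.normBeta ε β (fun y => v y + α * T.interp g y))]

lemma ResolvesBoundary.boundaryFaces_nonempty {T : Triangulation Ω} (h : T.ResolvesBoundary) :
    T.boundaryFaces.Nonempty := by
  rcases h with ⟨F, hF, -⟩ | ⟨F, hF, -⟩
  exacts [⟨F, hF⟩, ⟨F, hF⟩]

/-- The inf-sup quotient is nonnegative, as constants are admissible test functions. -/
lemma exists_convDiffForm_nonneg (T : Triangulation Ω) (hne : T.boundaryFaces.Nonempty)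
    {β : Plane → Plane} (hβ : ContinuousOn β (closure Ω)) {ε : ℝ} (hε : 0 < ε) {k : ℕ}
    {v : Plane → ℝ} (hv : v ∈ T.feSpace k) : ∃ w ∈ T.feSpace k, T.normBeta ε β w ≠ 0 ∧
      0 ≤ T.convDiffForm 0 ε β v w := by
  have h1 := T.const_mem_feSpace 1 k
  rcases le_total 0 (T.convDiffForm 0 ε β v fun _ => 1) with h | h
  · exact ⟨_, h1, (T.normBeta_pos hε β (T.normSqOneH_const_pos hne one_ne_zero)).ne', h⟩
  -- The function `1 + (-2) * 1` is the constant `-1`, which reverses the sign of the form.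
  · refine ⟨_, T.feSpace_add h1 h1 (-2), (T.normBeta_pos hε β
      (T.normSqOneH_const_pos hne (by norm_num))).ne', ?_⟩
    rw [T.convDiffForm_add hβ hv h1 h1]
    linarith

/-- A triangle has three faces, so five faces on one side need a second triangle. This excludes a
mesh of one triangle, for which the corner argument fails. -/
lemma one_lt_numCells {m : ℕ} {p : Fin m → Plane} {next : Equiv.Perm (Fin m)}
    (hΩ : IsPolygonalDomain Ω p next) (T : Triangulation Ω) (hne : T.boundaryFaces.Nonempty)
    (h : ∀ i, 5 ≤ (T.facesIn (segment ℝ (p i) (p (next i)))).card) : 1 < T.numCells := by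
  obtain ⟨F, hF⟩ := hne
  have hA := T.mem_boundaryFaces.1 hF (T.faceA_mem_face F)
  rw [hΩ.frontier_eq] at hA
  obtain ⟨i, -⟩ := Set.mem_iUnion.1 hA
  have h1 := (h i).trans (Finset.card_le_univ _)
  rw [Fintype.card_prod, Fintype.card_fin, Fintype.card_fin] at h1
  omega

end Triangulation

end

/-- Discrete inf-sup condition in the diffusion dominated regime. The constant `cs` depends only on
the domain, the polynomial degree and the shape regularity and quasi-uniformity constants. The
supremum is taken in the extended reals, over the `w` in `V_h^k` with nonzero norm. -/
theorem mainTheorem4 (Ω : Set Plane) (m : ℕ) (p : Fin m → Plane) (next : Equiv.Perm (Fin m))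
    (hΩ : IsPolygonalDomain Ω p next) (k : ℕ) (hk : 1 ≤ k) (cρ cq : ℝ) :
    ∃ cs : ℝ, 0 < cs ∧
      ∀ T : Triangulation Ω, T.ShapeRegular cρ → T.QuasiUniform cq →
        (∀ i, 5 ≤ (T.facesIn (segment ℝ (p i) (p (next i)))).card) →
        T.ResolvesBoundary →
        ∀ (ε : ℝ) (β : Plane → Plane), 0 < ε → IsAdmissibleVelocity Ω 0 β →
          (∀ x ∈ Ω, ‖β x‖ * T.h / ε < 1) →
          ∀ v ∈ T.feSpace k,
            ((cs * T.normBeta ε β v : ℝ) : EReal) ≤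
              ⨆ w ∈ {w | w ∈ T.feSpace k ∧ T.normBeta ε β w ≠ 0},
                ((T.convDiffForm 0 ε β v w / T.normBeta ε β w : ℝ) : EReal) := by
  have hM := lt_of_lt_of_le (zero_lt_one' ℝ)
    (one_le_mul_of_one_le_of_one_le (le_max_left 1 cρ) (le_max_left 1 cq))
  obtain ⟨c, hc, htest⟩ := Triangulation.exists_test_function hΩ hk
    (mul_pos (two_pos (α := ℝ)) hM)
  refine ⟨c, hc, fun T hρ hq hfaces hres ε β hε hβ hPe v hv => ?_⟩
  have hne := hres.boundaryFaces_nonempty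
  have hnum := Triangulation.one_lt_numCells hΩ T hne hfaces
  have hT := T.regular_of_shapeRegular hρ hq ⟨⟨0, by omega⟩⟩
  -- The Péclet condition holds in `Ω`; continuity extends it, as a weak inequality, to the closure
  -- and so to the boundary integrals.
  have hB : ∀ x ∈ closure Ω, ‖β x‖ ≤ ε / T.h := fun _ hx =>
    le_on_closure (fun y hy => by
      have h := hPe y hy
      rw [div_lt_one hε] at h
      rw [le_div_iff₀ hT.h_pos]
      exact h.le) hβ.continuousOn.norm continuousOn_const hx
  obtain ⟨w, hw, h1, h2⟩ := htest T hT hnum hres ε β hε hβ hB v hv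
  -- A test function of norm zero vanishes on the closure, and so does the form at it. Then `v` has
  -- norm zero, and it remains to see that the supremum is nonnegative.
  by_cases hw0 : T.normBeta ε β w = 0
  · have hn : T.normSqOneH w = 0 := by
      by_contra hcon
      exact (T.normBeta_pos hε β
        (lt_of_le_of_ne (T.normSqOneH_nonneg w) (Ne.symm hcon))).ne' hw0
    have hz := T.eq_zero_of_normSqOneH_eq_zero hT hΩ.isConnected.isPreconnected hne hw hn
    rw [T.convDiffForm_eq_zero hz] at h1
    have hv0 : T.normBeta ε β v = 0 :=
      (pow_eq_zero_iff two_ne_zero).1 (le_antisymm (by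
        by_contra hcon
        exact absurd h1 (not_le.2 (mul_pos hc (not_le.1 hcon)))) (sq_nonneg _))
    obtain ⟨u, hu, hu0, hpos⟩ := T.exists_convDiffForm_nonneg hne hβ.continuousOn hε hv
    refine le_iSup₂_of_le u ⟨hu, hu0⟩ (EReal.coe_le_coe_iff.2 ?_)
    rw [hv0, mul_zero]
    exact div_nonneg hpos (Real.sqrt_nonneg _)
  · refine le_iSup₂_of_le w ⟨hw, hw0⟩ (EReal.coe_le_coe_iff.2 ?_)
    have hpos : 0 < T.normBeta ε β w := lt_of_le_of_ne (Real.sqrt_nonneg _) (Ne.symm hw0)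
    rw [le_div_iff₀ hpos]
    exact h2
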